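/- **Theorem (regularity of the flow).** Let $f\in C^1(\mathbb R)$, let $u_0\in L^\infty(\mathbb R)\cap \mathrm{BV}_{\mathrm{loc}}(\mathbb R)$, and let $u\in L^\infty(\mathbb R\times\mathbb R_+)$ be the entropy solution of $$\partial_t u+\partial_x f(u)=0,\qquad u(\cdot,0)=u_0,$$ that is, for every nonnegative $\varphi\in C_c^\infty(\mathbb R\times[0,\infty))$ and every entropy pair ($\eta$ convex, $q$ locally Lipschitz with $q'=\eta' f'$ a.e.) one has $$\int_0^\infty\!\!\int_{\mathbb R}\big(\eta(u)\,\partial_t\varphi+q(u)\,\partial_x\varphi\big)\,dx\,dt+\int_{\mathbb R}\eta(u_0(x))\,\varphi(x,0)\,dx\ \ge\ 0,$$ and equality holds for $(\eta,q)=(\mathrm{id},f)$ and all $\varphi\in C_c^\infty(\mathbb R\times[0,\infty))$. Let $c\in\mathbb R$, let $[a,b]$ be a compact interval with $c\in[a,b]$ and $u_0(x)\in[a,b]$ for a.e. $x$, and assume that $f'$ is Lipschitz continuous on $[a,b]$ with constant $L\ge 0$. (This holds, for all such $c,a,b$, if $f'$ is globally $L$-Lipschitz; and such an $L$ always exists if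 $f\in C^2(\mathbb R)$.) Set $a_c(x,t)=A(u(x,t),c)$, where $A(v,c)=\frac{f(v)-f(c)}{v-c}$ for $v\ne c$ and $A(c,c)=f'(c)$. A *Filippov solution* of $\dot x=a_c(x,t)$ on $[s,\infty)$ is a locally absolutely continuous function $t\mapsto x_t$ such that, for a.e. $t>s$, $$\lim_{\delta\downarrow0}\operatorname*{ess\,inf}_{|y-x_t|<\delta}a_c(y,t)\ \le\ \dot x_t\ \le\ \lim_{\delta\downarrow0}\operatorname*{ess\,sup}_{|y-x_t|<\delta}a_c(y,t).$$ A *Filippov flow* of $a_c$ is a (Borel) measurable function $X_t(x,s)$, defined for $x\in\mathbb R$, $0\le s\le t$, such that $X_s(x,s)=x$, each $t\mapsto X_t(x,s)$ is a Filippov solution on $[s,\infty)$, and $X_t(X_\tau(x,s),\tau)=X_t(x,s)$ for $0\le s\le\tau\le t$. Then $a_c$ has exactly one Filippov flow $X^c$, and: 1. $X^c$ is Lipschitz continuous in $t$, uniformly in $(x,s)$: there is $M\geq 0$ such that, for all $x\in\mathbb R$ and $s\ge0$, $t\mapsto X^c_t(x,s)$ is $M$-Lipschitz on $[s,\infty)$.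 2. For all $x,y\in\mathbb R$ and $0\le s\le t$, $$|X^c_t(y,s)-X^c_t(x,s)|\ \le\ |y-x|+2\sqrt{L\,(t-s)\,\|u_0-c\|_{L^\infty}\,|y-x|}.$$ 3. $X^c$ is locally $\tfrac12$-Hölder continuous in $x$: for all $T,R$ there is $C$ such that $|X^c_t(y,s)-X^c_t(x,s)|\le C|y-x|^{1/2}$ whenever $0\le s\le t\le T$ and $|y-x|\le R$. 4. $X^c$ is locally $\tfrac12$-Hölder continuous in $s$: for every $T$ there is $C$ such that $|X^c_t(x,s_2)-X^c_t(x,s_1)|\le C|s_2-s_1|^{1/2}$ for all $x\in\mathbb R$, $s_1,s_2\ge0$ and $t$ with $\max(s_1,s_2)\le t\le T$. -/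

import Mathlib

open MeasureTheory Set Filter Topology
open scoped NNReal ENNReal

noncomputable section

namespace ConservationLaw

/-- The closed half plane of points `(x, t)`, `x ∈ ℝ`, `t ≥ 0`. -/
def halfPlane : Set (ℝ × ℝ) := {p | 0 ≤ p.2}

/-- The derivative of `φ` in its first (space) variable. -/
def dx (φ : ℝ × ℝ → ℝ) (p : ℝ × ℝ) : ℝ := fderiv ℝ φ p (1, 0)

/-- The derivative of `φ` in its second (time) variable. -/
def dt (φ : ℝ × ℝ → ℝ) (p : ℝ × ℝ) : ℝ := fderiv ℝ φ p (0, 1)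

/-- Test functions: restrictions to the closed half plane of smooth compactly supported
functions on the plane. They need not vanish at `t = 0`. -/
structure IsTestFunction (φ : ℝ × ℝ → ℝ) : Prop where
  smooth : ContDiff ℝ (⊤ : ℕ∞) φ
  compact : HasCompactSupport φ

/-- `u ∈ L^∞(ℝ × ℝ₊)` is a weak solution of `∂ₜu + ∂ₓf(u) = 0`, `u(·, 0) = u₀`. -/
structure IsWeakSolution (f : ℝ → ℝ) (u₀ : ℝ → ℝ) (u : ℝ × ℝ → ℝ) : Prop where
  memLp : MemLp u ⊤ (volume.restrict halfPlane)
  weak : ∀ φ : ℝ × ℝ → ℝ, IsTestFunction φ →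
    (∫ p in halfPlane, (u p * dt φ p + f (u p) * dx φ p)) + ∫ x, u₀ x * φ (x, 0) = 0

/-- An entropy pair: `η` is convex and `q' = η' f'`. As `η` need not be differentiable
everywhere (only off a countable set, with locally bounded derivative), the second relation is
imposed in integrated form, i.e. `q` is locally Lipschitz and `q' = η' f'` almost everywhere. -/
structure IsEntropyPair (f η q : ℝ → ℝ) : Prop where
  convex : ConvexOn ℝ univ η
  flux : ∀ v w : ℝ, q w - q v = ∫ r in v..w, deriv η r * deriv f r

/-- Entropy solutions: weak solutions satisfying the entropy inequality for all entropy pairs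
and all test functions that are nonnegative on the half plane. -/
structure IsEntropySolution (f : ℝ → ℝ) (u₀ : ℝ → ℝ) (u : ℝ × ℝ → ℝ) : Prop
    extends IsWeakSolution f u₀ u where
  entropy : ∀ η q : ℝ → ℝ, IsEntropyPair f η q →
    ∀ φ : ℝ × ℝ → ℝ, IsTestFunction φ → (∀ p ∈ halfPlane, 0 ≤ φ p) →
      0 ≤ (∫ p in halfPlane, (η (u p) * dt φ p + q (u p) * dx φ p)) + ∫ x, η (u₀ x) * φ (x, 0)

/-- `v ∈ BV_loc(ℝ)`: `v` is locally integrable and its distributional derivative is a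
(signed) Radon measure, written as a difference `μ - ν` of locally finite Borel measures. -/
def IsBVLoc (v : ℝ → ℝ) : Prop :=
  LocallyIntegrable v volume ∧
    ∃ μ ν : Measure ℝ, IsLocallyFiniteMeasure μ ∧ IsLocallyFiniteMeasure ν ∧
      ∀ φ : ℝ → ℝ, ContDiff ℝ (⊤ : ℕ∞) φ → HasCompactSupport φ →
        ∫ x, v x * deriv φ x = -((∫ x, φ x ∂μ) - ∫ x, φ x ∂ν)

/-- The velocity field `a_c(x, t) = A(u(x, t), c)`, where `A(v, c) = (f v - f c) / (v - c)` for
`v ≠ c` and `A(c, c) = f' c`. -/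
def velocity (f : ℝ → ℝ) (u : ℝ × ℝ → ℝ) (c : ℝ) (p : ℝ × ℝ) : ℝ :=
  if u p = c then deriv f c else (f (u p) - f c) / (u p - c)

/-- The lower envelope `lim_{δ ↓ 0} ess inf_{|y - x| < δ} a(y, t)`, as an extended real. The
essential infimum increases as `δ` decreases, so that the limit is a supremum. -/
def lowerEnvelope (a : ℝ × ℝ → ℝ) (x t : ℝ) : EReal :=
  ⨆ (δ : ℝ) (_ : 0 < δ), essInf (fun y : ℝ => (a (y, t) : EReal))
    (volume.restrict (Metric.ball x δ))

/-- The upper envelope `lim_{δ ↓ 0} ess sup_{|y - x| < δ} a(y, t)`, as an extended real. -/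
def upperEnvelope (a : ℝ × ℝ → ℝ) (x t : ℝ) : EReal :=
  ⨅ (δ : ℝ) (_ : 0 < δ), essSup (fun y : ℝ => (a (y, t) : EReal))
    (volume.restrict (Metric.ball x δ))

/-- `ξ` is a Filippov solution of `ξ' = a(ξ, t)` on `[s, ∞)`: it is locally absolutely
continuous there and `ξ'` lies between the two envelopes for almost every `t > s`. The values
`ξ t` with `t < s` play no role. -/
structure IsFilippovSolution (a : ℝ × ℝ → ℝ) (s : ℝ) (ξ : ℝ → ℝ) : Prop where
  absCont : ∀ T, s ≤ T → AbsolutelyContinuousOnInterval ξ s T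
  inclusion : ∀ᵐ t ∂(volume.restrict (Ioi s)), DifferentiableAt ℝ ξ t ∧
    lowerEnvelope a (ξ t) t ≤ ((deriv ξ t : ℝ) : EReal) ∧
    ((deriv ξ t : ℝ) : EReal) ≤ upperEnvelope a (ξ t) t

/-- The triples `(t, x, s)` with `0 ≤ s ≤ t`. -/
def flowDomain : Set (ℝ × ℝ × ℝ) := {p | 0 ≤ p.2.2 ∧ p.2.2 ≤ p.1}

/-- `X t x s` is a Filippov flow generated by `a`; only its values for `0 ≤ s ≤ t` matter. -/
structure IsFilippovFlow (a : ℝ × ℝ → ℝ) (X : ℝ → ℝ → ℝ → ℝ) : Prop where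
  measurable : Measurable (fun p : flowDomain => X p.1.1 p.1.2.1 p.1.2.2)
  initial : ∀ x s, 0 ≤ s → X s x s = x
  solution : ∀ x s, 0 ≤ s → IsFilippovSolution a s (fun t => X t x s)
  semigroup : ∀ x s τ t, 0 ≤ s → s ≤ τ → τ ≤ t → X t (X τ x s) τ = X t x s

end ConservationLaw

end

/-!
# Regularity of the generalised characteristics of a scalar conservation law

The flow of `a_c` is controlled by the entropy `|u - c|` and its perturbations. Between two
curves that move with the velocity `A(u, c)` the mass of `|u - c|` cannot grow, but this says nothing
about the distance of the curves where `u` is close to `c`. It is therefore perturbed to the mass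
of `E = ε + dist(u, [c - ε, c + ε])`, which lies between `ε d` and `(M + ε) d` if `d` is the distance
of the curves and `M = ‖u₀ - c‖`. Relative to the motion of a generalised characteristic, the flux of
`E` into either side is at most `L ε² / 2` (`flux_le_of_jump`), because `f'` is `L`-Lipschitz. So the mass
between two Filippov solutions grows at most with speed `L ε²`, whence
`ε d(t) ≤ (M + ε) d(s) + L ε² (t - s)` (`IsTracedSolution.eps_mul_le`). Optimising over `ε`
(`le_two_sqrt_of_forall`) gives the quantitative estimate (`IsTracedSolution.abs_sub_le`). Uniqueness,
the semigroup property, joint continuity and the Hölder estimates follow from it and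
the boundedness of the velocity (`IsStableFamily`). Existence holds for every bounded Borel velocity: the Euler polygons for velocities
averaged over short intervals converge along a subsequence to a Filippov solution
(`exists_filippovSolution`).

To make sense of the flux through a curve, `u(·, t)` needs one-sided limits at almost every time. The
solution is extended by the initial datum to negative times, where the flux is switched off; this
turns the initial value problem into Kruzhkov inequalities on the whole plane
(`IsEntropySolution.exists_kruzkov`), and the maximum principle keeps the values in the interval that
contains the initial values. Doubling of variables yields Kato's inequality for two such extensions
(`IsKruzkov.kato`), initial data included. Applied to a solution and its translates in space, together
with finite speed of propagation (`IsPlaneSubsolution.exists_ae_cone_le`), it propagates the local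
`L¹`-Lipschitz bound for translates of a `BV` datum to almost every time, and a bounded function with
that property has one-sided limits up to null sets (`hasTraces_of_integral_translate_le`).

The weak inequalities may be tested with cut-offs of strips between Lipschitz curves. A strip that
shrinks to a single curve gives the entropy inequality for the traces there
(`IsPlaneSubsolution.jump`), a fixed strip the growth of its mass (`IsPlaneSubsolution.exists_ae_mass_le`).
For `k = a` and `k = b` the jump inequalities contain the Rankine-Hugoniot condition. With the
inequality for `k = c` and the differential inclusion, which puts the speed `σ` of the curve between
the chord slopes of the two traces, they yield `A(u⁺, c) ≤ σ ≤ A(u⁻, c)`, up to degenerate cases in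
which a trace equals `c` (`chord_le_of_jump`). This is what makes the inward flux of `E` small.
-/

/-! ### Mollifiers and monotonicity in the sense of distributions -/

noncomputable section

namespace ConservationLaw

/-- A sequence of bump functions on `ℝ` centred at `0` whose supports shrink to `{0}`. -/
def bump (n : ℕ) : ContDiffBump (0 : ℝ) where
  rIn := 1 / (n + 1)
  rOut := 2 / (n + 1)
  rIn_pos := by positivity
  rIn_lt_rOut := by gcongr; norm_num

/-- The standard mollifiers on the line. -/
def mol (n : ℕ) : ℝ → ℝ := (bump n).normed volume

lemma mol_contDiff (n : ℕ) {k : ℕ∞} : ContDiff ℝ k (mol n) := (bump n).contDiff_normed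

lemma mol_continuous (n : ℕ) : Continuous (mol n) := (bump n).continuous_normed

lemma mol_nonneg (n : ℕ) (x : ℝ) : 0 ≤ mol n x := (bump n).nonneg_normed x

lemma mol_integral (n : ℕ) : ∫ x, mol n x = 1 := (bump n).integral_normed

lemma mol_integrable (n : ℕ) : Integrable (mol n) := (bump n).integrable_normed

lemma mol_hasCompactSupport (n : ℕ) : HasCompactSupport (mol n) :=
  (bump n).hasCompactSupport_normed

lemma mol_neg (n : ℕ) (x : ℝ) : mol n (-x) = mol n x := (bump n).normed_neg x

lemma mol_eq_zero {n : ℕ} {x : ℝ} (hx : 2 / ((n : ℝ) + 1) ≤ |x|) : mol n x = 0 := by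
  have h : x ∉ Function.support (mol n) := by
    have h2 := (bump n).support_normed_eq (μ := volume)
    rw [mol, h2]
    simpa [bump] using hx
  simpa using h

lemma tendsto_bump_radius : Tendsto (fun n : ℕ => 2 / ((n : ℝ) + 1)) atTop (𝓝 0) := by
  have h := (tendsto_one_div_add_atTop_nhds_zero_nat (𝕜 := ℝ)).const_mul 2
  simpa [div_eq_mul_inv] using h

/-- The regularisation of `g` by the mollifier `mol n`. -/
def mollify (n : ℕ) (g : ℝ → ℝ) : ℝ → ℝ :=
  convolution (mol n) g (ContinuousLinearMap.lsmul ℝ ℝ) volume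

lemma mollify_eq (n : ℕ) (g : ℝ → ℝ) (x : ℝ) : mollify n g x = ∫ t, mol n (t - x) * g t := by
  rw [mollify, convolution_eq_swap]
  refine integral_congr_ae (Eventually.of_forall fun t => ?_)
  have : mol n (x - t) = mol n (t - x) := by rw [← mol_neg]; congr 1; ring
  simp [this]

lemma mollify_ae_tendsto {g : ℝ → ℝ} (hg : LocallyIntegrable g) :
    ∀ᵐ x, Tendsto (fun n => mollify n g x) atTop (𝓝 (g x)) := by
  refine ContDiffBump.ae_convolution_tendsto_right_of_locallyIntegrable (φ := bump) (K := 2)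
    tendsto_bump_radius (Eventually.of_forall fun n => ?_) hg
  simp only [bump]
  apply le_of_eq; ring

lemma mollify_contDiff (n : ℕ) {g : ℝ → ℝ} (hg : LocallyIntegrable g) {k : ℕ∞} :
    ContDiff ℝ k (mollify n g) :=
  (mol_hasCompactSupport n).contDiff_convolution_left _ (mol_contDiff n) hg

lemma abs_mollify_le (n : ℕ) {g : ℝ → ℝ} {C : ℝ} (hC : ∀ t, |g t| ≤ C) (x : ℝ) :
    |mollify n g x| ≤ C := by
  rw [mollify_eq]
  have hi : Integrable (fun t => mol n (t - x) * C) := ((mol_integrable n).comp_sub_right x).mul_const C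
  calc |∫ t, mol n (t - x) * g t| ≤ ∫ t, mol n (t - x) * C := by
        rw [← Real.norm_eq_abs]
        refine norm_integral_le_of_norm_le hi (Eventually.of_forall fun t => ?_)
        rw [norm_mul, Real.norm_of_nonneg (mol_nonneg _ _), Real.norm_eq_abs]
        exact mul_le_mul_of_nonneg_left (hC t) (mol_nonneg _ _)
    _ = C := by
        rw [integral_mul_const, integral_sub_right_eq_self (mol n), mol_integral, one_mul]

/-- The primitive of the mollifier, a smooth monotone step from `0` to `1`. -/
def molStep (n : ℕ) (t : ℝ) : ℝ := ∫ x in (-3 : ℝ)..t, mol n x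

lemma molStep_hasDerivAt (n : ℕ) (t : ℝ) : HasDerivAt (molStep n) (mol n t) t :=
  intervalIntegral.integral_hasDerivAt_right ((mol_continuous n).intervalIntegrable _ _)
    (mol_continuous n).stronglyMeasurable.stronglyMeasurableAtFilter (mol_continuous n).continuousAt

lemma molStep_contDiff (n : ℕ) : ContDiff ℝ (⊤ : ℕ∞) (molStep n) := by
  rw [contDiff_infty_iff_deriv]
  refine ⟨fun t => (molStep_hasDerivAt n t).differentiableAt, ?_⟩
  have : deriv (molStep n) = mol n := funext fun t => (molStep_hasDerivAt n t).deriv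
  rw [this]; exact mol_contDiff n

lemma molStep_monotone (n : ℕ) : Monotone (molStep n) :=
  monotone_of_hasDerivAt_nonneg (molStep_hasDerivAt n) (mol_nonneg n)

lemma two_div_le_two (n : ℕ) : 2 / ((n : ℝ) + 1) ≤ 2 := by
  rw [div_le_iff₀ (by positivity)]
  have : (0 : ℝ) ≤ n := by positivity
  linarith

lemma molStep_eq_zero {n : ℕ} {t : ℝ} (ht : t ≤ -(2 / ((n : ℝ) + 1))) : molStep n t = 0 := by
  refine intervalIntegral.integral_zero_ae (Eventually.of_forall fun x hx => mol_eq_zero ?_)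
  have h2 := two_div_le_two n
  have h3 : x ≤ -(2 / ((n : ℝ) + 1)) := by
    rcases le_total (-3) t with h | h
    · rw [uIoc_of_le h] at hx; exact hx.2.trans ht
    · rw [uIoc_of_ge h] at hx
      linarith [hx.2]
  rw [le_abs]; right; linarith

lemma molStep_eq_one {n : ℕ} {t : ℝ} (ht : 2 / ((n : ℝ) + 1) ≤ t) : molStep n t = 1 := by
  have h2 := two_div_le_two n
  have h0 : 0 < 2 / ((n : ℝ) + 1) := by positivity
  rw [molStep, intervalIntegral.integral_of_le (by linarith), ← mol_integral n]
  refine setIntegral_eq_integral_of_forall_compl_eq_zero fun x hx => mol_eq_zero ?_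
  rw [mem_Ioc, not_and_or, not_lt, not_le] at hx
  rw [le_abs]
  rcases hx with h | h
  · right; linarith
  · left; linarith

lemma hasCompactSupport_of_Icc {χ : ℝ → ℝ} {A B : ℝ} (h : ∀ t, t ∉ Icc A B → χ t = 0) :
    HasCompactSupport χ :=
  HasCompactSupport.intro isCompact_Icc fun t ht => h t ht

lemma tsupport_subset_Icc {χ : ℝ → ℝ} {A B : ℝ} (h : ∀ t, t ∉ Icc A B → χ t = 0) :
    tsupport χ ⊆ Icc A B :=
  closure_minimal (fun t ht => by by_contra h'; exact ht (h t h')) isClosed_Icc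

/-- A function whose distributional derivative on `(s, ∞)` is nonpositive is nonincreasing
on a set of full measure. -/
lemma exists_ae_antitone {s : ℝ} {D : ℝ → ℝ} (hD : LocallyIntegrable D)
    (h : ∀ χ : ℝ → ℝ, ContDiff ℝ (⊤ : ℕ∞) χ → HasCompactSupport χ → tsupport χ ⊆ Ioi s →
      (∀ t, 0 ≤ χ t) → 0 ≤ ∫ t, deriv χ t * D t) :
    ∃ E : Set ℝ, (∀ᵐ t, t ∈ E) ∧ ∀ τ ∈ E, ∀ T ∈ E, s < τ → τ < T → D T ≤ D τ := by
  refine ⟨{x | Tendsto (fun n => mollify n D x) atTop (𝓝 (D x))}, mollify_ae_tendsto hD, ?_⟩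
  intro τ hτ T hT hs hτT
  refine le_of_tendsto_of_tendsto hT hτ ?_
  have hev : ∀ᶠ n : ℕ in atTop, 2 / ((n : ℝ) + 1) < τ - s :=
    tendsto_bump_radius.eventually_lt_const (by linarith)
  filter_upwards [hev] with n hn
  have h0 : 0 < 2 / ((n : ℝ) + 1) := by positivity
  set r := 2 / ((n : ℝ) + 1) with hr
  -- a smooth approximation of the indicator function of `(τ, T)` serves as test function
  have hz : ∀ t, t ∉ Icc (τ - r) (T + r) → molStep n (t - τ) - molStep n (t - T) = 0 := by
    intro t ht
    rw [mem_Icc, not_and_or, not_le, not_le] at ht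
    rcases ht with ht | ht
    · rw [molStep_eq_zero (by rw [← hr]; linarith), molStep_eq_zero (by rw [← hr]; linarith), sub_zero]
    · rw [molStep_eq_one (by rw [← hr]; linarith), molStep_eq_one (by rw [← hr]; linarith), sub_self]
  have hd : ∀ t, HasDerivAt (fun t => molStep n (t - τ) - molStep n (t - T))
      (mol n (t - τ) - mol n (t - T)) t := fun t =>
    ((molStep_hasDerivAt n (t - τ)).comp_sub_const t τ).sub
      ((molStep_hasDerivAt n (t - T)).comp_sub_const t T)
  have key := h (fun t => molStep n (t - τ) - molStep n (t - T))
    (((molStep_contDiff n).comp (contDiff_id.sub contDiff_const)).sub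
      ((molStep_contDiff n).comp (contDiff_id.sub contDiff_const)))
    (hasCompactSupport_of_Icc hz)
    ((tsupport_subset_Icc hz).trans fun t ht => by have := ht.1; simp only [mem_Ioi]; linarith)
    (fun t => sub_nonneg.2 (molStep_monotone n (by linarith)))
  have hi : ∀ y, Integrable fun t => mol n (t - y) * D t := fun y =>
    hD.integrable_smul_left_of_hasCompactSupport ((mol_continuous n).comp (continuous_id.sub continuous_const))
      ((mol_hasCompactSupport n).comp_homeomorph (Homeomorph.subRight y))
  rw [mollify_eq, mollify_eq]
  have : ∫ t, deriv (fun t => molStep n (t - τ) - molStep n (t - T)) t * D t =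
      (∫ t, mol n (t - τ) * D t) - ∫ t, mol n (t - T) * D t := by
    rw [← integral_sub (hi τ) (hi T)]
    refine integral_congr_ae (Eventually.of_forall fun t => ?_)
    simp only [(hd t).deriv]; ring
  rw [this] at key
  linarith

/-- A function that is nonnegative on `(s, ∞)` in the sense of distributions is nonnegative
almost everywhere there. -/
lemma ae_nonneg_of_forall_test {s : ℝ} {D : ℝ → ℝ} (hD : LocallyIntegrable D)
    (h : ∀ χ : ℝ → ℝ, ContDiff ℝ (⊤ : ℕ∞) χ → HasCompactSupport χ → tsupport χ ⊆ Ioi s →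
      (∀ t, 0 ≤ χ t) → 0 ≤ ∫ t, χ t * D t) :
    ∀ᵐ t, s < t → 0 ≤ D t := by
  filter_upwards [mollify_ae_tendsto hD] with τ hτ hs
  refine ge_of_tendsto hτ ?_
  have hev : ∀ᶠ n : ℕ in atTop, 2 / ((n : ℝ) + 1) < τ - s :=
    tendsto_bump_radius.eventually_lt_const (by linarith)
  filter_upwards [hev] with n hn
  rw [mollify_eq]
  set r := 2 / ((n : ℝ) + 1) with hr
  have hz : ∀ t, t ∉ Icc (τ - r) (τ + r) → mol n (t - τ) = 0 := by
    intro t ht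
    rw [mem_Icc, not_and_or, not_le, not_le] at ht
    refine mol_eq_zero ?_
    rw [le_abs]
    rcases ht with ht | ht
    · right; linarith
    · left; linarith
  exact h (fun t => mol n (t - τ)) ((mol_contDiff n).comp (contDiff_id.sub contDiff_const))
    (hasCompactSupport_of_Icc hz)
    ((tsupport_subset_Icc hz).trans fun t ht => by have := ht.1; simp only [mem_Ioi]; linarith)
    (fun t => mol_nonneg _ _)

end ConservationLaw

end

/-! ### Subsolutions on the plane and finite speed of propagation -/

noncomputable section

namespace ConservationLaw

/-- `∂ₜE + ∂ₓQ ≤ 0` in the sense of distributions on the whole plane. -/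
def IsPlaneSubsolution (E Q : ℝ × ℝ → ℝ) : Prop :=
  ∀ φ : ℝ × ℝ → ℝ, IsTestFunction φ → (∀ p, 0 ≤ φ p) → 0 ≤ ∫ p, (E p * dt φ p + Q p * dx φ p)

lemma IsTestFunction.differentiable {φ : ℝ × ℝ → ℝ} (h : IsTestFunction φ) : Differentiable ℝ φ :=
  h.smooth.differentiable (by simp)

lemma IsTestFunction.continuous {φ : ℝ × ℝ → ℝ} (h : IsTestFunction φ) : Continuous φ :=
  h.smooth.continuous

lemma IsTestFunction.continuous_dx {φ : ℝ × ℝ → ℝ} (h : IsTestFunction φ) : Continuous (dx φ) :=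
  (h.smooth.continuous_fderiv (by simp)).clm_apply continuous_const

lemma IsTestFunction.continuous_dt {φ : ℝ × ℝ → ℝ} (h : IsTestFunction φ) : Continuous (dt φ) :=
  (h.smooth.continuous_fderiv (by simp)).clm_apply continuous_const

lemma IsTestFunction.hasCompactSupport_dx {φ : ℝ × ℝ → ℝ} (h : IsTestFunction φ) :
    HasCompactSupport (dx φ) := h.compact.fderiv_apply (𝕜 := ℝ) (1, 0)

lemma IsTestFunction.hasCompactSupport_dt {φ : ℝ × ℝ → ℝ} (h : IsTestFunction φ) :
    HasCompactSupport (dt φ) := h.compact.fderiv_apply (𝕜 := ℝ) (0, 1)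

lemma hasDerivAt_dt {φ : ℝ × ℝ → ℝ} {x t : ℝ} (h : DifferentiableAt ℝ φ (x, t)) :
    HasDerivAt (fun r => φ (x, r)) (dt φ (x, t)) t := by
  have h1 : HasDerivAt (fun r : ℝ => (x, r)) ((0 : ℝ), (1 : ℝ)) t :=
    (hasDerivAt_const t x).prodMk (hasDerivAt_id t)
  exact h.hasFDerivAt.comp_hasDerivAt t h1

lemma hasDerivAt_dx {φ : ℝ × ℝ → ℝ} {x t : ℝ} (h : DifferentiableAt ℝ φ (x, t)) :
    HasDerivAt (fun y => φ (y, t)) (dx φ (x, t)) x := by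
  have h1 : HasDerivAt (fun r : ℝ => (r, t)) ((1 : ℝ), (0 : ℝ)) x :=
    (hasDerivAt_id x).prodMk (hasDerivAt_const x t)
  exact h.hasFDerivAt.comp_hasDerivAt x h1

lemma dt_eq {φ : ℝ × ℝ → ℝ} {x t d : ℝ} (h : DifferentiableAt ℝ φ (x, t))
    (hd : HasDerivAt (fun r => φ (x, r)) d t) : dt φ (x, t) = d := (hasDerivAt_dt h).unique hd

lemma dx_eq {φ : ℝ × ℝ → ℝ} {x t d : ℝ} (h : DifferentiableAt ℝ φ (x, t))
    (hd : HasDerivAt (fun y => φ (y, t)) d x) : dx φ (x, t) = d := (hasDerivAt_dx h).unique hd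

lemma integrable_bdd_mul_of_compact {X : Type*} [TopologicalSpace X] [MeasurableSpace X]
    [OpensMeasurableSpace X] {μ : Measure X} [IsFiniteMeasureOnCompacts μ]
    {g ψ : X → ℝ} {C : ℝ} (hg : AEStronglyMeasurable g μ)
    (hC : ∀ x, |g x| ≤ C) (hψ : Continuous ψ) (hc : HasCompactSupport ψ) :
    Integrable (fun x => g x * ψ x) μ :=
  (hψ.integrable_of_hasCompactSupport hc).bdd_mul hg (Eventually.of_forall hC)

lemma locallyIntegrable_of_bdd {g : ℝ → ℝ} {C : ℝ} (hg : Measurable g) (hC : ∀ x, |g x| ≤ C) :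
    LocallyIntegrable g :=
  (locallyIntegrable_const C).mono hg.aestronglyMeasurable
    (Eventually.of_forall fun x => (hC x).trans (le_abs_self C))

/-- The derivative of the smooth transition function. -/
def S' : ℝ → ℝ := deriv Real.smoothTransition

lemma hasDerivAt_S (x : ℝ) : HasDerivAt Real.smoothTransition (S' x) x :=
  ((Real.smoothTransition.contDiff (n := 1)).differentiable (by simp) x).hasDerivAt

lemma S'_nonneg (x : ℝ) : 0 ≤ S' x := Real.smoothTransition.monotone.deriv_nonneg

lemma S'_continuous : Continuous S' :=
  (Real.smoothTransition.contDiff (n := 1)).continuous_deriv (by simp)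

/-- The function `√(1 + x²)`, a smooth substitute for `|x|`. -/
def sm (x : ℝ) : ℝ := √(1 + x ^ 2)

lemma sm_contDiff : ContDiff ℝ (⊤ : ℕ∞) sm :=
  (contDiff_const.add (contDiff_id.pow 2)).sqrt fun x => by simp only [id]; positivity

lemma hasDerivAt_sm (x : ℝ) : HasDerivAt sm (x / sm x) x := by
  have h : HasDerivAt (fun x : ℝ => 1 + x ^ 2) (2 * x) x := by
    simpa using (hasDerivAt_pow 2 x).const_add 1
  convert! h.sqrt (by positivity) using 1
  rw [sm]; field_simp

lemma abs_le_sm (x : ℝ) : |x| ≤ sm x := Real.abs_le_sqrt (by linarith)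

lemma sm_pos (x : ℝ) : 0 < sm x := Real.sqrt_pos.2 (by positivity)

lemma sm_le (x : ℝ) : sm x ≤ 1 + |x| := by
  rw [sm, Real.sqrt_le_left (by positivity)]
  have := sq_abs x; nlinarith [abs_nonneg x]

/-- The space-time cut-off: it equals `1` well inside a cone that shrinks with speed `Λ`. -/
def cone (N Λ : ℝ) (p : ℝ × ℝ) : ℝ := Real.smoothTransition (N - sm p.1 - Λ * p.2)

lemma cone_contDiff (N Λ : ℝ) : ContDiff ℝ (⊤ : ℕ∞) (cone N Λ) :=
  Real.smoothTransition.contDiff.comp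
    ((contDiff_const.sub (sm_contDiff.comp contDiff_fst)).sub (contDiff_const.mul contDiff_snd))

lemma cone_nonneg (N Λ : ℝ) (p : ℝ × ℝ) : 0 ≤ cone N Λ p := Real.smoothTransition.nonneg _

lemma cone_le_one (N Λ : ℝ) (p : ℝ × ℝ) : cone N Λ p ≤ 1 := Real.smoothTransition.le_one _

lemma cone_eq_zero {N Λ x t : ℝ} (h : N - Λ * t ≤ |x|) : cone N Λ (x, t) = 0 :=
  Real.smoothTransition.zero_of_nonpos (by have := abs_le_sm x; simp only; linarith)

lemma cone_eq_one {N Λ x t : ℝ} (h : |x| ≤ N - 2 - Λ * t) : cone N Λ (x, t) = 1 :=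
  Real.smoothTransition.one_of_one_le (by have := sm_le x; simp only; linarith)

/-- Finite speed of propagation: if `∂ₜE + ∂ₓQ ≤ 0` with `E ≥ 0` and `|Q| ≤ Λ E`, then the mass
of `E` inside a cone shrinking with speed `Λ` does not increase. Times below `-1` are left out only to
bound the width of the cone; as the flux may vanish for negative times, times in `(-1, 0)` stand for the
initial time. -/
lemma IsPlaneSubsolution.exists_ae_cone_le {E Q : ℝ × ℝ → ℝ} (h : IsPlaneSubsolution E Q)
    (hE : Measurable E) (hQ : Measurable Q) {C Λ : ℝ} (hE0 : ∀ p, 0 ≤ E p) (hEC : ∀ p, E p ≤ C)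
    (hΛ : 0 ≤ Λ) (hQE : ∀ p, |Q p| ≤ Λ * E p) (N : ℝ) (hN : 0 ≤ N) :
    ∃ G : Set ℝ, (∀ᵐ t, t ∈ G) ∧ ∀ τ ∈ G, ∀ T ∈ G, -1 < τ → τ < T →
      ∫ x, E (x, T) * cone N Λ (x, T) ≤ ∫ x, E (x, τ) * cone N Λ (x, τ) := by
  have hcm : Measurable (cone N Λ) := (cone_contDiff N Λ).continuous.measurable
  have hEabs : ∀ p, |E p| ≤ C := fun p => by rw [abs_of_nonneg (hE0 p)]; exact hEC p
  have hC0 : 0 ≤ C := (hE0 0).trans (hEC 0)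
  have hQabs : ∀ p, |Q p| ≤ Λ * C := fun p =>
    (hQE p).trans (mul_le_mul_of_nonneg_left (hEC p) hΛ)
  set D : ℝ → ℝ := fun t => ∫ x, E (x, t) * cone N Λ (x, t) with hDdef
  have hDm : Measurable D := by
    have h1 : StronglyMeasurable (Function.uncurry fun t x => E (x, t) * cone N Λ (x, t)) :=
      ((hE.comp measurable_swap).mul (hcm.comp measurable_swap)).stronglyMeasurable
    exact h1.integral_prod_right.measurable
  have hDb : ∀ t, -1 < t → |D t| ≤ C * (2 * (N + Λ)) := by
    intro t ht
    have hs : ∀ x, x ∉ Icc (-(N + Λ)) (N + Λ) → E (x, t) * cone N Λ (x, t) = 0 := by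
      intro x hx
      rw [cone_eq_zero, mul_zero]
      have h2 : N + Λ ≤ |x| := by
        by_contra h3
        exact hx (abs_le.1 (not_le.1 h3).le)
      nlinarith
    rw [hDdef]
    simp only
    rw [← setIntegral_eq_integral_of_forall_compl_eq_zero hs, ← Real.norm_eq_abs]
    refine (norm_setIntegral_le_of_norm_le_const (C := C) (by simp) fun x _ => ?_).trans ?_
    · rw [norm_mul, Real.norm_eq_abs, Real.norm_of_nonneg (cone_nonneg _ _ _)]
      exact (mul_le_of_le_one_right (abs_nonneg _) (cone_le_one _ _ _)).trans (hEabs _)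
    · rw [Real.volume_real_Icc_of_le (by linarith)]
      apply le_of_eq; ring
  have hloc : LocallyIntegrable ((Ioi (-1 : ℝ)).indicator D) := by
    refine locallyIntegrable_of_bdd (C := C * (2 * (N + Λ))) (hDm.indicator measurableSet_Ioi) fun t => ?_
    by_cases ht : t ∈ Ioi (-1 : ℝ)
    · rw [indicator_of_mem ht]; exact hDb t ht
    · rw [indicator_of_notMem ht, abs_zero]; positivity
  suffices hkey : ∀ χ : ℝ → ℝ, ContDiff ℝ (⊤ : ℕ∞) χ → HasCompactSupport χ →
      tsupport χ ⊆ Ioi (-1) → (∀ t, 0 ≤ χ t) →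
      0 ≤ ∫ t, deriv χ t * (Ioi (-1 : ℝ)).indicator D t by
    obtain ⟨G, hG, hG'⟩ := exists_ae_antitone hloc hkey
    refine ⟨G, hG, fun τ hτ T hT h1 h2 => ?_⟩
    have := hG' τ hτ T hT h1 h2
    rwa [indicator_of_mem (show T ∈ Ioi (-1 : ℝ) from h1.trans h2),
      indicator_of_mem (show τ ∈ Ioi (-1 : ℝ) from h1)] at this
  intro χ hχ hχc hχs hχ0
  have hχd : ∀ t, t ∉ Ioi (-1 : ℝ) → deriv χ t = 0 := fun t ht =>
    image_eq_zero_of_notMem_tsupport fun h' => ht (hχs (tsupport_deriv_subset h'))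
  have hχdiff : ∀ t, HasDerivAt χ (deriv χ t) t := fun t =>
    (hχ.differentiable (by simp) t).hasDerivAt
  -- the product of the time and the space cut-off is compactly supported
  obtain ⟨R, hR⟩ := hχc.isCompact.isBounded.subset_closedBall 0
  have hcs : ∀ (α β : ℝ × ℝ → ℝ), (∀ p, p.2 ∉ tsupport χ → α p = 0) →
      (∀ p, p.2 ∈ tsupport χ → N + Λ < |p.1| → β p = 0) → HasCompactSupport (fun p => α p * β p) := by
    intro α β hα hβ
    refine HasCompactSupport.intro (isCompact_Icc (a := -(N + Λ)) (b := N + Λ) |>.prod hχc.isCompact)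
      fun p hp => ?_
    by_cases h2 : p.2 ∈ tsupport χ
    · rw [hβ p h2, mul_zero]
      by_contra h3
      exact hp ⟨abs_le.1 (not_lt.1 h3), h2⟩
    · rw [hα p h2, zero_mul]
  have hconez : ∀ p : ℝ × ℝ, p.2 ∈ tsupport χ → N + Λ < |p.1| → cone N Λ p = 0 := by
    intro p hp h3
    have h4 : -1 < p.2 := hχs hp
    exact cone_eq_zero (by nlinarith)
  have hφ : IsTestFunction (fun p => χ p.2 * cone N Λ p) :=
    ⟨(hχ.comp contDiff_snd).mul (cone_contDiff N Λ),
      hcs _ _ (fun p hp => image_eq_zero_of_notMem_tsupport hp) hconez⟩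
  have hdt : ∀ p : ℝ × ℝ, dt (fun p => χ p.2 * cone N Λ p) p =
      deriv χ p.2 * cone N Λ p + χ p.2 * (S' (N - sm p.1 - Λ * p.2) * -Λ) := by
    rintro ⟨x, t⟩
    refine dt_eq (hφ.differentiable _) ((hχdiff t).mul ?_)
    refine (hasDerivAt_S _).comp t ?_
    simpa using ((hasDerivAt_id t).const_mul Λ).const_sub (N - sm x)
  have hdx : ∀ p : ℝ × ℝ, dx (fun p => χ p.2 * cone N Λ p) p =
      χ p.2 * (S' (N - sm p.1 - Λ * p.2) * -(p.1 / sm p.1)) := by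
    rintro ⟨x, t⟩
    refine dx_eq (hφ.differentiable _) (HasDerivAt.const_mul (χ t) ?_)
    refine (hasDerivAt_S _).comp x ?_
    simpa using ((hasDerivAt_sm x).const_sub N).sub_const (Λ * t)
  have h0 := h _ hφ fun p => mul_nonneg (hχ0 _) (cone_nonneg _ _ _)
  have hi2 : Integrable fun p : ℝ × ℝ => E p * (deriv χ p.2 * cone N Λ p) := by
    refine integrable_bdd_mul_of_compact hE.aestronglyMeasurable hEabs
      (((hχ.continuous_deriv (by simp)).comp continuous_snd).mul (cone_contDiff N Λ).continuous)
      (hcs _ _ (fun p hp => ?_) hconez)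
    exact image_eq_zero_of_notMem_tsupport fun h' => hp (tsupport_deriv_subset h')
  -- the derivatives of the cone contribute a nonpositive term, since `|Q| ≤ Λ E`
  have h1 : 0 ≤ ∫ p : ℝ × ℝ, E p * (deriv χ p.2 * cone N Λ p) := by
    refine h0.trans (integral_mono ?_ hi2 fun p => ?_)
    · exact (integrable_bdd_mul_of_compact hE.aestronglyMeasurable hEabs hφ.continuous_dt
        hφ.hasCompactSupport_dt).add (integrable_bdd_mul_of_compact hQ.aestronglyMeasurable hQabs
        hφ.continuous_dx hφ.hasCompactSupport_dx)
    · simp only [hdt, hdx]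
      have h5 : |Q p * (p.1 / sm p.1)| ≤ Λ * E p := by
        rw [abs_mul]
        refine (mul_le_of_le_one_right (abs_nonneg _) ?_).trans (hQE p)
        rw [abs_div, abs_of_pos (sm_pos _)]
        exact div_le_one_of_le₀ (abs_le_sm _) (sm_pos _).le
      have h6 := (abs_le.1 h5).1
      have h7 : 0 ≤ χ p.2 * S' (N - sm p.1 - Λ * p.2) * (Λ * E p + Q p * (p.1 / sm p.1)) :=
        mul_nonneg (mul_nonneg (hχ0 _) (S'_nonneg _)) (by linarith)
      linarith
  refine h1.trans (le_of_eq ?_)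
  rw [Measure.volume_eq_prod, integral_prod_symm _ hi2]
  refine integral_congr_ae (Eventually.of_forall fun t => ?_)
  simp only
  by_cases ht : t ∈ Ioi (-1 : ℝ)
  · rw [indicator_of_mem ht, hDdef]
    simp only
    rw [← integral_const_mul]
    exact integral_congr_ae (Eventually.of_forall fun x => by ring)
  · simp [hχd t ht]

end ConservationLaw

end

/-! ### Translations in the mean and Kruzhkov fluxes -/

noncomputable section

namespace ConservationLaw

/-- Translations are continuous in `L¹`, in a weighted form for bounded functions. -/
lemma exists_translation_le {V W : ℝ × ℝ → ℝ} {C : ℝ} (hV : Measurable V) (hC : ∀ p, |V p| ≤ C)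
    (hW : Continuous W) (hWc : HasCompactSupport W) (hW0 : ∀ p, 0 ≤ W p) {η : ℝ} (hη : 0 < η) :
    ∃ r > 0, ∀ e : ℝ × ℝ, ‖e‖ < r → ∫ p, W p * |V (p - e) - V p| ≤ η := by
  obtain ⟨B, hB⟩ := hW.bounded_above_of_compact_support hWc
  have hB0 : 0 ≤ B := (norm_nonneg _).trans (hB 0)
  have hWi : Integrable W := hW.integrable_of_hasCompactSupport hWc
  set I := ∫ p, W p with hI
  have hI0 : 0 ≤ I := integral_nonneg hW0
  set K1 := Metric.cthickening 1 (tsupport W) with hK1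
  have hK1c : IsCompact K1 := hWc.isCompact.cthickening
  have hV1 : Integrable (K1.indicator V) := by
    refine IntegrableOn.integrable_indicator ?_ hK1c.measurableSet
    refine Measure.integrableOn_of_bounded (M := C) hK1c.measure_lt_top.ne hV.aestronglyMeasurable
      (Eventually.of_forall hC)
  -- on a neighbourhood of the support of `W`, the function `V` is approximated in the mean by a
  -- uniformly continuous `g`
  obtain ⟨g, hgc, hgle, hg, hgi⟩ := hV1.exists_hasCompactSupport_integral_sub_le
    (ε := η / (3 * (B + 1))) (by positivity)
  have hgu : UniformContinuous g := hgc.uniformContinuous_of_continuous hg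
  obtain ⟨r, hr, hgr⟩ := Metric.uniformContinuous_iff.1 hgu (η / (3 * (I + 1))) (by positivity)
  refine ⟨min r 1, lt_min hr one_pos, fun e he => ?_⟩
  have her : ‖e‖ < r := he.trans_le (min_le_left _ _)
  have he1 : ‖e‖ < 1 := he.trans_le (min_le_right _ _)
  set h1 : ℝ × ℝ → ℝ := fun p => ‖K1.indicator V p - g p‖ with hh1
  have h1i : Integrable h1 := (hV1.sub hgi).norm
  have h1i' : Integrable fun p => h1 (p - e) := h1i.comp_sub_right e
  have hle : ∀ p, W p * |V (p - e) - V p| ≤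
      B * h1 (p - e) + W p * (η / (3 * (I + 1))) + B * h1 p := by
    intro p
    by_cases hp : p ∈ tsupport W
    · have hp1 : p ∈ K1 := Metric.self_subset_cthickening _ hp
      have hp2 : p - e ∈ K1 := by
        refine Metric.mem_cthickening_of_dist_le _ p _ _ hp ?_
        rw [dist_eq_norm]; simpa using he1.le
      have h3 : dist (g (p - e)) (g p) < η / (3 * (I + 1)) := hgr (by rw [dist_eq_norm]; simpa using her)
      have e1 : h1 (p - e) = |V (p - e) - g (p - e)| := by simp [hh1, hp2]
      have e2 : h1 p = |V p - g p| := by simp [hh1, hp1]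
      rw [e1, e2]
      have hWB : W p ≤ B := (le_abs_self _).trans (hB p)
      rw [Real.dist_eq] at h3
      have h4 : |V (p - e) - V p| ≤ |V (p - e) - g (p - e)| + η / (3 * (I + 1)) + |V p - g p| := by
        have := abs_add_three (V (p - e) - g (p - e)) (g (p - e) - g p) (g p - V p)
        rw [abs_sub_comm (g p)] at this
        have h5 : V (p - e) - g (p - e) + (g (p - e) - g p) + (g p - V p) = V (p - e) - V p := by ring
        rw [h5] at this
        linarith
      calc W p * |V (p - e) - V p| ≤ W p * (|V (p - e) - g (p - e)| + η / (3 * (I + 1)) + |V p - g p|) :=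
            mul_le_mul_of_nonneg_left h4 (hW0 p)
        _ ≤ _ := by
            have := mul_le_mul_of_nonneg_right hWB (abs_nonneg (V (p - e) - g (p - e)))
            have := mul_le_mul_of_nonneg_right hWB (abs_nonneg (V p - g p))
            linarith
    · rw [image_eq_zero_of_notMem_tsupport hp]
      have : 0 ≤ h1 (p - e) := norm_nonneg _
      have : 0 ≤ h1 p := norm_nonneg _
      have := mul_nonneg hB0 (norm_nonneg (K1.indicator V (p - e) - g (p - e)))
      simp only [zero_mul, add_zero]
      positivity
  have hi : Integrable fun p => B * h1 (p - e) + W p * (η / (3 * (I + 1))) + B * h1 p :=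
    ((h1i'.const_mul B).add (hWi.mul_const _)).add (h1i.const_mul B)
  have hleft : Integrable fun p => W p * |V (p - e) - V p| := by
    simp_rw [mul_comm (W _)]
    refine integrable_bdd_mul_of_compact (C := 2 * C) ?_ (fun p => ?_) hW hWc
    · exact (((hV.comp (measurable_id.sub_const e)).sub hV).abs).aestronglyMeasurable
    · rw [abs_abs]
      exact (abs_sub _ _).trans (by linarith [hC (p - e), hC p])
  have h1s : ∫ p, h1 (p - e) = ∫ p, h1 p := integral_sub_right_eq_self h1 e
  calc ∫ p, W p * |V (p - e) - V p|
      ≤ ∫ p, (B * h1 (p - e) + W p * (η / (3 * (I + 1))) + B * h1 p) := integral_mono hleft hi hle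
    _ = B * (∫ p, h1 p) + I * (η / (3 * (I + 1))) + B * ∫ p, h1 p := by
        have hadd : Integrable fun p => B * h1 (p - e) + W p * (η / (3 * (I + 1))) :=
          (h1i'.const_mul B).add (hWi.mul_const _)
        rw [integral_add hadd (h1i.const_mul B), integral_add (h1i'.const_mul B) (hWi.mul_const _),
          integral_const_mul, integral_const_mul, integral_mul_const, h1s]
    _ ≤ η / 3 + η / 3 + η / 3 := by
        have h5 : B * (∫ p, h1 p) ≤ η / 3 := by
          calc B * (∫ p, h1 p) ≤ (B + 1) * (η / (3 * (B + 1))) :=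
                mul_le_mul (by linarith) hgle (integral_nonneg fun p => norm_nonneg _) (by linarith)
            _ = η / 3 := by field_simp
        have h6 : I * (η / (3 * (I + 1))) ≤ η / 3 := by
          calc I * (η / (3 * (I + 1))) ≤ (I + 1) * (η / (3 * (I + 1))) :=
                mul_le_mul_of_nonneg_right (by linarith) (by positivity)
            _ = η / 3 := by field_simp
        linarith
    _ = η := by ring

/-- Kruzhkov's entropy flux `sgn(v - k)(f v - f k)`. -/
def kflux (f : ℝ → ℝ) (v k : ℝ) : ℝ := f (max v k) - f (min v k)

lemma kflux_comm (f : ℝ → ℝ) (v k : ℝ) : kflux f v k = kflux f k v := by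
  rw [kflux, kflux, max_comm, min_comm]

lemma kflux_of_le {f : ℝ → ℝ} {v k : ℝ} (h : k ≤ v) : kflux f v k = f v - f k := by
  rw [kflux, max_eq_left h, min_eq_right h]

lemma kflux_of_ge {f : ℝ → ℝ} {v k : ℝ} (h : v ≤ k) : kflux f v k = f k - f v := by
  rw [kflux, max_eq_right h, min_eq_left h]

lemma kflux_continuous {f : ℝ → ℝ} (hf : Continuous f) :
    Continuous fun p : ℝ × ℝ => kflux f p.1 p.2 := by
  unfold kflux; fun_prop

lemma abs_kflux_le {f : ℝ → ℝ} {a b Λ : ℝ}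
    (hL : ∀ v ∈ Icc a b, ∀ w ∈ Icc a b, |f v - f w| ≤ Λ * |v - w|) {v k : ℝ}
    (hv : v ∈ Icc a b) (hk : k ∈ Icc a b) : |kflux f v k| ≤ Λ * |v - k| := by
  rcases le_total k v with h | h
  · rw [kflux_of_le h]; exact hL v hv k hk
  · rw [kflux_of_ge h, abs_sub_comm v]; exact hL k hk v hv

lemma abs_kflux_sub_le {f : ℝ → ℝ} {a b Λ : ℝ}
    (hL : ∀ v ∈ Icc a b, ∀ w ∈ Icc a b, |f v - f w| ≤ Λ * |v - w|) {v k l : ℝ}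
    (hv : v ∈ Icc a b) (hk : k ∈ Icc a b) (hl : l ∈ Icc a b) :
    |kflux f v k - kflux f v l| ≤ Λ * |k - l| := by
  wlog hkl : k ≤ l generalizing k l
  · rw [abs_sub_comm, abs_sub_comm k]; exact this hl hk (le_of_not_ge hkl)
  rcases le_total v k with h1 | h1
  · rw [kflux_of_ge h1, kflux_of_ge (h1.trans hkl), sub_sub_sub_cancel_right]; exact hL k hk l hl
  rcases le_total l v with h2 | h2
  · rw [kflux_of_le h1, kflux_of_le h2, sub_sub_sub_cancel_left, abs_sub_comm k]; exact hL l hl k hk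
  · rw [kflux_of_le h1, kflux_of_ge h2]
    have e1 := abs_le.1 (hL v hv k hk)
    have e2 := abs_le.1 (hL l hl v hv)
    rw [abs_of_nonneg (sub_nonneg.2 h1)] at e1
    rw [abs_of_nonneg (sub_nonneg.2 h2)] at e2
    rw [abs_sub_comm k, abs_of_nonneg (sub_nonneg.2 hkl), abs_le]
    constructor <;> nlinarith [e1.1, e1.2, e2.1, e2.2]

/-- The flux `q` switched off for nonpositive times. -/
def cutFlux (q : ℝ × ℝ → ℝ) (p : ℝ × ℝ) : ℝ := if 0 < p.2 then q p else 0

lemma cutFlux_measurable {q : ℝ × ℝ → ℝ} (hq : Measurable q) : Measurable (cutFlux q) :=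
  Measurable.ite (measurableSet_lt measurable_const measurable_snd) hq measurable_const

lemma abs_cutFlux_le (q : ℝ × ℝ → ℝ) (p : ℝ × ℝ) : |cutFlux q p| ≤ |q p| := by
  rw [cutFlux]; split_ifs
  · exact le_rfl
  · rw [abs_zero]; exact abs_nonneg _

/-- The product mollifier on the plane, with scale `m` in space and `n` in time. -/
def molPlane (m n : ℕ) (e : ℝ × ℝ) : ℝ := mol m e.1 * mol n e.2

lemma molPlane_isTestFunction (m n : ℕ) : IsTestFunction (molPlane m n) := by
  refine ⟨((mol_contDiff m).comp contDiff_fst).mul ((mol_contDiff n).comp contDiff_snd), ?_⟩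
  refine HasCompactSupport.intro ((mol_hasCompactSupport m).isCompact.prod
    (mol_hasCompactSupport n).isCompact) fun p hp => ?_
  rw [molPlane]
  by_cases h1 : p.1 ∈ tsupport (mol m)
  · rw [image_eq_zero_of_notMem_tsupport (fun h2 => hp ⟨h1, h2⟩ : p.2 ∉ tsupport (mol n)), mul_zero]
  · rw [image_eq_zero_of_notMem_tsupport h1, zero_mul]

lemma molPlane_nonneg (m n : ℕ) (e : ℝ × ℝ) : 0 ≤ molPlane m n e :=
  mul_nonneg (mol_nonneg _ _) (mol_nonneg _ _)

lemma molPlane_integral (m n : ℕ) : ∫ e, molPlane m n e = 1 := by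
  rw [Measure.volume_eq_prod]
  simp only [molPlane]
  rw [integral_prod_mul (mol m) (mol n), mol_integral, mol_integral, one_mul]

lemma molPlane_eq_zero {m n : ℕ} {r : ℝ} (hm : 2 / ((m : ℝ) + 1) < r) (hn : 2 / ((n : ℝ) + 1) < r)
    {e : ℝ × ℝ} (he : r ≤ ‖e‖) : molPlane m n e = 0 := by
  rw [molPlane]
  rw [Prod.norm_def, le_max_iff] at he
  rcases he with h | h
  · rw [mol_eq_zero (hm.le.trans h), zero_mul]
  · rw [mol_eq_zero (hn.le.trans h), mul_zero]

lemma dx_molPlane (m n : ℕ) (e : ℝ × ℝ) :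
    dx (molPlane m n) e = deriv (mol m) e.1 * mol n e.2 :=
  dx_eq ((molPlane_isTestFunction m n).differentiable _)
    ((((mol_contDiff m (k := 1)).differentiable (by simp) e.1).hasDerivAt).mul_const (mol n e.2))

lemma integral_abs_dx_molPlane (m n : ℕ) :
    ∫ e, |dx (molPlane m n) e| = ∫ x, |deriv (mol m) x| := by
  simp_rw [dx_molPlane, abs_mul, abs_of_nonneg (mol_nonneg n _)]
  rw [Measure.volume_eq_prod, integral_prod_mul (fun x => |deriv (mol m) x|) (mol n),
    mol_integral, mul_one]

/-- In the coordinates `(p₁, p₁ - p₂)` of the doubled space, products of compactly supported functions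
are compactly supported. -/
lemma hasCompactSupport_shear {α β : ℝ × ℝ → ℝ} (hα : HasCompactSupport α)
    (hβ : HasCompactSupport β) :
    HasCompactSupport fun z : (ℝ × ℝ) × (ℝ × ℝ) => α z.1 * β (z.1 - z.2) := by
  have hK : IsCompact ((fun z : (ℝ × ℝ) × (ℝ × ℝ) => (z.1, z.1 - z.2)) ''
      (tsupport α ×ˢ tsupport β)) :=
    (hα.isCompact.prod hβ.isCompact).image (by fun_prop)
  refine HasCompactSupport.intro hK fun z hz => ?_
  by_cases h1 : z.1 ∈ tsupport α
  · rw [image_eq_zero_of_notMem_tsupport (f := β) (fun h2 => hz ⟨(z.1, z.1 - z.2), ⟨h1, h2⟩, by simp⟩),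
      mul_zero]
  · rw [image_eq_zero_of_notMem_tsupport h1, zero_mul]

lemma integrable_shear {g : (ℝ × ℝ) × (ℝ × ℝ) → ℝ} {C : ℝ} (hg : Measurable g)
    (hC : ∀ z, |g z| ≤ C) {α β : ℝ × ℝ → ℝ} (hα : Continuous α) (hβ : Continuous β)
    (hαc : HasCompactSupport α) (hβc : HasCompactSupport β) :
    Integrable (fun z => g z * (α z.1 * β (z.1 - z.2))) (volume.prod volume) := by
  refine integrable_bdd_mul_of_compact hg.aestronglyMeasurable hC (by fun_prop)
    (hasCompactSupport_shear hαc hβc)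

end ConservationLaw

end

/-! ### Doubling of variables -/

noncomputable section

namespace ConservationLaw

/-- `U` satisfies all Kruzhkov entropy inequalities with constants `k ∈ [a, b]` on the plane,
where the flux is switched off for nonpositive times. Thus the values of `U` at negative times
encode the initial datum. -/
def IsKruzkov (f : ℝ → ℝ) (a b : ℝ) (U : ℝ × ℝ → ℝ) : Prop :=
  ∀ k ∈ Icc a b, IsPlaneSubsolution (fun p => |U p - k|) (cutFlux fun p => kflux f (U p) k)

/-- The doubled integrand of Kruzhkov's argument at the points `p` and `p - e`, with test function `φ`
and mollifier `κ`. The fluxes at the two points differ only in being switched on for `0 < p.2` and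
`0 < (p - e).2` respectively. -/
def doubled (f : ℝ → ℝ) (U V φ κ : ℝ × ℝ → ℝ) (p e : ℝ × ℝ) : ℝ :=
  (|U p - V (p - e)| * dt φ p + cutFlux (fun p => kflux f (U p) (V (p - e))) p * dx φ p) * κ e +
  ((if 0 < p.2 then kflux f (U p) (V (p - e)) else 0) -
    (if 0 < (p - e).2 then kflux f (U p) (V (p - e)) else 0)) * (φ p * dx κ e)

lemma measurable_ite_fst {g : (ℝ × ℝ) × (ℝ × ℝ) → ℝ} (hg : Measurable g) :
    Measurable fun z : (ℝ × ℝ) × (ℝ × ℝ) => if 0 < z.1.2 then g z else 0 :=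
  Measurable.ite (measurableSet_lt measurable_const (by fun_prop)) hg measurable_const

lemma measurable_ite_snd {g : (ℝ × ℝ) × (ℝ × ℝ) → ℝ} (hg : Measurable g) :
    Measurable fun z : (ℝ × ℝ) × (ℝ × ℝ) => if 0 < z.2.2 then g z else 0 :=
  Measurable.ite (measurableSet_lt measurable_const (by fun_prop)) hg measurable_const

lemma abs_ite_le {P : Prop} [Decidable P] {x C : ℝ} (h : |x| ≤ C) :
    |if P then x else 0| ≤ C := by
  split_ifs
  · exact h
  · rw [abs_zero]; exact (abs_nonneg x).trans h

section Doubling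

variable {f : ℝ → ℝ} {a b Λ : ℝ} {U V : ℝ × ℝ → ℝ}

/-- Doubling of variables: the inequalities for `U` (with `k = V p₂`) and for `V` (with
`k = U p₁`) are added, so that the singular time derivatives of the mollifier cancel. -/
lemma doubled_integral_nonneg (hf : Continuous f)
    (hL : ∀ v ∈ Icc a b, ∀ w ∈ Icc a b, |f v - f w| ≤ Λ * |v - w|) (hΛ : 0 ≤ Λ)
    (hU : Measurable U) (hV : Measurable V) (hUab : ∀ p, U p ∈ Icc a b)
    (hVab : ∀ p, V p ∈ Icc a b) (hUK : IsKruzkov f a b U) (hVK : IsKruzkov f a b V)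
    {φ κ : ℝ × ℝ → ℝ} (hφ : IsTestFunction φ) (hφ0 : ∀ p, 0 ≤ φ p) (hκ : IsTestFunction κ)
    (hκ0 : ∀ p, 0 ≤ κ p) :
    Integrable (fun p => ∫ e, doubled f U V φ κ p e) ∧
      0 ≤ ∫ p, ∫ e, doubled f U V φ κ p e := by
  have hd1 : ∀ p₁ p₂, |U p₁ - V p₂| ≤ b - a := fun p₁ p₂ => by
    rw [abs_le]; constructor <;> linarith [(hUab p₁).1, (hUab p₁).2, (hVab p₂).1, (hVab p₂).2]
  have hd2 : ∀ p₁ p₂, |kflux f (U p₁) (V p₂)| ≤ Λ * (b - a) := fun p₁ p₂ =>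
    (abs_kflux_le hL (hUab _) (hVab _)).trans (mul_le_mul_of_nonneg_left (hd1 _ _) hΛ)
  have hm1 : Measurable fun z : (ℝ × ℝ) × (ℝ × ℝ) => |U z.1 - V z.2| := by fun_prop
  have hm2 : Measurable fun z : (ℝ × ℝ) × (ℝ × ℝ) => kflux f (U z.1) (V z.2) :=
    (kflux_continuous hf).measurable.comp
      ((hU.comp measurable_fst).prodMk (hV.comp measurable_snd))
  set A : ℝ × ℝ → ℝ × ℝ → ℝ := fun p₁ p₂ =>
    |U p₁ - V p₂| * (dt φ p₁ * κ (p₁ - p₂)) + |U p₁ - V p₂| * (φ p₁ * dt κ (p₁ - p₂)) +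
    ((if 0 < p₁.2 then kflux f (U p₁) (V p₂) else 0) * (dx φ p₁ * κ (p₁ - p₂)) +
    (if 0 < p₁.2 then kflux f (U p₁) (V p₂) else 0) * (φ p₁ * dx κ (p₁ - p₂))) with hA
  set B : ℝ × ℝ → ℝ × ℝ → ℝ := fun p₁ p₂ =>
    -(|U p₁ - V p₂| * (φ p₁ * dt κ (p₁ - p₂))) -
    (if 0 < p₂.2 then kflux f (U p₁) (V p₂) else 0) * (φ p₁ * dx κ (p₁ - p₂)) with hB
  have i1 := integrable_shear hm1 (fun z => by rw [abs_abs]; exact hd1 _ _) hφ.continuous_dt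
    hκ.continuous hφ.hasCompactSupport_dt hκ.compact
  have i2 := integrable_shear hm1 (fun z => by rw [abs_abs]; exact hd1 _ _) hφ.continuous
    hκ.continuous_dt hφ.compact hκ.hasCompactSupport_dt
  have i3 := integrable_shear (measurable_ite_fst hm2) (fun z => abs_ite_le (hd2 _ _))
    hφ.continuous_dx hκ.continuous hφ.hasCompactSupport_dx hκ.compact
  have i4 := integrable_shear (measurable_ite_fst hm2) (fun z => abs_ite_le (hd2 _ _))
    hφ.continuous hκ.continuous_dx hφ.compact hκ.hasCompactSupport_dx
  have i5 := integrable_shear (measurable_ite_snd hm2) (fun z => abs_ite_le (hd2 _ _))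
    hφ.continuous hκ.continuous_dx hφ.compact hκ.hasCompactSupport_dx
  have iA : Integrable (Function.uncurry A) (volume.prod volume) := (i1.add i2).add (i3.add i4)
  have iB : Integrable (Function.uncurry B) (volume.prod volume) := i2.neg.sub i5
  -- the inequality for `U` with `k = V p₂` and the test function `φ(p) κ(p - p₂)`
  have hIA : 0 ≤ ∫ p₂, ∫ p₁, A p₁ p₂ := by
    refine integral_nonneg fun p₂ => ?_
    have ht : IsTestFunction fun p => φ p * κ (p - p₂) :=
      ⟨hφ.smooth.mul (hκ.smooth.comp (contDiff_id.sub contDiff_const)), hφ.compact.mul_right⟩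
    refine (hUK (V p₂) (hVab p₂) _ ht fun p => mul_nonneg (hφ0 _) (hκ0 _)).trans (le_of_eq ?_)
    refine integral_congr_ae (Eventually.of_forall ?_)
    rintro ⟨x, t⟩
    have e1 : dt (fun p => φ p * κ (p - p₂)) (x, t) =
        dt φ (x, t) * κ ((x, t) - p₂) + φ (x, t) * dt κ ((x, t) - p₂) :=
      dt_eq (ht.differentiable _) ((hasDerivAt_dt (hφ.differentiable _)).mul
        ((hasDerivAt_dt (hκ.differentiable (x - p₂.1, t - p₂.2))).comp_sub_const t p₂.2))
    have e2 : dx (fun p => φ p * κ (p - p₂)) (x, t) =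
        dx φ (x, t) * κ ((x, t) - p₂) + φ (x, t) * dx κ ((x, t) - p₂) :=
      dx_eq (ht.differentiable _) ((hasDerivAt_dx (hφ.differentiable _)).mul
        ((hasDerivAt_dx (hκ.differentiable (x - p₂.1, t - p₂.2))).comp_sub_const x p₂.1))
    simp only [e1, e2, hA, cutFlux]
    ring
  -- the inequality for `V` with `k = U p₁` and the test function `φ(p₁) κ(p₁ - p)`
  have hIB : 0 ≤ ∫ p₁, ∫ p₂, B p₁ p₂ := by
    refine integral_nonneg fun p₁ => ?_
    have ht : IsTestFunction fun p => φ p₁ * κ (p₁ - p) := by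
      refine ⟨contDiff_const.mul (hκ.smooth.comp (contDiff_const.sub contDiff_id)), ?_⟩
      exact (hκ.compact.comp_homeomorph (Homeomorph.subLeft p₁)).mul_left
    refine (hVK (U p₁) (hUab p₁) _ ht fun p => mul_nonneg (hφ0 _) (hκ0 _)).trans (le_of_eq ?_)
    refine integral_congr_ae (Eventually.of_forall ?_)
    rintro ⟨x, t⟩
    have e1 : dt (fun p => φ p₁ * κ (p₁ - p)) (x, t) = φ p₁ * -dt κ (p₁ - (x, t)) :=
      dt_eq (ht.differentiable _) (HasDerivAt.const_mul (φ p₁)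
        ((hasDerivAt_dt (hκ.differentiable (p₁.1 - x, p₁.2 - t))).comp_const_sub p₁.2 t))
    have e2 : dx (fun p => φ p₁ * κ (p₁ - p)) (x, t) = φ p₁ * -dx κ (p₁ - (x, t)) :=
      dx_eq (ht.differentiable _) (HasDerivAt.const_mul (φ p₁)
        ((hasDerivAt_dx (hκ.differentiable (p₁.1 - x, p₁.2 - t))).comp_const_sub p₁.1 x))
    simp only [e1, e2, hB, cutFlux]
    rw [abs_sub_comm, kflux_comm]
    ring
  rw [← integral_integral_swap iA] at hIA
  have hsum : ∀ p, ∫ e, doubled f U V φ κ p e = ∫ p₂, (A p p₂ + B p p₂) := by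
    intro p
    rw [← integral_sub_left_eq_self (fun p₂ => A p p₂ + B p p₂) volume p]
    refine integral_congr_ae (Eventually.of_forall fun e => ?_)
    simp only [doubled, hA, hB, cutFlux, sub_sub_cancel]
    ring
  have iAB : Integrable (Function.uncurry fun p₁ p₂ => A p₁ p₂ + B p₁ p₂)
      (volume.prod volume) := iA.add iB
  have hAB : ∫ p₁, ∫ p₂, (A p₁ p₂ + B p₁ p₂) = (∫ p₁, ∫ p₂, A p₁ p₂) + ∫ p₁, ∫ p₂, B p₁ p₂ :=
    integral_integral_add iA iB
  constructor
  · simp_rw [hsum]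
    exact iAB.integral_prod_left
  · simp_rw [hsum]
    rw [hAB]
    exact add_nonneg hIA hIB

/-- Kato's inequality for two Kruzhkov solutions, with the initial data included. The mollifier has a
space scale and a time scale. The space scale is fixed by the continuity of translations; the jump of
the flux at time zero then causes an error that is singular in the space scale, but supported in
a strip whose width is the time scale, which is chosen last. -/
lemma IsKruzkov.kato (hf : Continuous f)
    (hL : ∀ v ∈ Icc a b, ∀ w ∈ Icc a b, |f v - f w| ≤ Λ * |v - w|) (hΛ : 0 ≤ Λ)
    (hU : Measurable U) (hV : Measurable V) (hUab : ∀ p, U p ∈ Icc a b)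
    (hVab : ∀ p, V p ∈ Icc a b) (hUK : IsKruzkov f a b U) (hVK : IsKruzkov f a b V) :
    IsPlaneSubsolution (fun p => |U p - V p|) (cutFlux fun p => kflux f (U p) (V p)) := by
  intro φ hφ hφ0
  have hd1 : ∀ p₁ p₂, |U p₁ - V p₂| ≤ b - a := fun p₁ p₂ => by
    rw [abs_le]; constructor <;> linarith [(hUab p₁).1, (hUab p₁).2, (hVab p₂).1, (hVab p₂).2]
  have hba : 0 ≤ b - a := (abs_nonneg _).trans (hd1 0 0)
  have hd2 : ∀ p₁ p₂, |kflux f (U p₁) (V p₂)| ≤ Λ * (b - a) := fun p₁ p₂ =>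
    (abs_kflux_le hL (hUab _) (hVab _)).trans (mul_le_mul_of_nonneg_left (hd1 _ _) hΛ)
  set W : ℝ × ℝ → ℝ := fun p => |dt φ p| + Λ * |dx φ p| with hW
  have hWc : Continuous W := hφ.continuous_dt.abs.add (continuous_const.mul hφ.continuous_dx.abs)
  have hWs : HasCompactSupport W :=
    (hφ.hasCompactSupport_dt.comp_left (g := fun x => |x|) abs_zero).add
      (HasCompactSupport.mul_left (hφ.hasCompactSupport_dx.comp_left (g := fun x => |x|) abs_zero))
  have hW0 : ∀ p, 0 ≤ W p := fun p => by positivity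
  set G : ℝ × ℝ → ℝ := fun p =>
    |U p - V p| * dt φ p + cutFlux (fun p => kflux f (U p) (V p)) p * dx φ p with hG
  have hmU : Measurable fun p => |U p - V p| := by fun_prop
  have hmk : Measurable fun p => kflux f (U p) (V p) :=
    (kflux_continuous hf).measurable.comp (hU.prodMk hV)
  have hGi : Integrable G :=
    (integrable_bdd_mul_of_compact hmU.aestronglyMeasurable
      (fun p => by rw [abs_abs]; exact hd1 p p) hφ.continuous_dt hφ.hasCompactSupport_dt).add
    (integrable_bdd_mul_of_compact (cutFlux_measurable hmk).aestronglyMeasurable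
      (fun p => (abs_cutFlux_le _ p).trans (hd2 p p)) hφ.continuous_dx hφ.hasCompactSupport_dx)
  have hVb : ∀ p, |V p| ≤ |a| + |b| := fun p => by
    rw [abs_le]
    constructor
    · linarith [(hVab p).1, neg_abs_le a, abs_nonneg b]
    · linarith [(hVab p).2, le_abs_self b, abs_nonneg a]
  refine le_of_forall_pos_le_add fun η hη => ?_
  -- `η` is split evenly between the translation error and the error at time zero
  obtain ⟨r, hr, hrω⟩ := exists_translation_le hV hVb hWc hWs hW0 (half_pos hη)
  obtain ⟨m, hm⟩ := (tendsto_bump_radius.eventually_lt_const hr).exists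
  set Cm := ∫ x, |deriv (mol m) x| with hCm
  -- the error caused by the jump of the flux at time zero tends to zero with the time scale
  have herr : Tendsto (fun n : ℕ => ∫ p : ℝ × ℝ,
      (if |p.2| ≤ 2 / ((n : ℝ) + 1) then φ p else 0) * (Λ * (b - a) * Cm)) atTop (𝓝 0) := by
    suffices h0 : Tendsto (fun n : ℕ => ∫ p : ℝ × ℝ,
        (if |p.2| ≤ 2 / ((n : ℝ) + 1) then φ p else 0) * (Λ * (b - a) * Cm)) atTop
        (𝓝 (∫ p : ℝ × ℝ, (0 : ℝ))) by simpa using h0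
    refine tendsto_integral_of_dominated_convergence (fun p => φ p * |Λ * (b - a) * Cm|) (fun n => ?_)
      ((hφ.continuous.integrable_of_hasCompactSupport hφ.compact).mul_const _) (fun n => ?_) ?_
    · exact ((Measurable.ite (measurableSet_le (by fun_prop) measurable_const)
        hφ.continuous.measurable measurable_const).mul_const _).aestronglyMeasurable
    · refine Eventually.of_forall fun p => ?_
      rw [norm_mul, Real.norm_eq_abs, Real.norm_eq_abs]
      refine mul_le_mul_of_nonneg_right (abs_ite_le ?_) (abs_nonneg _)
      rw [abs_of_nonneg (hφ0 p)]
    · have hne : ∀ᵐ p : ℝ × ℝ, p.2 ≠ 0 := by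
        have : ∀ᵐ t : ℝ, t ≠ 0 := by simp [ae_iff, measure_singleton]
        exact Measure.quasiMeasurePreserving_snd.ae this
      filter_upwards [hne] with p hp
      refine tendsto_const_nhds.congr' ?_
      filter_upwards [tendsto_bump_radius.eventually_lt_const (abs_pos.2 hp)] with n hn
      rw [if_neg (not_le.2 hn), zero_mul]
  obtain ⟨n, hn, hnr⟩ := ((herr.eventually_lt_const (half_pos hη)).and
    (tendsto_bump_radius.eventually_lt_const hr)).exists
  have hκ := molPlane_isTestFunction m n
  obtain ⟨hJi, hJ⟩ := doubled_integral_nonneg hf hL hΛ hU hV hUab hVab hUK hVK hφ hφ0 hκ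
    (molPlane_nonneg m n)
  set κ := molPlane m n with hκdef
  have hκi : Integrable κ := hκ.continuous.integrable_of_hasCompactSupport hκ.compact
  have hmZ : Measurable fun z : (ℝ × ℝ) × (ℝ × ℝ) => |V (z.1 - z.2) - V z.1| := by fun_prop
  have hZi : Integrable (Function.uncurry fun p e : ℝ × ℝ => |V (p - e) - V p| * (W p * κ e))
      (volume.prod volume) := by
    refine integrable_bdd_mul_of_compact (C := b - a) hmZ.aestronglyMeasurable (fun z => ?_)
      ((hWc.comp continuous_fst).mul (hκ.continuous.comp continuous_snd)) ?_
    · rw [abs_abs, abs_le]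
      constructor <;> linarith [(hVab z.1).1, (hVab z.1).2, (hVab (z.1 - z.2)).1,
        (hVab (z.1 - z.2)).2]
    · refine HasCompactSupport.intro (hWs.isCompact.prod hκ.compact.isCompact) fun z hz => ?_
      by_cases h1 : z.1 ∈ tsupport W
      · rw [image_eq_zero_of_notMem_tsupport (f := κ) (fun h2 => hz ⟨h1, h2⟩), mul_zero]
      · rw [image_eq_zero_of_notMem_tsupport h1, zero_mul]
  -- the error of replacing `V (p - e)` by `V p`
  have hZle : ∫ p, ∫ e, |V (p - e) - V p| * (W p * κ e) ≤ η / 2 := by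
    rw [integral_integral_swap hZi]
    calc ∫ e, ∫ p, |V (p - e) - V p| * (W p * κ e) ≤ ∫ e, κ e * (η / 2) := by
          refine integral_mono hZi.integral_prod_right (hκi.mul_const _) fun e => ?_
          have : ∫ p, |V (p - e) - V p| * (W p * κ e) = κ e * ∫ p, W p * |V (p - e) - V p| := by
            rw [← integral_const_mul]
            exact integral_congr_ae (Eventually.of_forall fun p => by ring)
          simp only [this]
          by_cases he : ‖e‖ < r
          · exact mul_le_mul_of_nonneg_left (hrω e he) (molPlane_nonneg m n e)
          · rw [hκdef, molPlane_eq_zero hm hnr (not_lt.1 he), zero_mul, zero_mul]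
      _ = η / 2 := by rw [integral_mul_const, hκdef, molPlane_integral, one_mul]
  -- after integration in `e`: the integrand of the claim, the translation error, and the error at
  -- time zero
  have hpt : ∀ p, ∫ e, doubled f U V φ κ p e ≤ G p + (∫ e, |V (p - e) - V p| * (W p * κ e)) +
      (if |p.2| ≤ 2 / ((n : ℝ) + 1) then φ p else 0) * (Λ * (b - a) * Cm) := by
    intro p
    have hmVp : Measurable fun e => |V (p - e) - V p| := by fun_prop
    have j1 : Integrable fun e => G p * κ e := hκi.const_mul _
    have j2 : Integrable fun e => |V (p - e) - V p| * (W p * κ e) := by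
      refine integrable_bdd_mul_of_compact (C := b - a) hmVp.aestronglyMeasurable (fun e => ?_)
        (continuous_const.mul hκ.continuous) (hκ.compact.mul_left)
      rw [abs_abs, abs_le]
      constructor <;> linarith [(hVab p).1, (hVab p).2, (hVab (p - e)).1, (hVab (p - e)).2]
    have hdi : Integrable fun e => |dx κ e| :=
      (hκ.continuous_dx.integrable_of_hasCompactSupport hκ.hasCompactSupport_dx).abs
    have j3 : Integrable fun e => (if |p.2| ≤ 2 / ((n : ℝ) + 1) then φ p else 0) *
        (Λ * (b - a)) * |dx κ e| := hdi.const_mul _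
    have hle : ∀ e, doubled f U V φ κ p e ≤ G p * κ e + |V (p - e) - V p| * (W p * κ e) +
        (if |p.2| ≤ 2 / ((n : ℝ) + 1) then φ p else 0) * (Λ * (b - a)) * |dx κ e| := by
      intro e
      rw [doubled]
      refine add_le_add ?_ ?_
      · have hκe := molPlane_nonneg m n e
        have h1 : (|U p - V (p - e)| - |U p - V p|) * dt φ p ≤ |V (p - e) - V p| * |dt φ p| := by
          refine (le_abs_self _).trans ?_
          rw [abs_mul]
          refine mul_le_mul_of_nonneg_right ?_ (abs_nonneg _)
          refine (abs_abs_sub_abs_le_abs_sub _ _).trans (le_of_eq ?_)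
          rw [← abs_neg]; congr 1; ring
        have h2 : (cutFlux (fun p => kflux f (U p) (V (p - e))) p -
            cutFlux (fun p => kflux f (U p) (V p)) p) * dx φ p ≤
            Λ * |V (p - e) - V p| * |dx φ p| := by
          refine (le_abs_self _).trans ?_
          rw [abs_mul]
          refine mul_le_mul_of_nonneg_right ?_ (abs_nonneg _)
          simp only [cutFlux]
          split_ifs
          · exact abs_kflux_sub_le hL (hUab _) (hVab _) (hVab _)
          · rw [sub_zero, abs_zero]; exact mul_nonneg hΛ (abs_nonneg _)
        have h3 := mul_le_mul_of_nonneg_right (add_le_add h1 h2) hκe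
        simp only [hG, hW]
        change _ * molPlane m n e ≤ _
        linarith
      · have hφp := hφ0 p
        -- the two fluxes cancel unless time zero lies between `p` and `p - e`
        by_cases hpn : |p.2| ≤ 2 / ((n : ℝ) + 1)
        · rw [if_pos hpn]
          refine (le_abs_self _).trans ?_
          rw [abs_mul, abs_mul, abs_of_nonneg hφp]
          have h4 : |(if 0 < p.2 then kflux f (U p) (V (p - e)) else 0) -
              (if 0 < (p - e).2 then kflux f (U p) (V (p - e)) else 0)| ≤ Λ * (b - a) := by
            have := hd2 p (p - e)
            split_ifs <;> simp [this, mul_nonneg hΛ hba]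
          calc _ ≤ (Λ * (b - a)) * (φ p * |dx κ e|) :=
                mul_le_mul_of_nonneg_right h4 (by positivity)
            _ = _ := by ring
        · rw [if_neg hpn, zero_mul, zero_mul]
          by_cases hen : 2 / ((n : ℝ) + 1) ≤ |e.2|
          · rw [hκdef, dx_molPlane, mol_eq_zero hen, mul_zero, mul_zero, mul_zero]
          · rw [not_le] at hpn hen
            have hiff : 0 < p.2 ↔ 0 < (p - e).2 := by
              rw [Prod.snd_sub]
              obtain ⟨e1, e2⟩ := abs_lt.1 hen
              rcases lt_abs.1 hpn with h | h
              · constructor <;> intro <;> linarith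
              · constructor <;> intro <;> linarith
            simp only [hiff, sub_self, zero_mul, le_refl]
    have j0 : ∫ e, (G p * κ e + |V (p - e) - V p| * (W p * κ e) +
        (if |p.2| ≤ 2 / ((n : ℝ) + 1) then φ p else 0) * (Λ * (b - a)) * |dx κ e|) =
        G p + (∫ e, |V (p - e) - V p| * (W p * κ e)) +
        (if |p.2| ≤ 2 / ((n : ℝ) + 1) then φ p else 0) * (Λ * (b - a) * Cm) := by
      have j12 : Integrable fun e => G p * κ e + |V (p - e) - V p| * (W p * κ e) := j1.add j2
      rw [integral_add j12 j3, integral_add j1 j2, integral_const_mul, integral_const_mul, hκdef,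
        molPlane_integral, integral_abs_dx_molPlane, mul_one, mul_assoc]
    rw [← j0]
    suffices hdint : Integrable fun e => doubled f U V φ κ p e from
      integral_mono hdint ((j1.add j2).add j3) hle
    have hmd : Measurable fun e : ℝ × ℝ => kflux f (U p) (V (p - e)) :=
      (kflux_continuous hf).measurable.comp
        (measurable_const.prodMk (hV.comp (measurable_const.sub measurable_id)))
    simp only [doubled]
    refine Integrable.add ?_ ?_
    · refine integrable_bdd_mul_of_compact (C := (b - a) * |dt φ p| + Λ * (b - a) * |dx φ p|) ?_
        (fun e => ?_) hκ.continuous hκ.compact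
      · refine (Measurable.add ?_ ?_).aestronglyMeasurable
        · fun_prop
        · simp only [cutFlux]
          refine Measurable.mul_const ?_ _
          by_cases h : 0 < p.2
          · simpa [h] using hmd
          · simp [h]
      · refine (abs_add_le _ _).trans (add_le_add ?_ ?_)
        · rw [abs_mul, abs_abs]
          exact mul_le_mul_of_nonneg_right (hd1 _ _) (abs_nonneg _)
        · rw [abs_mul]
          exact mul_le_mul_of_nonneg_right ((abs_cutFlux_le _ p).trans (hd2 _ _)) (abs_nonneg _)
    · refine integrable_bdd_mul_of_compact (C := Λ * (b - a)) ?_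
        (fun e => ?_) (continuous_const.mul hκ.continuous_dx) hκ.hasCompactSupport_dx.mul_left
      · refine (Measurable.sub ?_ ?_).aestronglyMeasurable
        · by_cases h : 0 < p.2
          · simpa [h] using hmd
          · simp [h]
        · exact Measurable.ite (measurableSet_lt measurable_const (by fun_prop)) hmd
            measurable_const
      · have := hd2 p (p - e)
        split_ifs <;> simp [this, mul_nonneg hΛ hba]
  have herri : Integrable fun p : ℝ × ℝ =>
      (if |p.2| ≤ 2 / ((n : ℝ) + 1) then φ p else 0) * (Λ * (b - a) * Cm) := by
    refine Integrable.mul_const ?_ _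
    refine (hφ.continuous.integrable_of_hasCompactSupport hφ.compact).mono
      (Measurable.ite (measurableSet_le (by fun_prop) measurable_const)
        hφ.continuous.measurable measurable_const).aestronglyMeasurable
      (Eventually.of_forall fun p => ?_)
    rw [Real.norm_eq_abs, Real.norm_eq_abs]
    exact abs_ite_le le_rfl
  have hZi' : Integrable fun p => ∫ e, |V (p - e) - V p| * (W p * κ e) := hZi.integral_prod_left
  have hfin := integral_mono hJi ((hGi.add hZi').add herri) hpt
  have hadd : Integrable fun p => G p + ∫ e, |V (p - e) - V p| * (W p * κ e) := hGi.add hZi'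
  have : ∫ p, (G p + (∫ e, |V (p - e) - V p| * (W p * κ e)) +
      (if |p.2| ≤ 2 / ((n : ℝ) + 1) then φ p else 0) * (Λ * (b - a) * Cm)) =
      (∫ p, G p) + (∫ p, ∫ e, |V (p - e) - V p| * (W p * κ e)) +
      ∫ p : ℝ × ℝ, (if |p.2| ≤ 2 / ((n : ℝ) + 1) then φ p else 0) * (Λ * (b - a) * Cm) := by
    rw [integral_add hadd herri, integral_add hGi hZi']
  have hfin' : ∫ p, ∫ e, doubled f U V φ κ p e ≤ ∫ p, (G p + (∫ e, |V (p - e) - V p| * (W p * κ e)) +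
      (if |p.2| ≤ 2 / ((n : ℝ) + 1) then φ p else 0) * (Λ * (b - a) * Cm)) := hfin
  rw [this] at hfin'
  linarith

end Doubling

end ConservationLaw

end

/-! ### Kruzhkov entropies and the distance to an interval -/

noncomputable section

namespace ConservationLaw

lemma ae_abs_le_of_memLp_top {X : Type*} [MeasurableSpace X] {μ : Measure X} {g : X → ℝ}
    (h : MemLp g ⊤ μ) : ∀ᵐ x ∂μ, |g x| ≤ (eLpNorm g ⊤ μ).toReal := by
  rw [eLpNorm_exponent_top]
  filter_upwards [ae_le_eLpNormEssSup (f := g) (μ := μ)] with x hx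
  have h2 : eLpNormEssSup g μ ≠ ⊤ := by
    rw [← eLpNorm_exponent_top]; exact h.eLpNorm_ne_top
  have := ENNReal.toReal_mono h2 hx
  simpa using this

lemma ae_fiber {P : ℝ × ℝ → Prop} (h : ∀ᵐ p, P p) : ∀ᵐ t : ℝ, ∀ᵐ x : ℝ, P (x, t) := by
  rw [Measure.volume_eq_prod] at h
  have h2 := (Measure.measurePreserving_swap (μ := (volume : Measure ℝ))
    (ν := (volume : Measure ℝ))).quasiMeasurePreserving.ae h
  exact Measure.ae_ae_of_ae_prod h2

/-- The converse of `ae_fiber` by Tonelli's theorem, for measurable conditions. -/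
lemma ae_of_ae_fiber {P : ℝ × ℝ → Prop} (hm : MeasurableSet {p | P p})
    (h : ∀ᵐ t : ℝ, ∀ᵐ x : ℝ, P (x, t)) : ∀ᵐ p, P p := by
  rw [Measure.volume_eq_prod]
  have h2 : ∀ᵐ q : ℝ × ℝ ∂(volume.prod volume), P q.swap :=
    (Measure.ae_prod_mem_iff_ae_ae_mem (s := {q : ℝ × ℝ | P q.swap})
      (measurable_swap hm)).2 h
  have h3 := (Measure.measurePreserving_swap (μ := (volume : Measure ℝ))
    (ν := (volume : Measure ℝ))).quasiMeasurePreserving.ae h2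
  simpa using h3

lemma abs_sub_lipschitz (k : ℝ) : LipschitzWith 1 fun v : ℝ => |v - k| := by
  refine LipschitzWith.of_dist_le_mul fun x y => ?_
  rw [Real.dist_eq, Real.dist_eq, NNReal.coe_one, one_mul]
  refine (abs_abs_sub_abs_le_abs_sub _ _).trans (le_of_eq ?_)
  congr 1; ring

/-- Kruzhkov's functions form an entropy pair. -/
lemma isEntropyPair_kruzkov {f : ℝ → ℝ} (hf : ContDiff ℝ 1 f) (k : ℝ) :
    IsEntropyPair f (fun v => |v - k|) (fun v => kflux f v k) := by
  refine ⟨?_, fun v w => ?_⟩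
  · have h : ConvexOn ℝ univ fun v : ℝ => ‖v‖ := convexOn_univ_norm
    have := h.translate_left (-k)
    simpa [Real.norm_eq_abs, Function.comp_def, sub_eq_add_neg] using this
  · symm
    refine integral_eq_of_hasDerivAt_off_countable (fun v => kflux f v k)
      (fun r => deriv (fun v => |v - k|) r * deriv f r) (countable_singleton k) ?_ ?_ ?_
    · exact ((kflux_continuous hf.continuous).comp
        (continuous_id.prodMk continuous_const)).continuousOn
    · intro r hr
      have hfd : HasDerivAt f (deriv f r) r := (hf.differentiable (by simp) r).hasDerivAt
      have hrk : r ≠ k := hr.2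
      rcases lt_or_gt_of_ne hrk with h | h
      · have e1 : (fun v => |v - k|) =ᶠ[𝓝 r] fun v => k - v := by
          filter_upwards [Iio_mem_nhds h] with v hv
          rw [abs_sub_comm, abs_of_nonneg (by linarith [mem_Iio.1 hv])]
        have e2 : (fun v => kflux f v k) =ᶠ[𝓝 r] fun v => f k - f v := by
          filter_upwards [Iio_mem_nhds h] with v hv
          exact kflux_of_ge (le_of_lt hv)
        rw [e1.deriv_eq, ((hasDerivAt_id' r).const_sub k).deriv]
        have := (hfd.const_sub (f k)).congr_of_eventuallyEq e2
        simpa using this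
      · have e1 : (fun v => |v - k|) =ᶠ[𝓝 r] fun v => v - k := by
          filter_upwards [Ioi_mem_nhds h] with v hv
          rw [abs_of_nonneg (by linarith [mem_Ioi.1 hv])]
        have e2 : (fun v => kflux f v k) =ᶠ[𝓝 r] fun v => f v - f k := by
          filter_upwards [Ioi_mem_nhds h] with v hv
          exact kflux_of_le (le_of_lt hv)
        rw [e1.deriv_eq, ((hasDerivAt_id' r).sub_const k).deriv]
        have := (hfd.sub_const (f k)).congr_of_eventuallyEq e2
        simpa using this
    · have hb : ∀ r, ‖deriv (fun v => |v - k|) r‖ ≤ 1 := fun r => by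
        simpa using norm_deriv_le_of_lipschitz (abs_sub_lipschitz k)
      have hi := (hf.continuous_deriv (by simp)).intervalIntegrable (μ := volume) v w
      exact ⟨hi.1.bdd_mul (measurable_deriv _).aestronglyMeasurable (Eventually.of_forall hb),
        hi.2.bdd_mul (measurable_deriv _).aestronglyMeasurable (Eventually.of_forall hb)⟩

lemma IsTestFunction.hasCompactSupport_slice_t {φ : ℝ × ℝ → ℝ} (h : IsTestFunction φ) (x : ℝ) :
    HasCompactSupport fun t => φ (x, t) :=
  HasCompactSupport.intro (h.compact.isCompact.image continuous_snd) fun t ht =>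
    image_eq_zero_of_notMem_tsupport fun h' => ht ⟨(x, t), h', rfl⟩

lemma IsTestFunction.hasCompactSupport_slice_x {φ : ℝ × ℝ → ℝ} (h : IsTestFunction φ) (t : ℝ) :
    HasCompactSupport fun x => φ (x, t) :=
  HasCompactSupport.intro (h.compact.isCompact.image continuous_fst) fun x hx =>
    image_eq_zero_of_notMem_tsupport fun h' => hx ⟨(x, t), h', rfl⟩

lemma IsTestFunction.integral_Iic_dt {φ : ℝ × ℝ → ℝ} (h : IsTestFunction φ) (x s : ℝ) :
    ∫ t in Iic s, dt φ (x, t) = φ (x, s) := by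
  refine Eq.trans ?_ (HasCompactSupport.integral_Iic_deriv_eq
    ((h.smooth.comp (contDiff_prodMk_right x)).of_le (by simp)) (h.hasCompactSupport_slice_t x) s)
  exact integral_congr_ae (Eventually.of_forall fun t =>
    (hasDerivAt_dt (h.differentiable (x, t))).deriv.symm)

lemma integral_deriv_eq_zero_of_compact {g g' : ℝ → ℝ} (hg : ∀ x, HasDerivAt g (g' x) x)
    (hg' : Continuous g') (hc : HasCompactSupport g) : ∫ x, g' x = 0 := by
  have hgc : Continuous g := continuous_iff_continuousAt.2 fun x => (hg x).continuousAt
  have hd : g' = deriv g := funext fun x => (hg x).deriv.symm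
  refine integral_eq_zero_of_hasDerivAt_of_integrable hg ?_ (hgc.integrable_of_hasCompactSupport hc)
  rw [hd] at hg' ⊢
  exact hg'.integrable_of_hasCompactSupport hc.deriv

lemma IsTestFunction.integral_dt_slice {φ : ℝ × ℝ → ℝ} (h : IsTestFunction φ) (x : ℝ) :
    ∫ t, dt φ (x, t) = 0 :=
  integral_deriv_eq_zero_of_compact (fun t => hasDerivAt_dt (h.differentiable (x, t)))
    (h.continuous_dt.comp (by fun_prop)) (h.hasCompactSupport_slice_t x)

lemma IsTestFunction.integral_dx_slice {φ : ℝ × ℝ → ℝ} (h : IsTestFunction φ) (t : ℝ) :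
    ∫ x, dx φ (x, t) = 0 :=
  integral_deriv_eq_zero_of_compact (fun x => hasDerivAt_dx (h.differentiable (x, t)))
    (h.continuous_dx.comp (by fun_prop)) (h.hasCompactSupport_slice_x t)

/-- Constants solve the equation with the flux switched off for nonpositive times. -/
lemma IsTestFunction.integral_const {φ : ℝ × ℝ → ℝ} (h : IsTestFunction φ) (c d : ℝ) :
    ∫ p, (c * dt φ p + cutFlux (fun _ => d) p * dx φ p) = 0 := by
  have i1 : Integrable fun p => c * dt φ p :=
    (h.continuous_dt.integrable_of_hasCompactSupport h.hasCompactSupport_dt).const_mul c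
  have i2 : Integrable fun p => cutFlux (fun _ => d) p * dx φ p :=
    integrable_bdd_mul_of_compact (C := |d|) (cutFlux_measurable measurable_const).aestronglyMeasurable
      (fun p => abs_cutFlux_le _ p) h.continuous_dx h.hasCompactSupport_dx
  rw [integral_add i1 i2]
  have e1 : ∫ p, c * dt φ p = 0 := by
    rw [Measure.volume_eq_prod, integral_prod _ i1]
    simp_rw [integral_const_mul, h.integral_dt_slice]; simp
  have e2 : ∫ p, cutFlux (fun _ => d) p * dx φ p = 0 := by
    rw [Measure.volume_eq_prod, integral_prod_symm _ i2]
    have : ∀ t, ∫ x, cutFlux (fun _ => d) (x, t) * dx φ (x, t) = 0 := by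
      intro t
      simp only [cutFlux]
      rw [integral_const_mul, h.integral_dx_slice, mul_zero]
    simp [this]
  rw [e1, e2, add_zero]

/-- Subsolutions form a convex cone, and constants may be added to the density and to the flux at
positive times. -/
lemma IsPlaneSubsolution.combine {E₁ E₂ Q₁ Q₂ : ℝ × ℝ → ℝ} {C : ℝ} (h₁ : IsPlaneSubsolution E₁ Q₁)
    (h₂ : IsPlaneSubsolution E₂ Q₂) (hE₁ : Measurable E₁) (hE₂ : Measurable E₂)
    (hQ₁ : Measurable Q₁) (hQ₂ : Measurable Q₂) (bE₁ : ∀ p, |E₁ p| ≤ C) (bE₂ : ∀ p, |E₂ p| ≤ C)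
    (bQ₁ : ∀ p, |Q₁ p| ≤ C) (bQ₂ : ∀ p, |Q₂ p| ≤ C) {α β : ℝ} (hα : 0 ≤ α) (hβ : 0 ≤ β) (c d : ℝ) :
    IsPlaneSubsolution (fun p => α * E₁ p + β * E₂ p + c)
      (fun p => α * Q₁ p + β * Q₂ p + cutFlux (fun _ => d) p) := by
  intro φ hφ hφ0
  have k₁ := h₁ φ hφ hφ0
  have k₂ := h₂ φ hφ hφ0
  have i₁ : Integrable fun p => E₁ p * dt φ p + Q₁ p * dx φ p :=
    (integrable_bdd_mul_of_compact hE₁.aestronglyMeasurable bE₁ hφ.continuous_dt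
      hφ.hasCompactSupport_dt).add (integrable_bdd_mul_of_compact hQ₁.aestronglyMeasurable bQ₁
      hφ.continuous_dx hφ.hasCompactSupport_dx)
  have i₂ : Integrable fun p => E₂ p * dt φ p + Q₂ p * dx φ p :=
    (integrable_bdd_mul_of_compact hE₂.aestronglyMeasurable bE₂ hφ.continuous_dt
      hφ.hasCompactSupport_dt).add (integrable_bdd_mul_of_compact hQ₂.aestronglyMeasurable bQ₂
      hφ.continuous_dx hφ.hasCompactSupport_dx)
  have i₃ : Integrable fun p => c * dt φ p + cutFlux (fun _ => d) p * dx φ p :=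
    ((hφ.continuous_dt.integrable_of_hasCompactSupport hφ.hasCompactSupport_dt).const_mul c).add
      (integrable_bdd_mul_of_compact (C := |d|)
        (cutFlux_measurable measurable_const).aestronglyMeasurable
        (fun p => abs_cutFlux_le _ p) hφ.continuous_dx hφ.hasCompactSupport_dx)
  have i₁₂ : Integrable fun p => α * (E₁ p * dt φ p + Q₁ p * dx φ p) +
      β * (E₂ p * dt φ p + Q₂ p * dx φ p) := (i₁.const_mul α).add (i₂.const_mul β)
  have : ∫ p, ((α * E₁ p + β * E₂ p + c) * dt φ p +
      (α * Q₁ p + β * Q₂ p + cutFlux (fun _ => d) p) * dx φ p) =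
      α * (∫ p, (E₁ p * dt φ p + Q₁ p * dx φ p)) + β * ∫ p, (E₂ p * dt φ p + Q₂ p * dx φ p) := by
    rw [← integral_const_mul, ← integral_const_mul, ← integral_add (i₁.const_mul α) (i₂.const_mul β)]
    refine Eq.trans ?_ ((integral_add i₁₂ i₃).trans (by rw [hφ.integral_const c d, add_zero]))
    exact integral_congr_ae (Eventually.of_forall fun p => by ring)
  rw [this]
  positivity

/-- The distance to the interval `[α, β]`, written as a combination of Kruzhkov entropies. -/
def gap (α β v : ℝ) : ℝ := (|v - α| + |v - β| - (β - α)) / 2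

/-- The flux that belongs to `gap`, normalised to vanish on `[α, β]`. -/
def gapFlux (f : ℝ → ℝ) (α β v : ℝ) : ℝ := (kflux f v α + kflux f v β - (f β - f α)) / 2

lemma gap_of_mem {α β v : ℝ} (h : v ∈ Icc α β) : gap α β v = 0 := by
  rw [gap, abs_of_nonneg (sub_nonneg.2 h.1), abs_of_nonpos (sub_nonpos.2 h.2)]; ring

lemma gap_of_ge {α β v : ℝ} (hαβ : α ≤ β) (h : β ≤ v) : gap α β v = v - β := by
  rw [gap, abs_of_nonneg (by linarith), abs_of_nonneg (by linarith)]; ring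

lemma gap_of_le {α β v : ℝ} (hαβ : α ≤ β) (h : v ≤ α) : gap α β v = α - v := by
  rw [gap, abs_of_nonpos (by linarith), abs_of_nonpos (by linarith)]; ring

lemma gapFlux_of_mem {f : ℝ → ℝ} {α β v : ℝ} (h : v ∈ Icc α β) : gapFlux f α β v = 0 := by
  rw [gapFlux, kflux_of_le h.1, kflux_of_ge h.2]; ring

lemma gapFlux_of_ge {f : ℝ → ℝ} {α β v : ℝ} (hαβ : α ≤ β) (h : β ≤ v) :
    gapFlux f α β v = f v - f β := by
  rw [gapFlux, kflux_of_le (hαβ.trans h), kflux_of_le h]; ring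

lemma gapFlux_of_le {f : ℝ → ℝ} {α β v : ℝ} (hαβ : α ≤ β) (h : v ≤ α) :
    gapFlux f α β v = f α - f v := by
  rw [gapFlux, kflux_of_ge h, kflux_of_ge (h.trans hαβ)]; ring

lemma gap_continuous (α β : ℝ) : Continuous (gap α β) := by unfold gap; fun_prop

lemma gapFlux_continuous {f : ℝ → ℝ} (hf : Continuous f) (α β : ℝ) :
    Continuous (gapFlux f α β) := by
  unfold gapFlux kflux; fun_prop

lemma cutFlux_linear (q₁ q₂ : ℝ × ℝ → ℝ) (α β d : ℝ) (p : ℝ × ℝ) :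
    α * cutFlux q₁ p + β * cutFlux q₂ p + cutFlux (fun _ => d) p =
      cutFlux (fun p => α * q₁ p + β * q₂ p + d) p := by
  simp only [cutFlux]; split_ifs <;> ring

/-- The entropy inequality for `ε + gap α β`, with a constant `d` added to the flux. -/
lemma IsKruzkov.gap {f : ℝ → ℝ} {a b : ℝ} {U : ℝ × ℝ → ℝ} {α β R : ℝ} (hf : Continuous f)
    (h : IsKruzkov f a b U) (hU : Measurable U) (hR : ∀ p, |U p| ≤ R) (hα : α ∈ Icc a b)
    (hβ : β ∈ Icc a b) (ε d : ℝ) :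
    IsPlaneSubsolution (fun p => ε + gap α β (U p))
      (cutFlux fun p => gapFlux f α β (U p) + d) := by
  have hk : ∀ k, Continuous fun v => kflux f v k := fun k =>
    (kflux_continuous hf).comp (continuous_id.prodMk continuous_const)
  have hR' : ∀ p, U p ∈ Icc (-R) R := fun p => abs_le.1 (hR p)
  obtain ⟨C₁, h₁⟩ := isCompact_Icc.exists_bound_of_continuousOn (s := Icc (-R) R)
    (hk α).continuousOn
  obtain ⟨C₂, h₂⟩ := isCompact_Icc.exists_bound_of_continuousOn (s := Icc (-R) R)
    (hk β).continuousOn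
  obtain ⟨C₃, h₃⟩ := isCompact_Icc.exists_bound_of_continuousOn (s := Icc (-R) R)
    (f := fun v => |v - α|) (by fun_prop)
  obtain ⟨C₄, h₄⟩ := isCompact_Icc.exists_bound_of_continuousOn (s := Icc (-R) R)
    (f := fun v => |v - β|) (by fun_prop)
  set C := max (max C₁ C₂) (max C₃ C₄) with hC
  have key := (h α hα).combine (C := C) (h β hβ) (by fun_prop) (by fun_prop)
    (cutFlux_measurable ((hk α).measurable.comp hU)) (cutFlux_measurable ((hk β).measurable.comp hU))
    (fun p => (h₃ _ (hR' p)).trans (by simp [hC])) (fun p => (h₄ _ (hR' p)).trans (by simp [hC]))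
    (fun p => (abs_cutFlux_le _ p).trans ((h₁ _ (hR' p)).trans (by simp [hC])))
    (fun p => (abs_cutFlux_le _ p).trans ((h₂ _ (hR' p)).trans (by simp [hC])))
    (α := 1 / 2) (β := 1 / 2) (by norm_num) (by norm_num) (ε - (β - α) / 2)
    (d - (f β - f α) / 2)
  convert! key using 2 with p p
  · rw [ConservationLaw.gap]; ring
  · rw [cutFlux_linear]
    simp only [cutFlux, gapFlux]
    congr 1; ring

end ConservationLaw

end

/-! ### Extension by the initial datum and the maximum principle -/

noncomputable section

namespace ConservationLaw

/-- The function that equals `u` for positive times and the initial datum `v₀` before. -/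
def glue (v₀ : ℝ → ℝ) (u : ℝ × ℝ → ℝ) (p : ℝ × ℝ) : ℝ := if 0 < p.2 then u p else v₀ p.1

lemma glue_measurable {v₀ : ℝ → ℝ} {u : ℝ × ℝ → ℝ} (hv : Measurable v₀) (hu : Measurable u) :
    Measurable (glue v₀ u) :=
  Measurable.ite (measurableSet_lt measurable_const measurable_snd) hu (hv.comp measurable_fst)

lemma ae_snd_ne_zero : ∀ᵐ p : ℝ × ℝ, p.2 ≠ 0 := by
  have : ∀ᵐ t : ℝ, t ≠ 0 := by simp [ae_iff, measure_singleton]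
  exact Measure.quasiMeasurePreserving_snd.ae this

/-- Extending an entropy solution by its initial datum turns the entropy inequalities with
initial data into inequalities on the plane. -/
lemma IsEntropySolution.glue_isPlaneSubsolution {f u₀ v₀ : ℝ → ℝ} {u u₁ : ℝ × ℝ → ℝ} {R : ℝ}
    (hf : ContDiff ℝ 1 f) (hu : IsEntropySolution f u₀ u) (hv : Measurable v₀) (hv₀ : v₀ =ᵐ[volume] u₀)
    (hu₁ : Measurable u₁) (huu : ∀ᵐ p, 0 < p.2 → u₁ p = u p) (hvR : ∀ x, |v₀ x| ≤ R)
    (huR : ∀ p, |u₁ p| ≤ R) (k : ℝ) :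
    IsPlaneSubsolution (fun p => |glue v₀ u₁ p - k|)
      (cutFlux fun p => kflux f (glue v₀ u₁ p) k) := by
  intro φ hφ hφ0
  set U := glue v₀ u₁ with hU
  have hUm : Measurable U := glue_measurable hv hu₁
  have hUR : ∀ p, U p ∈ Icc (-R) R := fun p => by
    rw [hU, glue]; split_ifs
    · exact abs_le.1 (huR p)
    · exact abs_le.1 (hvR p.1)
  have hk : Continuous fun v => kflux f v k :=
    (kflux_continuous hf.continuous).comp (continuous_id.prodMk continuous_const)
  obtain ⟨C₁, h₁⟩ := isCompact_Icc.exists_bound_of_continuousOn (s := Icc (-R) R) hk.continuousOn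
  obtain ⟨C₂, h₂⟩ := isCompact_Icc.exists_bound_of_continuousOn (s := Icc (-R) R)
    (f := fun v => |v - k|) (by fun_prop)
  have hmE : Measurable fun p => |U p - k| := by fun_prop
  have hmQ : Measurable (cutFlux fun p => kflux f (U p) k) :=
    cutFlux_measurable (hk.measurable.comp hUm)
  have iE : Integrable fun p => |U p - k| * dt φ p :=
    integrable_bdd_mul_of_compact hmE.aestronglyMeasurable (fun p => h₂ _ (hUR p))
      hφ.continuous_dt hφ.hasCompactSupport_dt
  have iQ : Integrable fun p => cutFlux (fun p => kflux f (U p) k) p * dx φ p :=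
    integrable_bdd_mul_of_compact hmQ.aestronglyMeasurable
      (fun p => (abs_cutFlux_le _ p).trans (h₁ _ (hUR p))) hφ.continuous_dx hφ.hasCompactSupport_dx
  have hms : MeasurableSet halfPlane := measurableSet_le measurable_const measurable_snd
  have hcompl : halfPlaneᶜ = univ ×ˢ Iio (0 : ℝ) := by ext p; simp [halfPlane]
  have hmain := hu.entropy _ _ (isEntropyPair_kruzkov hf k) φ hφ fun p _ => hφ0 p
  have iEQ : Integrable fun p => |U p - k| * dt φ p +
      cutFlux (fun p => kflux f (U p) k) p * dx φ p := iE.add iQ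
  -- integrating `∂ₜφ` over the lower half plane produces the initial term
  refine hmain.trans (le_of_eq (Eq.trans ?_ (integral_add_compl hms iEQ)))
  congr 1
  · refine setIntegral_congr_ae hms ?_
    filter_upwards [huu, ae_snd_ne_zero] with p hp hp0 hph
    have hpos : 0 < p.2 := lt_of_le_of_ne hph (Ne.symm hp0)
    simp only [cutFlux, hU, glue, if_pos hpos, hp hpos]
  · have e1 : ∫ p in halfPlaneᶜ, (|U p - k| * dt φ p +
        cutFlux (fun p => kflux f (U p) k) p * dx φ p) =
        ∫ p in halfPlaneᶜ, |U p - k| * dt φ p := by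
      refine setIntegral_congr_fun hms.compl fun p hp => ?_
      have : ¬ 0 < p.2 := by simp only [halfPlane, mem_compl_iff, mem_ofPred_eq, not_le] at hp; linarith
      simp [cutFlux, this]
    rw [e1, hcompl, Measure.volume_eq_prod, setIntegral_prod, Measure.restrict_univ]
    · refine integral_congr_ae ?_
      filter_upwards [hv₀] with x hx
      have e2 : ∫ t in Iio (0 : ℝ), |U (x, t) - k| * dt φ (x, t) =
          ∫ t in Iio (0 : ℝ), |v₀ x - k| * dt φ (x, t) := by
        refine setIntegral_congr_fun measurableSet_Iio fun t ht => ?_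
        have : ¬ 0 < t := not_lt.2 (le_of_lt ht)
        simp [hU, glue, this]
      rw [e2, integral_const_mul, ← integral_Iic_eq_integral_Iio, hφ.integral_Iic_dt, hx]
    · rw [← Measure.volume_eq_prod]; exact iE.integrableOn

/-- The projection onto the interval `[a, b]`. -/
def clamp (a b v : ℝ) : ℝ := max a (min v b)

lemma clamp_mem {a b : ℝ} (h : a ≤ b) (v : ℝ) : clamp a b v ∈ Icc a b :=
  ⟨le_max_left _ _, max_le h (min_le_right _ _)⟩

lemma clamp_of_mem {a b v : ℝ} (h : v ∈ Icc a b) : clamp a b v = v := by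
  rw [clamp, min_eq_left h.2, max_eq_right h.1]

lemma clamp_continuous (a b : ℝ) : Continuous (clamp a b) := by unfold clamp; fun_prop

lemma exists_lipschitz_bound {f : ℝ → ℝ} (hf : ContDiff ℝ 1 f) (R : ℝ) :
    ∃ Λ : ℝ, 0 ≤ Λ ∧ (∀ v ∈ Icc (-R) R, |deriv f v| ≤ Λ) ∧
      ∀ v ∈ Icc (-R) R, ∀ w ∈ Icc (-R) R, |f v - f w| ≤ Λ * |v - w| := by
  obtain ⟨C, hC⟩ := isCompact_Icc.exists_bound_of_continuousOn (s := Icc (-R) R)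
    (hf.continuous_deriv (by simp)).continuousOn
  have hC' : ∀ v ∈ Icc (-R) R, ‖deriv f v‖ ≤ max C 0 := fun v hv => (hC v hv).trans (le_max_left _ _)
  refine ⟨max C 0, le_max_right _ _, hC', fun v hv w hw => ?_⟩
  exact (convex_Icc (-R) R).norm_image_sub_le_of_norm_deriv_le
    (fun x _ => hf.differentiable (by simp) x) hC' hw hv

lemma exists_mem_Ioo_of_ae {P : ℝ → Prop} (h : ∀ᵐ t, P t) {α β : ℝ} (hαβ : α < β) :
    ∃ t ∈ Ioo α β, P t := by
  have hne : (ae (volume.restrict (Ioo α β))).NeBot := by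
    rw [ae_neBot, Ne, Measure.restrict_eq_zero, Real.volume_Ioo]
    simpa using hαβ
  exact ((ae_restrict_mem measurableSet_Ioo).and (ae_restrict_of_ae h)).exists

/-- The maximum principle: Kruzhkov solutions on the plane stay in the interval that contains
their initial values. -/
lemma ae_mem_Icc_of_isKruzkov {f : ℝ → ℝ} {a b R : ℝ} {U : ℝ × ℝ → ℝ} (hf : ContDiff ℝ 1 f)
    (hab : a ≤ b) (haR : a ∈ Icc (-R) R) (hbR : b ∈ Icc (-R) R) (h : IsKruzkov f a b U)
    (hU : Measurable U) (hR : ∀ p, |U p| ≤ R) (h0 : ∀ x t, t ≤ 0 → U (x, t) ∈ Icc a b) :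
    ∀ᵐ p, U p ∈ Icc a b := by
  obtain ⟨Λ, hΛ, -, hL⟩ := exists_lipschitz_bound hf R
  have hUR : ∀ p, U p ∈ Icc (-R) R := fun p => abs_le.1 (hR p)
  -- the distance of `U` to `[a, b]` is a subsolution that vanishes for negative times
  have hsub := h.gap hf.continuous hU hR (left_mem_Icc.2 hab) (right_mem_Icc.2 hab) 0 0
  simp only [zero_add, add_zero] at hsub
  have hg0 : ∀ v, 0 ≤ gap a b v := fun v => by
    rcases le_total v a with h1 | h1
    · rw [gap_of_le hab h1]; linarith
    rcases le_total b v with h2 | h2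
    · rw [gap_of_ge hab h2]; linarith
    · rw [gap_of_mem ⟨h1, h2⟩]
  have hgz : ∀ v, gap a b v = 0 → v ∈ Icc a b := fun v hv => by
    rcases lt_or_ge v a with h1 | h1
    · rw [gap_of_le hab h1.le] at hv; exact absurd hv (by linarith)
    rcases lt_or_ge b v with h2 | h2
    · rw [gap_of_ge hab h2.le] at hv; exact absurd hv (by linarith)
    · exact ⟨h1, h2⟩
  have hfg : ∀ v ∈ Icc (-R) R, |gapFlux f a b v| ≤ Λ * gap a b v := fun v hv => by
    rcases le_total v a with h1 | h1
    · rw [gap_of_le hab h1, gapFlux_of_le hab h1]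
      simpa [abs_of_nonneg (sub_nonneg.2 h1)] using hL a haR v hv
    rcases le_total b v with h2 | h2
    · rw [gap_of_ge hab h2, gapFlux_of_ge hab h2]
      simpa [abs_of_nonneg (sub_nonneg.2 h2)] using hL v hv b hbR
    · rw [gap_of_mem ⟨h1, h2⟩, gapFlux_of_mem ⟨h1, h2⟩]; simp
  obtain ⟨C, hC⟩ := isCompact_Icc.exists_bound_of_continuousOn (s := Icc (-R) R)
    (gap_continuous a b).continuousOn
  have hgm : Measurable fun p => gap a b (U p) := (gap_continuous a b).measurable.comp hU
  have hcone := hsub.exists_ae_cone_le hgm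
    (cutFlux_measurable ((gapFlux_continuous hf.continuous a b).measurable.comp hU))
    (fun p => hg0 _) (fun p => (le_abs_self _).trans (hC _ (hUR p))) hΛ
    (fun p => (abs_cutFlux_le _ p).trans (hfg _ (hUR p)))
  choose! G hG hG' using fun n : ℕ => hcone n (by positivity)
  refine ae_of_ae_fiber (hU measurableSet_Icc) ?_
  filter_upwards [ae_all_iff.2 hG] with T hT
  rcases le_or_gt T 0 with hT0 | hT0
  · exact Eventually.of_forall fun x => h0 x T hT0
  -- a good negative time at which the mass vanishes
  obtain ⟨τ, hτ1, hτG⟩ := exists_mem_Ioo_of_ae (ae_all_iff.2 hG) (show (-1 : ℝ) < 0 by norm_num)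
  have hzero : ∀ n : ℕ, ∀ᵐ x : ℝ, gap a b (U (x, T)) * cone n Λ (x, T) = 0 := by
    intro n
    have h1 := hG' n τ (hτG n) T (hT n) hτ1.1 (hτ1.2.trans hT0)
    have h2 : ∫ x, gap a b (U (x, τ)) * cone n Λ (x, τ) = 0 := by
      simp [gap_of_mem (h0 _ τ hτ1.2.le)]
    rw [h2] at h1
    have hnn : ∀ x, 0 ≤ gap a b (U (x, T)) * cone n Λ (x, T) := fun x =>
      mul_nonneg (hg0 _) (cone_nonneg _ _ _)
    have hci : Integrable fun x => gap a b (U (x, T)) * cone n Λ (x, T) := by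
      have hgm' : Measurable fun x => gap a b (U (x, T)) := hgm.comp (by fun_prop)
      refine integrable_bdd_mul_of_compact hgm'.aestronglyMeasurable
        (fun x => hC _ (hUR _)) ((cone_contDiff n Λ).continuous.comp (by fun_prop)) ?_
      refine hasCompactSupport_of_Icc (A := -n) (B := n) fun x hx => cone_eq_zero ?_
      have h5 : (n : ℝ) ≤ |x| := by
        by_contra h6
        exact hx (abs_le.1 (not_le.1 h6).le)
      have := mul_nonneg hΛ hT0.le
      linarith
    have h3 := (integral_eq_zero_iff_of_nonneg hnn hci).1 (le_antisymm h1 (integral_nonneg hnn))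
    exact h3
  filter_upwards [ae_all_iff.2 hzero] with x hx
  obtain ⟨n, hn⟩ := exists_nat_ge (|x| + 2 + Λ * T)
  have := hx n
  rw [cone_eq_one (by linarith), mul_one] at this
  exact hgz _ this

lemma IsPlaneSubsolution.congr_ae {E E' Q Q' : ℝ × ℝ → ℝ} (h : IsPlaneSubsolution E Q)
    (hE : ∀ᵐ p, E p = E' p) (hQ : ∀ᵐ p, Q p = Q' p) : IsPlaneSubsolution E' Q' := by
  intro φ hφ hφ0
  refine (h φ hφ hφ0).trans (le_of_eq (integral_congr_ae ?_))
  filter_upwards [hE, hQ] with p h1 h2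
  rw [h1, h2]

/-- Every entropy solution coincides almost everywhere with a Borel function on the plane that
takes values in `[a, b]`, satisfies the Kruzhkov inequalities and equals the initial datum for
nonpositive times. -/
lemma IsEntropySolution.exists_kruzkov {f u₀ : ℝ → ℝ} {u : ℝ × ℝ → ℝ} {a b : ℝ}
    (hf : ContDiff ℝ 1 f) (hu₀ : MemLp u₀ ⊤ volume) (hu : IsEntropySolution f u₀ u)
    (hab : a ≤ b) (h0 : ∀ᵐ x, u₀ x ∈ Icc a b) :
    ∃ U : ℝ × ℝ → ℝ, Measurable U ∧ (∀ p, U p ∈ Icc a b) ∧ IsKruzkov f a b U ∧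
      (∀ᵐ p, 0 < p.2 → U p = u p) ∧
      ∃ v₀ : ℝ → ℝ, Measurable v₀ ∧ v₀ =ᵐ[volume] u₀ ∧ ∀ x t, t ≤ 0 → U (x, t) = v₀ x := by
  have hum := hu.memLp.aestronglyMeasurable
  set R := max (eLpNorm u ⊤ (volume.restrict halfPlane)).toReal (max |a| |b|) with hRdef
  have haR : a ∈ Icc (-R) R := abs_le.1 (by simp [hRdef])
  have hbR : b ∈ Icc (-R) R := abs_le.1 (by simp [hRdef])
  set v₀ : ℝ → ℝ := fun x => clamp a b (hu₀.aestronglyMeasurable.mk u₀ x) with hv₀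
  have hv₀m : Measurable v₀ :=
    (clamp_continuous a b).measurable.comp hu₀.aestronglyMeasurable.stronglyMeasurable_mk.measurable
  have hv₀u : v₀ =ᵐ[volume] u₀ := by
    filter_upwards [hu₀.aestronglyMeasurable.ae_eq_mk, h0] with x hx hx'
    rw [hv₀]; simp only; rw [← hx, clamp_of_mem hx']
  -- Borel representatives, truncated so that they are bounded everywhere
  set u₁ : ℝ × ℝ → ℝ := fun p => clamp (-R) R (hum.mk u p) with hu₁
  have hu₁m : Measurable u₁ :=
    (clamp_continuous _ _).measurable.comp hum.stronglyMeasurable_mk.measurable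
  have hms : MeasurableSet halfPlane := measurableSet_le measurable_const measurable_snd
  have hu₁u : ∀ᵐ p, 0 < p.2 → u₁ p = u p := by
    have e1 := (ae_restrict_iff' hms).1 hum.ae_eq_mk
    have e2 := (ae_restrict_iff' hms).1 (ae_abs_le_of_memLp_top hu.memLp)
    filter_upwards [e1, e2] with p h1 h2 hp
    have hp' : p ∈ halfPlane := le_of_lt hp
    rw [hu₁]; simp only
    rw [← h1 hp', clamp_of_mem (abs_le.1 ((h2 hp').trans (le_max_left _ _)))]
  have hRR : -R ≤ R := haR.1.trans haR.2
  have hv₀ab : ∀ x, v₀ x ∈ Icc a b := fun x => clamp_mem hab _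
  have hv₀R : ∀ x, |v₀ x| ≤ R := fun x =>
    abs_le.2 ⟨haR.1.trans (hv₀ab x).1, (hv₀ab x).2.trans hbR.2⟩
  have hu₁R : ∀ p, |u₁ p| ≤ R := fun p => abs_le.2 (clamp_mem hRR _)
  set U₁ := glue v₀ u₁ with hU₁
  have hU₁m : Measurable U₁ := glue_measurable hv₀m hu₁m
  have hK : IsKruzkov f a b U₁ := fun k _ =>
    hu.glue_isPlaneSubsolution hf hv₀m hv₀u hu₁m hu₁u hv₀R hu₁R k
  have hU₁0 : ∀ x t, t ≤ 0 → U₁ (x, t) = v₀ x := fun x t ht => by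
    simp [hU₁, glue, not_lt.2 ht]
  have hU₁R : ∀ p, |U₁ p| ≤ R := fun p => by
    rw [hU₁, glue]; split_ifs
    · exact hu₁R p
    · exact hv₀R p.1
  have hmem := ae_mem_Icc_of_isKruzkov hf hab haR hbR hK hU₁m hU₁R
    fun x t ht => by rw [hU₁0 x t ht]; exact hv₀ab x
  refine ⟨fun p => clamp a b (U₁ p), (clamp_continuous a b).measurable.comp hU₁m,
    fun p => clamp_mem hab _, fun k hk => (hK k hk).congr_ae ?_ ?_, ?_, v₀, hv₀m, hv₀u, ?_⟩
  · filter_upwards [hmem] with p hp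
    rw [clamp_of_mem hp]
  · filter_upwards [hmem] with p hp
    simp only [cutFlux]
    rw [clamp_of_mem hp]
  · filter_upwards [hmem, hu₁u] with p hp hp' hpos
    rw [clamp_of_mem hp, ← hp' hpos, hU₁, glue, if_pos hpos]
  · intro x t ht
    simp only
    rw [hU₁0 x t ht, clamp_of_mem (hv₀ab x)]

end ConservationLaw

end

/-! ### Functions of bounded variation and one-sided limits -/

noncomputable section

namespace ConservationLaw

lemma mollify_eq_zero {n : ℕ} {g : ℝ → ℝ} {A B x : ℝ} (hg : ∀ t, t ∉ Icc A B → g t = 0)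
    (hx : x ∉ Icc (A - 2) (B + 2)) : mollify n g x = 0 := by
  rw [mollify_eq]
  refine integral_eq_zero_of_ae (Eventually.of_forall fun t => ?_)
  by_cases ht : t ∈ Icc A B
  · have h2 := two_div_le_two n
    have : mol n (t - x) = 0 := by
      refine mol_eq_zero (h2.trans ?_)
      rw [mem_Icc, not_and_or, not_le, not_le] at hx
      rw [le_abs]
      rcases hx with h | h
      · left; linarith [ht.1]
      · right; linarith [ht.2]
    simp [this]
  · simp [hg t ht]

/-- Functions of locally bounded variation are Lipschitz continuous in `L¹_loc` under
translations. -/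
lemma IsBVLoc.exists_integral_translate_le {u₀ v : ℝ → ℝ} (h : IsBVLoc u₀) (hv : Measurable v)
    (hvu : v =ᵐ[volume] u₀) {B : ℝ} (hB : ∀ x, |v x| ≤ B) (R : ℝ) :
    ∃ C : ℝ, 0 ≤ C ∧ ∀ s : ℝ, 0 < s → s ≤ 1 →
      ∫ x in Icc (-R) R, |v (x + s) - v x| ≤ C * s := by
  obtain ⟨-, μ, ν, hμ, hν, hD⟩ := h
  set K := Icc (-R - 4) (R + 4) with hK
  refine ⟨μ.real K + ν.real K, by positivity, fun s hs hs1 => ?_⟩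
  have hB0 : 0 ≤ B := (abs_nonneg _).trans (hB 0)
  set g : ℝ → ℝ := fun x => v (x + s) - v x with hg
  have hgm : Measurable g := (hv.comp (measurable_id.add_const s)).sub hv
  have hgB : ∀ x, |g x| ≤ 2 * B := fun x => (abs_sub _ _).trans (by linarith [hB (x + s), hB x])
  -- the sign of the difference; where `g x = 0`, the quotient is `0`
  set σ : ℝ → ℝ := (Icc (-R) R).indicator fun x => g x / |g x| with hσ
  have hσm : Measurable σ := (hgm.div hgm.abs).indicator measurableSet_Icc
  have hσ1 : ∀ x, |σ x| ≤ 1 := fun x => by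
    rw [hσ]
    by_cases hx : x ∈ Icc (-R) R
    · rw [indicator_of_mem hx, abs_div, abs_abs]; exact div_self_le_one _
    · rw [indicator_of_notMem hx, abs_zero]; exact zero_le_one
  have hσ0 : ∀ t, t ∉ Icc (-R) R → σ t = 0 := fun t ht => indicator_of_notMem ht _
  have hσloc : LocallyIntegrable σ := locallyIntegrable_of_bdd hσm hσ1
  -- the estimate for smooth test functions
  have hψ : ∀ n, ∫ x, g x * mollify n σ x ≤ (μ.real K + ν.real K) * s := by
    intro n
    set ψ := mollify n σ with hψdef
    have hψs : ContDiff ℝ (⊤ : ℕ∞) ψ := mollify_contDiff n hσloc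
    have hψc := hψs.continuous
    have hψ1 : ∀ x, |ψ x| ≤ 1 := abs_mollify_le n hσ1
    have hψ0 : ∀ x, x ∉ Icc (-R - 2) (R + 2) → ψ x = 0 := fun x hx => mollify_eq_zero hσ0 hx
    have hψcs : HasCompactSupport ψ := hasCompactSupport_of_Icc hψ0
    -- testing `v` with `Ψ`, whose derivative is `ψ(· - s) - ψ`, shifts the difference onto `v`; as
    -- `Ψ` is an integral over an interval of length `s`, it is bounded by `s`
    set Ψ : ℝ → ℝ := fun x => ∫ r in x..(x - s), ψ r with hΨ
    have hΨ' : ∀ x, HasDerivAt Ψ (ψ (x - s) - ψ x) x := by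
      intro x
      have hP : ∀ y, HasDerivAt (fun y => ∫ r in (0 : ℝ)..y, ψ r) (ψ y) y := fun y =>
        intervalIntegral.integral_hasDerivAt_right (hψc.intervalIntegrable _ _)
          hψc.stronglyMeasurable.stronglyMeasurableAtFilter hψc.continuousAt
      have e : Ψ = fun x => (∫ r in (0 : ℝ)..(x - s), ψ r) - ∫ r in (0 : ℝ)..x, ψ r := by
        funext y
        rw [hΨ, intervalIntegral.integral_interval_sub_left (hψc.intervalIntegrable _ _)
          (hψc.intervalIntegrable _ _)]
      rw [e]
      exact ((hP (x - s)).comp_sub_const x s).sub (hP x)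
    have hΨs : ContDiff ℝ (⊤ : ℕ∞) Ψ := by
      rw [contDiff_infty_iff_deriv]
      refine ⟨fun x => (hΨ' x).differentiableAt, ?_⟩
      rw [show deriv Ψ = fun x => ψ (x - s) - ψ x from funext fun x => (hΨ' x).deriv]
      exact (hψs.comp (contDiff_id.sub contDiff_const)).sub hψs
    have hΨb : ∀ x, |Ψ x| ≤ s := fun x => by
      have := intervalIntegral.norm_integral_le_of_norm_le_const (a := x) (b := x - s) (f := ψ)
        (C := 1) (fun r _ => hψ1 r)
      simpa [abs_of_pos hs] using this
    have hΨ0 : ∀ x, x ∉ K → Ψ x = 0 := by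
      intro x hx
      refine intervalIntegral.integral_zero_ae (Eventually.of_forall fun r hr => hψ0 r ?_)
      rw [uIoc_of_ge (by linarith)] at hr
      rw [hK, mem_Icc, not_and_or, not_le, not_le] at hx
      rintro ⟨h1, h2⟩
      rcases hx with h | h
      · linarith [hr.2]
      · linarith [hr.1]
    have hΨc : HasCompactSupport Ψ := hasCompactSupport_of_Icc hΨ0
    have hint : ∀ ρ : Measure ℝ, IsLocallyFiniteMeasure ρ → |∫ x, Ψ x ∂ρ| ≤ s * ρ.real K := by
      intro ρ _
      rw [← setIntegral_eq_integral_of_forall_compl_eq_zero hΨ0]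
      have := norm_setIntegral_le_of_norm_le_const (μ := ρ) (s := K) (f := Ψ) (C := s)
        isCompact_Icc.measure_lt_top fun x _ => hΨb x
      exact this
    have h1 := hD Ψ hΨs hΨc
    have h2 : ∫ x, u₀ x * deriv Ψ x = ∫ x, v x * (ψ (x - s) - ψ x) := by
      refine integral_congr_ae ?_
      filter_upwards [hvu] with x hx
      rw [(hΨ' x).deriv, hx]
    have i1 : Integrable fun x => v x * ψ (x - s) :=
      integrable_bdd_mul_of_compact hv.aestronglyMeasurable hB
        (hψc.comp (continuous_id.sub continuous_const)) (hψcs.comp_homeomorph (Homeomorph.subRight s))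
    have i2 : Integrable fun x => v x * ψ x :=
      integrable_bdd_mul_of_compact hv.aestronglyMeasurable hB hψc hψcs
    have i3 : Integrable fun x => v (x + s) * ψ x :=
      integrable_bdd_mul_of_compact (hv.comp (measurable_id.add_const s)).aestronglyMeasurable
        (fun x => hB _) hψc hψcs
    have h3 : ∫ x, v x * (ψ (x - s) - ψ x) = ∫ x, g x * ψ x := by
      simp_rw [mul_sub, hg, sub_mul]
      rw [integral_sub i1 i2, integral_sub i3 i2]
      congr 1
      rw [← integral_add_right_eq_self (fun x => v x * ψ (x - s)) s]
      simp
    rw [← h3, ← h2, h1]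
    have a1 := abs_le.1 (hint μ hμ)
    have a2 := abs_le.1 (hint ν hν)
    linarith [a1.1, a2.2]
  have hlim : Tendsto (fun n => ∫ x, g x * mollify n σ x) atTop (𝓝 (∫ x, g x * σ x)) := by
    refine tendsto_integral_of_dominated_convergence
      ((Icc (-R - 2) (R + 2)).indicator fun _ => 2 * B) (fun n => ?_) ?_ (fun n => ?_) ?_
    · exact (hgm.mul (mollify_contDiff n hσloc (k := 0)).continuous.measurable).aestronglyMeasurable
    · exact (integrableOn_const (by simp)).integrable_indicator measurableSet_Icc
    · refine Eventually.of_forall fun x => ?_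
      by_cases hx : x ∈ Icc (-R - 2) (R + 2)
      · rw [indicator_of_mem hx, norm_mul]
        exact (mul_le_of_le_one_right (norm_nonneg _) (abs_mollify_le n hσ1 x)).trans (hgB x)
      · rw [mollify_eq_zero hσ0 hx, mul_zero, norm_zero, indicator_of_notMem hx]
    · filter_upwards [mollify_ae_tendsto hσloc] with x hx using hx.const_mul _
  have hfin := le_of_tendsto' hlim hψ
  refine (le_of_eq ?_).trans hfin
  rw [← integral_indicator measurableSet_Icc]
  refine integral_congr_ae (Eventually.of_forall fun x => ?_)
  simp only [hσ]
  by_cases hx : x ∈ Icc (-R) R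
  · rw [indicator_of_mem hx, indicator_of_mem hx]
    rcases eq_or_ne (g x) 0 with h0 | h0
    · simp only [hg] at h0 ⊢; simp [h0]
    · have : |g x| ≠ 0 := abs_ne_zero.2 h0
      change |g x| = _
      field_simp
      exact (sq_abs _)
  · rw [indicator_of_notMem hx, indicator_of_notMem hx, mul_zero]

/-- The filter of right neighbourhoods of `x`, up to null sets. -/
def aeRight (x : ℝ) : Filter ℝ := ae volume ⊓ 𝓝[>] x

/-- The filter of left neighbourhoods of `x`, up to null sets. -/
def aeLeft (x : ℝ) : Filter ℝ := ae volume ⊓ 𝓝[<] x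

/-- The function `g` has essential one-sided limits at every point. -/
def HasTraces (g : ℝ → ℝ) : Prop :=
  ∀ x, (∃ l, Tendsto g (aeLeft x) (𝓝 l)) ∧ ∃ l, Tendsto g (aeRight x) (𝓝 l)

lemma eVariationOn_le_of_edist_le {f g : ℝ → ℝ} {s : Set ℝ}
    (h : ∀ x ∈ s, ∀ y ∈ s, edist (f x) (f y) ≤ edist (g x) (g y)) :
    eVariationOn f s ≤ eVariationOn g s := by
  refine iSup_le fun p => ?_
  exact (Finset.sum_le_sum fun i _ => h _ (p.2.2.2 _) _ (p.2.2.2 _)).trans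
    (eVariationOn.sum_le p.2.2.1 p.2.2.2)

/-- A bounded function whose translates are `L¹_loc`-Lipschitz has essential one-sided limits. The
averages over intervals of length `1 / (n + 1)` have uniformly bounded variation, and they converge
to `g` on a set of full measure, so that `g` has bounded variation on that set. -/
lemma hasTraces_of_integral_translate_le {g : ℝ → ℝ} (hg : Measurable g) {B : ℝ}
    (hB : ∀ x, |g x| ≤ B)
    (h : ∀ R : ℝ, 0 ≤ R → ∃ C : ℝ, ∀ n : ℕ, ∫ x in Icc (-R) R, |g (x + 1 / ((n : ℝ) + 1)) - g x| ≤
      C * (1 / ((n : ℝ) + 1))) : HasTraces g := by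
  have hloc : LocallyIntegrable g := locallyIntegrable_of_bdd hg hB
  have hII : ∀ x y, IntervalIntegrable g volume x y := fun x y =>
    (hloc.integrableOn_isCompact isCompact_uIcc).intervalIntegrable
  set G : ℕ → ℝ → ℝ := fun n x => (∫ r in x..(x + 1 / ((n : ℝ) + 1)), g r) / (1 / ((n : ℝ) + 1)) with hG
  set E : Set ℝ := {x | Tendsto (fun n => G n x) atTop (𝓝 (g x))} with hE
  have hEae : E ∈ ae volume := by
    filter_upwards [LocallyIntegrable.ae_hasDerivAt_integral hloc] with x hx
    have h1 := (hx x).tendsto_slope_zero_right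
    have h2 : Tendsto (fun n : ℕ => 1 / ((n : ℝ) + 1)) atTop (𝓝[>] 0) :=
      tendsto_nhdsWithin_iff.2 ⟨tendsto_one_div_add_atTop_nhds_zero_nat,
        Eventually.of_forall fun n => by simp only [mem_Ioi]; positivity⟩
    have h3 := h1.comp h2
    refine h3.congr fun n => ?_
    simp [hG, div_eq_inv_mul]
  have hBV : ∀ R : ℝ, 0 ≤ R → BoundedVariationOn g (E ∩ Icc (-R) R) := by
    intro R hR
    obtain ⟨C, hC⟩ := h R hR
    have hGC : ∀ n, eVariationOn (G n) (Icc (-R) R) ≤ ENNReal.ofReal C := by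
      intro n
      set s := 1 / ((n : ℝ) + 1) with hs
      have hs0 : 0 < s := by positivity
      set d : ℝ → ℝ := fun r => |g (r + s) - g r| with hd
      have hdm : Measurable d := ((hg.comp (measurable_id.add_const s)).sub hg).abs
      have hdI : ∀ x y, IntervalIntegrable d volume x y := fun x y =>
        ((locallyIntegrable_of_bdd (C := 2 * B) hdm fun x => by
          rw [hd, abs_abs]; exact (abs_sub _ _).trans (by linarith [hB (x + s), hB x])
          ).integrableOn_isCompact isCompact_uIcc).intervalIntegrable
      -- the variation of `G n` is controlled by the increments of the monotone function `M`
      set M : ℝ → ℝ := fun x => (∫ r in (-R)..x, d r) / s with hM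
      have hsub : ∀ x y, G n y - G n x = (∫ r in x..y, (g (r + s) - g r)) / s := by
        intro x y
        have hII' : IntervalIntegrable (fun r => g (r + s)) volume x y := by
          have := (hII (x + s) (y + s)).comp_add_right s
          simpa using this
        rw [intervalIntegral.integral_sub hII' (hII x y), intervalIntegral.integral_comp_add_right]
        simp only [hG]
        rw [← sub_div]
        congr 1
        have := intervalIntegral.integral_add_adjacent_intervals (hII x y) (hII y (y + s))
        have := intervalIntegral.integral_add_adjacent_intervals (hII x (x + s)) (hII (x + s) (y + s))
        linarith
      have hMsub : ∀ x y, M y - M x = (∫ r in x..y, d r) / s := by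
        intro x y
        simp only [hM]
        rw [← sub_div, intervalIntegral.integral_interval_sub_left (hdI _ _) (hdI _ _)]
      have hMmono : Monotone M := by
        intro x y hxy
        rw [← sub_nonneg, hMsub]
        exact div_nonneg (intervalIntegral.integral_nonneg hxy fun r _ => abs_nonneg _) hs0.le
      have hle : ∀ x y, x ≤ y → |G n y - G n x| ≤ M y - M x := by
        intro x y hxy
        rw [hsub, hMsub, abs_div, abs_of_pos hs0]
        exact div_le_div_of_nonneg_right (intervalIntegral.abs_integral_le_integral_abs hxy) hs0.le
      have h1 : eVariationOn (G n) (Icc (-R) R) ≤ eVariationOn M (Icc (-R) R) := by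
        refine eVariationOn_le_of_edist_le fun x _ y _ => ?_
        rw [edist_dist, edist_dist]
        refine ENNReal.ofReal_le_ofReal ?_
        rw [Real.dist_eq, Real.dist_eq]
        rcases le_total x y with hxy | hxy
        · rw [abs_sub_comm, abs_sub_comm (M x)]
          exact (hle x y hxy).trans (le_abs_self _)
        · exact (hle y x hxy).trans (le_abs_self _)
      have hm1 : -R ∈ Icc (-R) R := ⟨le_rfl, by linarith⟩
      have hm2 : R ∈ Icc (-R) R := ⟨by linarith, le_rfl⟩
      have h2 := (hMmono.monotoneOn (Icc (-R) R)).eVariationOn_eq hm1 hm2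
      rw [inter_self, hMsub] at h2
      refine h1.trans (h2.le.trans (ENNReal.ofReal_le_ofReal ?_))
      rw [div_le_iff₀ hs0, intervalIntegral.integral_of_le (by linarith), ← integral_Icc_eq_integral_Ioc]
      exact hC n
    have hle : eVariationOn g (E ∩ Icc (-R) R) ≤ ENNReal.ofReal C := by
      by_contra hcon
      have hev := eVariationOn.lowerSemicontinuous_aux (F := G) (p := atTop) (f := g)
        (s := E ∩ Icc (-R) R) (fun x hx => hx.1) (not_le.1 hcon)
      obtain ⟨n, hn⟩ := hev.exists
      exact absurd ((eVariationOn.mono (G n) inter_subset_right).trans (hGC n)) (not_le.2 hn)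
    exact ne_top_of_le_ne_top ENNReal.ofReal_ne_top hle
  intro x
  have hb := hBV (|x| + 1) (by positivity)
  have hI : Icc (-(|x| + 1)) (|x| + 1) ∈ 𝓝 x :=
    Icc_mem_nhds (by linarith [neg_abs_le x]) (by linarith [le_abs_self x])
  constructor
  · obtain ⟨l, hl⟩ := hb.exists_tendsto_left x
    refine ⟨l, hl.mono_left (le_inf (inf_le_right.trans inf_le_left) (le_principal_iff.2 ?_))⟩
    exact inter_mem (inter_mem (mem_inf_of_left hEae) (mem_inf_of_right (mem_nhdsWithin_of_mem_nhds hI)))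
      (mem_inf_of_right self_mem_nhdsWithin)
  · obtain ⟨l, hl⟩ := hb.exists_tendsto_right x
    refine ⟨l, hl.mono_left (le_inf (inf_le_right.trans inf_le_left) (le_principal_iff.2 ?_))⟩
    exact inter_mem (inter_mem (mem_inf_of_left hEae) (mem_inf_of_right (mem_nhdsWithin_of_mem_nhds hI)))
      (mem_inf_of_right self_mem_nhdsWithin)

end ConservationLaw

end

/-! ### Traces of Kruzhkov solutions -/

noncomputable section

namespace ConservationLaw

lemma IsTestFunction.translate {φ : ℝ × ℝ → ℝ} (h : IsTestFunction φ) (e : ℝ × ℝ) :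
    IsTestFunction fun p => φ (p - e) :=
  ⟨h.smooth.comp (contDiff_id.sub contDiff_const),
    h.compact.comp_homeomorph (Homeomorph.subRight e)⟩

/-- Kruzhkov solutions are invariant under translations in space. -/
lemma IsKruzkov.translate {f : ℝ → ℝ} {a b : ℝ} {U : ℝ × ℝ → ℝ} (h : IsKruzkov f a b U) (s : ℝ) :
    IsKruzkov f a b fun p => U (p + (s, 0)) := by
  intro k hk φ hφ hφ0
  have h1 := h k hk _ (hφ.translate (s, 0)) fun p => hφ0 _
  rw [← integral_add_right_eq_self _ ((s, 0) : ℝ × ℝ)] at h1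
  refine h1.trans (le_of_eq (integral_congr_ae (Eventually.of_forall ?_)))
  rintro ⟨x, t⟩
  have e1 : dt (fun p => φ (p - (s, 0))) ((x, t) + (s, 0)) = dt φ (x, t) := by
    refine dt_eq ((hφ.translate (s, 0)).differentiable _) ?_
    have := hasDerivAt_dt (hφ.differentiable (x, t))
    simpa using this
  have e2 : dx (fun p => φ (p - (s, 0))) ((x, t) + (s, 0)) = dx φ (x, t) := by
    refine dx_eq ((hφ.translate (s, 0)).differentiable _) ?_
    have h2 : HasDerivAt (fun y => φ (y, t)) (dx φ (x, t)) (x + s - s) := by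
      rw [add_sub_cancel_right]; exact hasDerivAt_dx (hφ.differentiable (x, t))
    have := h2.comp_sub_const (x + s) s
    simpa using this
  simp only [e1, e2, cutFlux]
  simp

/-- At almost every positive time, a Kruzhkov solution whose initial datum has locally bounded
variation possesses one-sided limits. By Kato's inequality for the solution and its translates, the
bound for the translates of the initial datum propagates inside cones. -/
lemma IsKruzkov.ae_hasTraces {f u₀ v₀ : ℝ → ℝ} {a b : ℝ} {U : ℝ × ℝ → ℝ} (hf : ContDiff ℝ 1 f)
    (hBV : IsBVLoc u₀) (hv₀ : Measurable v₀) (hv₀u : v₀ =ᵐ[volume] u₀) (hU : Measurable U)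
    (hUab : ∀ p, U p ∈ Icc a b) (h : IsKruzkov f a b U)
    (hU0 : ∀ x t, t ≤ 0 → U (x, t) = v₀ x) :
    ∀ᵐ t : ℝ, 0 < t → HasTraces fun x => U (x, t) := by
  set R := max |a| |b| with hR
  have habR : ∀ v ∈ Icc a b, v ∈ Icc (-R) R := fun v hv =>
    ⟨(abs_le.1 (le_max_left |a| |b|)).1.trans hv.1, hv.2.trans (abs_le.1 (le_max_right |a| |b|)).2⟩
  obtain ⟨Λ, hΛ, -, hL'⟩ := exists_lipschitz_bound hf R
  have hL : ∀ v ∈ Icc a b, ∀ w ∈ Icc a b, |f v - f w| ≤ Λ * |v - w| := fun v hv w hw =>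
    hL' v (habR v hv) w (habR w hw)
  set s : ℕ → ℝ := fun n => 1 / ((n : ℝ) + 1) with hs
  have hs0 : ∀ n, 0 < s n := fun n => by rw [hs]; positivity
  have hs1 : ∀ n, s n ≤ 1 := fun n => by
    rw [hs]; simp only
    rw [div_le_one (by positivity)]
    have : (0 : ℝ) ≤ n := by positivity
    linarith
  set V : ℕ → ℝ × ℝ → ℝ := fun n p => U (p + (s n, 0)) with hV
  have hVm : ∀ n, Measurable (V n) := fun n => hU.comp (measurable_id.add_const _)
  have hcont := hf.continuous
  have hd : ∀ n p, |U p - V n p| ≤ b - a := fun n p => by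
    have h1 := hUab p
    have h2 := hUab (p + (s n, 0))
    simp only [hV]
    rw [abs_le]; constructor <;> linarith [h1.1, h1.2, h2.1, h2.2]
  have hcone := fun n : ℕ => (h.kato hcont hL hΛ hU (hVm n) hUab (fun p => hUab _)
    (h.translate (s n))).exists_ae_cone_le (by fun_prop)
    (cutFlux_measurable ((kflux_continuous hcont).measurable.comp (hU.prodMk (hVm n))))
    (fun p => abs_nonneg _) (hd n) hΛ
    (fun p => (abs_cutFlux_le _ p).trans (abs_kflux_le hL (hUab _) (hUab _)))
  choose! G hG hG' using fun n N : ℕ => hcone n N (by positivity)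
  have hGall : ∀ᵐ t, ∀ n N, t ∈ G n N := ae_all_iff.2 fun n => ae_all_iff.2 fun N => hG n N
  -- at the negative time `τ` the solution is its initial datum
  obtain ⟨τ, hτ, hτG⟩ := exists_mem_Ioo_of_ae hGall (show (-1 : ℝ) < 0 by norm_num)
  filter_upwards [hGall] with T hT hT0
  refine hasTraces_of_integral_translate_le (B := R) (by fun_prop)
    (fun x => abs_le.2 (habR _ (hUab _))) fun r hr => ?_
  obtain ⟨N, hN⟩ := exists_nat_ge (r + 2 + Λ * T)
  obtain ⟨C, hC, hCs⟩ := hBV.exists_integral_translate_le hv₀ hv₀u (B := R)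
    (fun x => by
      have h1 := hUab (x, 0)
      rw [hU0 x 0 le_rfl] at h1
      exact abs_le.2 (habR _ h1)) (N + Λ)
  refine ⟨C, fun n => ?_⟩
  have hΛT : 0 ≤ Λ * T := mul_nonneg hΛ hT0.le
  have hcm : Continuous (cone N Λ) := (cone_contDiff N Λ).continuous
  have hint : ∀ t, Integrable fun x => |U (x, t) - V n (x, t)| * cone N Λ (x, t) := by
    intro t
    have hm : Measurable fun x => |U (x, t) - V n (x, t)| := by
      have := hVm n
      fun_prop
    refine integrable_bdd_mul_of_compact hm.aestronglyMeasurable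
      (fun x => by rw [abs_abs]; exact hd n _) (hcm.comp (by fun_prop)) ?_
    refine hasCompactSupport_of_Icc (A := -(N - Λ * t)) (B := N - Λ * t) fun x hx => cone_eq_zero ?_
    by_contra h6
    exact hx (abs_le.1 (not_le.1 h6).le)
  have hmeas : Measurable fun x => |v₀ (x + s n) - v₀ x| := by fun_prop
  calc ∫ x in Icc (-r) r, |U (x + s n, T) - U (x, T)|
      = ∫ x in Icc (-r) r, |U (x, T) - V n (x, T)| * cone N Λ (x, T) := by
        refine setIntegral_congr_fun measurableSet_Icc fun x hx => ?_
        have hx' : |x| ≤ r := abs_le.2 hx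
        simp only [hV]
        rw [cone_eq_one (by linarith), mul_one, abs_sub_comm]
        simp
    _ ≤ ∫ x, |U (x, T) - V n (x, T)| * cone N Λ (x, T) :=
        setIntegral_le_integral (hint T) (Eventually.of_forall fun x =>
          mul_nonneg (abs_nonneg _) (cone_nonneg _ _ _))
    _ ≤ ∫ x, |U (x, τ) - V n (x, τ)| * cone N Λ (x, τ) :=
        hG' n N τ (hτG n N) T (hT n N) hτ.1 (hτ.2.trans hT0)
    _ ≤ ∫ x in Icc (-(N + Λ)) (N + Λ), |v₀ (x + s n) - v₀ x| := by
        rw [← integral_indicator measurableSet_Icc]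
        refine integral_mono (hint τ) ?_ fun x => ?_
        · refine IntegrableOn.integrable_indicator ?_ measurableSet_Icc
          refine Measure.integrableOn_of_bounded (M := b - a) (by simp) hmeas.aestronglyMeasurable
            (Eventually.of_forall fun x => ?_)
          have := hd n (x, 0)
          simp only [hV, Prod.mk_add_mk, add_zero] at this
          rw [hU0 _ _ le_rfl, hU0 _ _ le_rfl, abs_sub_comm] at this
          simpa using this
        · by_cases hx : x ∈ Icc (-(N + Λ)) (N + Λ)
          · rw [indicator_of_mem hx]
            refine (mul_le_of_le_one_right (abs_nonneg _) (cone_le_one _ _ _)).trans (le_of_eq ?_)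
            simp only [hV, Prod.mk_add_mk, add_zero]
            rw [hU0 _ _ hτ.2.le, hU0 _ _ hτ.2.le, abs_sub_comm]
          · rw [indicator_of_notMem hx]
            simp only
            rw [cone_eq_zero, mul_zero]
            have h5 : N + Λ ≤ |x| := by
              by_contra h6
              exact hx (abs_le.1 (not_le.1 h6).le)
            nlinarith [hτ.1]
    _ ≤ C * s n := hCs (s n) (hs0 n) (hs1 n)

end ConservationLaw

end

/-! ### Averaging kernels, curves and plateau functions -/

noncomputable section

namespace ConservationLaw

lemma S'_eq_zero_of_nonpos {y : ℝ} (hy : y ≤ 0) : S' y = 0 := by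
  refine IsLocalMin.deriv_eq_zero (Eventually.of_forall fun z => ?_)
  rw [Real.smoothTransition.zero_of_nonpos hy]
  exact Real.smoothTransition.nonneg z

lemma S'_eq_zero_of_one_le {y : ℝ} (hy : 1 ≤ y) : S' y = 0 := by
  refine IsLocalMax.deriv_eq_zero (Eventually.of_forall fun z => ?_)
  rw [Real.smoothTransition.one_of_one_le hy]
  exact Real.smoothTransition.le_one z

lemma S'_hasCompactSupport : HasCompactSupport S' := by
  refine hasCompactSupport_of_Icc (A := 0) (B := 1) fun t ht => ?_
  rw [mem_Icc, not_and_or, not_le, not_le] at ht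
  rcases ht with h | h
  · exact S'_eq_zero_of_nonpos h.le
  · exact S'_eq_zero_of_one_le h.le

lemma S'_integrable : Integrable S' := S'_continuous.integrable_of_hasCompactSupport S'_hasCompactSupport

lemma S'_integral : ∫ y, S' y = 1 := by
  have h1 : ∫ y in Ioc (0 : ℝ) 1, S' y = ∫ y, S' y := by
    refine setIntegral_eq_integral_of_forall_compl_eq_zero fun y hy => ?_
    rw [mem_Ioc, not_and_or, not_lt, not_le] at hy
    rcases hy with h | h
    · exact S'_eq_zero_of_nonpos h
    · exact S'_eq_zero_of_one_le h.le
  rw [← h1, ← intervalIntegral.integral_of_le zero_le_one,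
    intervalIntegral.integral_eq_sub_of_hasDerivAt (fun x _ => hasDerivAt_S x)
      (S'_continuous.intervalIntegrable _ _), Real.smoothTransition.one, Real.smoothTransition.zero,
    sub_zero]

/-- The averaging kernel on `[a, a + δ]` with profile `S'`. -/
def ker (δ a x : ℝ) : ℝ := 1 / δ * S' ((x - a) / δ)

lemma ker_nonneg {δ : ℝ} (hδ : 0 < δ) (a x : ℝ) : 0 ≤ ker δ a x :=
  mul_nonneg (by positivity) (S'_nonneg _)

lemma ker_continuous (δ a : ℝ) : Continuous (ker δ a) :=
  continuous_const.mul (S'_continuous.comp (by fun_prop))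

lemma ker_eq_zero {δ a x : ℝ} (hδ : 0 < δ) (hx : x ∉ Ioo a (a + δ)) : ker δ a x = 0 := by
  rw [ker]
  rw [mem_Ioo, not_and_or, not_lt, not_lt] at hx
  rcases hx with h | h
  · rw [S'_eq_zero_of_nonpos (div_nonpos_of_nonpos_of_nonneg (by linarith) hδ.le), mul_zero]
  · rw [S'_eq_zero_of_one_le ((one_le_div hδ).2 (by linarith)), mul_zero]

lemma ker_integrable {δ : ℝ} (hδ : 0 < δ) (a : ℝ) : Integrable (ker δ a) := by
  have := ((S'_integrable.comp_div hδ.ne').comp_sub_right a).const_mul (1 / δ)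
  exact this

lemma ker_integral {δ : ℝ} (hδ : 0 < δ) (a : ℝ) : ∫ x, ker δ a x = 1 := by
  simp only [ker]
  rw [integral_const_mul, integral_sub_right_eq_self (fun x => S' (x / δ)) a,
    Measure.integral_comp_div S' δ, S'_integral, abs_of_pos hδ, smul_eq_mul, mul_one]
  field_simp

lemma abs_integral_ker_le {δ : ℝ} (hδ : 0 < δ) (a : ℝ) {G : ℝ → ℝ} {C : ℝ} (hC : ∀ x, |G x| ≤ C) :
    |∫ x, ker δ a x * G x| ≤ C := by
  calc |∫ x, ker δ a x * G x| ≤ ∫ x, ker δ a x * C := by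
        rw [← Real.norm_eq_abs]
        refine norm_integral_le_of_norm_le ((ker_integrable hδ a).mul_const C)
          (Eventually.of_forall fun x => ?_)
        rw [norm_mul, Real.norm_of_nonneg (ker_nonneg hδ a x), Real.norm_eq_abs]
        exact mul_le_mul_of_nonneg_left (hC x) (ker_nonneg hδ a x)
    _ = C := by rw [integral_mul_const, ker_integral hδ, one_mul]

/-- Averages over intervals on which `G` is essentially close to `l` are close to `l`. -/
lemma abs_integral_ker_sub_le {δ : ℝ} (hδ : 0 < δ) (a : ℝ) {G : ℝ → ℝ} {C l ε : ℝ}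
    (hG : Measurable G) (hC : ∀ x, |G x| ≤ C) (h : ∀ᵐ x, x ∈ Ioo a (a + δ) → |G x - l| ≤ ε) :
    |(∫ x, ker δ a x * G x) - l| ≤ ε := by
  have hi := ker_integrable hδ a
  have hiG : Integrable fun x => ker δ a x * G x := by
    simp_rw [mul_comm (ker δ a _)]
    exact hi.bdd_mul hG.aestronglyMeasurable (Eventually.of_forall hC)
  have e : (∫ x, ker δ a x * G x) - l = ∫ x, ker δ a x * (G x - l) := by
    simp_rw [mul_sub]
    rw [integral_sub hiG (hi.mul_const l), integral_mul_const, ker_integral hδ, one_mul]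
  rw [e]
  calc |∫ x, ker δ a x * (G x - l)| ≤ ∫ x, ker δ a x * ε := by
        rw [← Real.norm_eq_abs]
        refine norm_integral_le_of_norm_le (hi.mul_const ε) ?_
        filter_upwards [h] with x hx
        rw [norm_mul, Real.norm_of_nonneg (ker_nonneg hδ a x), Real.norm_eq_abs]
        by_cases hxa : x ∈ Ioo a (a + δ)
        · exact mul_le_mul_of_nonneg_left (hx hxa) (ker_nonneg hδ a x)
        · rw [ker_eq_zero hδ hxa, zero_mul, zero_mul]
    _ = ε := by rw [integral_mul_const, ker_integral hδ, one_mul]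

lemma exists_of_tendsto_aeRight {G : ℝ → ℝ} {x l : ℝ} (h : Tendsto G (aeRight x) (𝓝 l)) {ε : ℝ}
    (hε : 0 < ε) : ∃ r > 0, ∀ᵐ y, y ∈ Ioo x (x + r) → |G y - l| ≤ ε := by
  have h1 : {y | |G y - l| ≤ ε} ∈ aeRight x := by
    filter_upwards [h (Metric.closedBall_mem_nhds l hε)] with y hy
    simpa [Real.dist_eq] using hy
  obtain ⟨A, hA, B, hB, hAB⟩ := mem_inf_iff_superset.1 h1
  obtain ⟨z, hz, hzB⟩ := mem_nhdsGT_iff_exists_Ioo_subset.1 hB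
  refine ⟨z - x, sub_pos.2 hz, ?_⟩
  filter_upwards [hA] with y hy hyx
  exact hAB ⟨hy, hzB (by rwa [add_sub_cancel] at hyx)⟩

lemma exists_of_tendsto_aeLeft {G : ℝ → ℝ} {x l : ℝ} (h : Tendsto G (aeLeft x) (𝓝 l)) {ε : ℝ}
    (hε : 0 < ε) : ∃ r > 0, ∀ᵐ y, y ∈ Ioo (x - r) x → |G y - l| ≤ ε := by
  have h1 : {y | |G y - l| ≤ ε} ∈ aeLeft x := by
    filter_upwards [h (Metric.closedBall_mem_nhds l hε)] with y hy
    simpa [Real.dist_eq] using hy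
  obtain ⟨A, hA, B, hB, hAB⟩ := mem_inf_iff_superset.1 h1
  obtain ⟨z, hz, hzB⟩ := mem_nhdsLT_iff_exists_Ioo_subset.1 hB
  refine ⟨x - z, sub_pos.2 hz, ?_⟩
  filter_upwards [hA] with y hy hyx
  exact hAB ⟨hy, hzB (by rwa [sub_sub_cancel] at hyx)⟩

/-- The curve that starts at `x₀` at time `s` and has velocity `g`. -/
def curve (x₀ s : ℝ) (g : ℝ → ℝ) (t : ℝ) : ℝ := x₀ + ∫ r in s..t, g r

lemma intervalIntegrable_of_bdd {g : ℝ → ℝ} {C : ℝ} (hg : Measurable g) (hC : ∀ x, |g x| ≤ C)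
    (x y : ℝ) : IntervalIntegrable g volume x y :=
  ((locallyIntegrable_of_bdd hg hC).integrableOn_isCompact isCompact_uIcc).intervalIntegrable

lemma abs_curve_sub_le {g : ℝ → ℝ} {Λ : ℝ} (hg : Measurable g) (hΛ : ∀ t, |g t| ≤ Λ)
    (x₀ s t t' : ℝ) : |curve x₀ s g t - curve x₀ s g t'| ≤ Λ * |t - t'| := by
  have e : curve x₀ s g t - curve x₀ s g t' = ∫ r in t'..t, g r := by
    simp only [curve]
    rw [add_sub_add_left_eq_sub, intervalIntegral.integral_interval_sub_left
      (intervalIntegrable_of_bdd hg hΛ _ _) (intervalIntegrable_of_bdd hg hΛ _ _)]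
  rw [e]
  exact intervalIntegral.norm_integral_le_of_norm_le_const (a := t') (b := t) (f := g) (C := Λ)
    (fun r _ => hΛ r)

lemma curve_continuous {g : ℝ → ℝ} {Λ : ℝ} (hg : Measurable g) (hΛ : ∀ t, |g t| ≤ Λ)
    (x₀ s : ℝ) : Continuous (curve x₀ s g) := by
  have hΛ0 : 0 ≤ Λ := (abs_nonneg _).trans (hΛ 0)
  refine (LipschitzWith.of_dist_le_mul (K := ⟨Λ, hΛ0⟩) fun t t' => ?_).continuous
  exact abs_curve_sub_le hg hΛ x₀ s t t'

@[simp] lemma curve_self (x₀ s : ℝ) (g : ℝ → ℝ) : curve x₀ s g s = x₀ := by simp [curve]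

lemma abs_curve_le {g : ℝ → ℝ} {Λ : ℝ} (hg : Measurable g) (hΛ : ∀ t, |g t| ≤ Λ)
    (x₀ s t : ℝ) : |curve x₀ s g t| ≤ |x₀| + Λ * |t - s| := by
  have h := abs_curve_sub_le hg hΛ x₀ s t s
  rw [curve_self] at h
  have := abs_add_le x₀ (curve x₀ s g t - x₀)
  rw [add_sub_cancel] at this
  linarith

/-- A smooth substitute for the indicator function of `(α, β)`. -/
def plateau (δ α β x : ℝ) : ℝ :=
  Real.smoothTransition ((x - α) / δ) * Real.smoothTransition ((β - x) / δ)

/-- The part of the derivative of `plateau` that sits at its left end. -/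
def plateauL (δ α β x : ℝ) : ℝ := 1 / δ * S' ((x - α) / δ) * Real.smoothTransition ((β - x) / δ)

/-- The part of the derivative of `-plateau` that sits at its right end. -/
def plateauR (δ α β x : ℝ) : ℝ := 1 / δ * S' ((β - x) / δ) * Real.smoothTransition ((x - α) / δ)

lemma plateau_eq_zero {δ α β x : ℝ} (hδ : 0 < δ) (hx : x ∉ Ioo α β) : plateau δ α β x = 0 := by
  rw [mem_Ioo, not_and_or, not_lt, not_lt] at hx
  rw [plateau]
  rcases hx with h | h
  · rw [Real.smoothTransition.zero_of_nonpos (div_nonpos_of_nonpos_of_nonneg (by linarith) hδ.le),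
      zero_mul]
  · rw [Real.smoothTransition.zero_of_nonpos (x := (β - x) / δ)
      (div_nonpos_of_nonpos_of_nonneg (by linarith) hδ.le), mul_zero]

lemma plateauL_eq_zero {δ α β x : ℝ} (hδ : 0 < δ) (hx : x ∉ Ioo α β) : plateauL δ α β x = 0 := by
  rw [mem_Ioo, not_and_or, not_lt, not_lt] at hx
  rw [plateauL]
  rcases hx with h | h
  · rw [S'_eq_zero_of_nonpos (div_nonpos_of_nonpos_of_nonneg (by linarith) hδ.le), mul_zero, zero_mul]
  · rw [Real.smoothTransition.zero_of_nonpos (x := (β - x) / δ)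
      (div_nonpos_of_nonpos_of_nonneg (by linarith) hδ.le), mul_zero]

lemma plateauR_eq_zero {δ α β x : ℝ} (hδ : 0 < δ) (hx : x ∉ Ioo α β) : plateauR δ α β x = 0 := by
  rw [mem_Ioo, not_and_or, not_lt, not_lt] at hx
  rw [plateauR]
  rcases hx with h | h
  · rw [Real.smoothTransition.zero_of_nonpos (x := (x - α) / δ)
      (div_nonpos_of_nonpos_of_nonneg (by linarith) hδ.le), mul_zero]
  · rw [S'_eq_zero_of_nonpos (div_nonpos_of_nonpos_of_nonneg (by linarith) hδ.le), mul_zero, zero_mul]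

lemma plateau_nonneg (δ α β x : ℝ) : 0 ≤ plateau δ α β x :=
  mul_nonneg (Real.smoothTransition.nonneg _) (Real.smoothTransition.nonneg _)

lemma plateau_le_one (δ α β x : ℝ) : plateau δ α β x ≤ 1 :=
  mul_le_one₀ (Real.smoothTransition.le_one _) (Real.smoothTransition.nonneg _)
    (Real.smoothTransition.le_one _)

lemma plateau_continuous (δ : ℝ) : Continuous fun z : ℝ × ℝ × ℝ => plateau δ z.1 z.2.1 z.2.2 := by
  have := Real.smoothTransition.continuous
  unfold plateau; fun_prop

lemma plateauL_continuous (δ : ℝ) : Continuous fun z : ℝ × ℝ × ℝ => plateauL δ z.1 z.2.1 z.2.2 := by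
  have := Real.smoothTransition.continuous
  have := S'_continuous
  unfold plateauL; fun_prop

lemma plateauR_continuous (δ : ℝ) : Continuous fun z : ℝ × ℝ × ℝ => plateauR δ z.1 z.2.1 z.2.2 := by
  have := Real.smoothTransition.continuous
  have := S'_continuous
  unfold plateauR; fun_prop

lemma exists_S'_bound : ∃ M, 0 ≤ M ∧ ∀ y, S' y ≤ M := by
  obtain ⟨M, hM⟩ := S'_continuous.bounded_above_of_compact_support S'_hasCompactSupport
  exact ⟨M, (norm_nonneg _).trans (hM 0), fun y => (le_abs_self _).trans (hM y)⟩

lemma plateauL_nonneg {δ : ℝ} (hδ : 0 < δ) (α β x : ℝ) : 0 ≤ plateauL δ α β x :=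
  mul_nonneg (mul_nonneg (by positivity) (S'_nonneg _)) (Real.smoothTransition.nonneg _)

lemma plateauR_nonneg {δ : ℝ} (hδ : 0 < δ) (α β x : ℝ) : 0 ≤ plateauR δ α β x :=
  mul_nonneg (mul_nonneg (by positivity) (S'_nonneg _)) (Real.smoothTransition.nonneg _)

lemma exists_plateau_bound {δ : ℝ} (hδ : 0 < δ) : ∃ M, 0 ≤ M ∧
    ∀ α β x, plateauL δ α β x ≤ M ∧ plateauR δ α β x ≤ M := by
  obtain ⟨M, hM0, hM⟩ := exists_S'_bound
  refine ⟨1 / δ * M, by positivity, fun α β x => ⟨?_, ?_⟩⟩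
  · exact (mul_le_of_le_one_right (mul_nonneg (by positivity) (S'_nonneg _))
      (Real.smoothTransition.le_one _)).trans (mul_le_mul_of_nonneg_left (hM _) (by positivity))
  · exact (mul_le_of_le_one_right (mul_nonneg (by positivity) (S'_nonneg _))
      (Real.smoothTransition.le_one _)).trans (mul_le_mul_of_nonneg_left (hM _) (by positivity))

lemma hasDerivAt_plateau_x (δ α β x : ℝ) :
    HasDerivAt (fun x => plateau δ α β x) (plateauL δ α β x - plateauR δ α β x) x := by
  have h1 : HasDerivAt (fun x => (x - α) / δ) (1 / δ) x := ((hasDerivAt_id' x).sub_const α).div_const δ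
  have h2 : HasDerivAt (fun x => (β - x) / δ) (-1 / δ) x := ((hasDerivAt_id' x).const_sub β).div_const δ
  refine (((hasDerivAt_S _).comp x h1).mul ((hasDerivAt_S _).comp x h2)).congr_deriv ?_
  simp only [plateauL, plateauR, Function.comp]; ring

lemma hasDerivAt_plateau_t {δ x t ξ' ζ' : ℝ} {ξ ζ : ℝ → ℝ} (hξ : HasDerivAt ξ ξ' t)
    (hζ : HasDerivAt ζ ζ' t) :
    HasDerivAt (fun t => plateau δ (ξ t) (ζ t) x)
      (-ξ' * plateauL δ (ξ t) (ζ t) x + ζ' * plateauR δ (ξ t) (ζ t) x) t := by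
  have h1 : HasDerivAt (fun t => (x - ξ t) / δ) (-ξ' / δ) t := (hξ.const_sub x).div_const δ
  have h2 : HasDerivAt (fun t => (ζ t - x) / δ) (ζ' / δ) t := (hζ.sub_const x).div_const δ
  refine (((hasDerivAt_S _).comp t h1).mul ((hasDerivAt_S _).comp t h2)).congr_deriv ?_
  simp only [plateauL, plateauR, Function.comp]; ring

lemma mollify_measurable (n : ℕ) {g : ℝ → ℝ} (hg : LocallyIntegrable g) :
    Measurable (mollify n g) := (mollify_contDiff n hg (k := 0)).continuous.measurable

lemma curve_mollify_hasDerivAt (x₀ s : ℝ) (n : ℕ) {g : ℝ → ℝ} (hg : LocallyIntegrable g) (t : ℝ) :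
    HasDerivAt (curve x₀ s (mollify n g)) (mollify n g t) t := by
  have hc : Continuous (mollify n g) := (mollify_contDiff n hg (k := 0)).continuous
  exact (intervalIntegral.integral_hasDerivAt_right (hc.intervalIntegrable _ _)
    hc.stronglyMeasurable.stronglyMeasurableAtFilter hc.continuousAt).const_add x₀

lemma curve_mollify_contDiff (x₀ s : ℝ) (n : ℕ) {g : ℝ → ℝ} (hg : LocallyIntegrable g) :
    ContDiff ℝ (⊤ : ℕ∞) (curve x₀ s (mollify n g)) := by
  rw [contDiff_infty_iff_deriv]
  refine ⟨fun t => (curve_mollify_hasDerivAt x₀ s n hg t).differentiableAt, ?_⟩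
  rw [show deriv (curve x₀ s (mollify n g)) = mollify n g from
    funext fun t => (curve_mollify_hasDerivAt x₀ s n hg t).deriv]
  exact mollify_contDiff n hg

lemma curve_mollify_tendsto (x₀ s : ℝ) {g : ℝ → ℝ} {Λ : ℝ} (hg : Measurable g)
    (hΛ : ∀ t, |g t| ≤ Λ) (t : ℝ) :
    Tendsto (fun n => curve x₀ s (mollify n g) t) atTop (𝓝 (curve x₀ s g t)) := by
  have hl := locallyIntegrable_of_bdd hg hΛ
  refine Tendsto.const_add x₀ ?_
  refine intervalIntegral.tendsto_integral_filter_of_dominated_convergence (fun _ => Λ) ?_ ?_ ?_ ?_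
  · exact Eventually.of_forall fun n => (mollify_measurable n hl).aestronglyMeasurable
  · exact Eventually.of_forall fun n => Eventually.of_forall fun r _ => abs_mollify_le n hΛ r
  · exact intervalIntegrable_const
  · filter_upwards [mollify_ae_tendsto hl] with r hr _ using hr

end ConservationLaw

end

/-! ### Testing between Lipschitz curves -/

noncomputable section

namespace ConservationLaw

/-- The integrand of the weak formulation of `∂ₜE + ∂ₓQ ≤ 0`, tested with `χ(t)` times the plateau
function between two curves `ξ` and `ζ` whose velocities are `g` and `k`. -/
def stripIntegrand (E Q : ℝ × ℝ → ℝ) (χ : ℝ → ℝ) (δ : ℝ) (ξ ζ g k : ℝ → ℝ) (p : ℝ × ℝ) : ℝ :=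
  E p * (deriv χ p.2 * plateau δ (ξ p.2) (ζ p.2) p.1 + χ p.2 *
    (-g p.2 * plateauL δ (ξ p.2) (ζ p.2) p.1 + k p.2 * plateauR δ (ξ p.2) (ζ p.2) p.1)) +
  Q p * (χ p.2 * (plateauL δ (ξ p.2) (ζ p.2) p.1 - plateauR δ (ξ p.2) (ζ p.2) p.1))

lemma stripIntegrand_measurable {E Q : ℝ × ℝ → ℝ} {χ : ℝ → ℝ} {δ : ℝ} {ξ ζ g k : ℝ → ℝ}
    (hE : Measurable E) (hQ : Measurable Q) (hχ : Continuous χ) (hξ : Continuous ξ)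
    (hζ : Continuous ζ) (hg : Measurable g) (hk : Measurable k) :
    Measurable (stripIntegrand E Q χ δ ξ ζ g k) := by
  have h : Continuous fun p : ℝ × ℝ => (ξ p.2, ζ p.2, p.1) := by fun_prop
  have h0 := ((plateau_continuous δ).comp h).measurable
  have h1 := ((plateauL_continuous δ).comp h).measurable
  have h2 := ((plateauR_continuous δ).comp h).measurable
  have h3 := measurable_deriv χ
  have h4 := hχ.measurable
  simp only [Function.comp_def] at h0 h1 h2
  unfold stripIntegrand
  fun_prop

/-- An integrable majorant that is uniform in the curves, as long as their velocities and their values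
on the support of `χ` are bounded. -/
lemma exists_abs_stripIntegrand_le {E Q : ℝ × ℝ → ℝ} {C Λ B : ℝ} {χ : ℝ → ℝ} {δ : ℝ} (hδ : 0 < δ)
    (hEC : ∀ p, |E p| ≤ C) (hQC : ∀ p, |Q p| ≤ C)
    (hχ : ContDiff ℝ (⊤ : ℕ∞) χ) (hχc : HasCompactSupport χ) :
    ∃ F : ℝ × ℝ → ℝ, Integrable F ∧ ∀ ξ ζ g k : ℝ → ℝ, (∀ t, |g t| ≤ Λ) → (∀ t, |k t| ≤ Λ) →
      (∀ t ∈ tsupport χ, |ξ t| ≤ B) → (∀ t ∈ tsupport χ, |ζ t| ≤ B) →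
      ∀ p, |stripIntegrand E Q χ δ ξ ζ g k p| ≤ F p := by
  obtain ⟨M, hM0, hM⟩ := exists_plateau_bound hδ
  obtain ⟨M₀, hM₀⟩ := hχ.continuous.bounded_above_of_compact_support hχc
  obtain ⟨M₁, hM₁⟩ := (hχ.continuous_deriv (by simp)).bounded_above_of_compact_support hχc.deriv
  refine ⟨(Icc (-B) B ×ˢ tsupport χ).indicator
    fun _ => C * (M₁ * 1 + M₀ * (Λ * M + Λ * M)) + C * (M₀ * (M + M)), ?_, ?_⟩
  · refine (integrable_indicator_iff ?_).2 (integrableOn_const ?_)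
    · exact measurableSet_Icc.prod (isClosed_tsupport χ).measurableSet
    · exact (isCompact_Icc.prod hχc.isCompact).measure_lt_top.ne
  · intro ξ ζ g k hg hk hξ hζ p
    by_cases hp : p ∈ Icc (-B) B ×ˢ tsupport χ
    · rw [indicator_of_mem hp, stripIntegrand]
      have b1 := hM (ξ p.2) (ζ p.2) p.1
      have b2 := plateauL_nonneg hδ (ξ p.2) (ζ p.2) p.1
      have b3 := plateauR_nonneg hδ (ξ p.2) (ζ p.2) p.1
      have hC0 : 0 ≤ C := (abs_nonneg _).trans (hEC p)
      have hΛ0 : 0 ≤ Λ := (abs_nonneg _).trans (hg 0)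
      have hM00 : 0 ≤ M₀ := (norm_nonneg _).trans (hM₀ 0)
      have hM10 : 0 ≤ M₁ := (norm_nonneg _).trans (hM₁ 0)
      refine (abs_add_le _ _).trans (add_le_add ?_ ?_)
      · rw [abs_mul]
        refine mul_le_mul (hEC p) ((abs_add_le _ _).trans (add_le_add ?_ ?_)) (abs_nonneg _) hC0
        · rw [abs_mul, abs_of_nonneg (plateau_nonneg _ _ _ _)]
          exact mul_le_mul (hM₁ _) (plateau_le_one _ _ _ _) (plateau_nonneg _ _ _ _) hM10
        · rw [abs_mul]
          refine mul_le_mul (hM₀ _) ((abs_add_le _ _).trans (add_le_add ?_ ?_)) (abs_nonneg _) hM00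
          · rw [abs_mul, abs_neg, abs_of_nonneg b2]
            exact mul_le_mul (hg _) b1.1 b2 hΛ0
          · rw [abs_mul, abs_of_nonneg b3]
            exact mul_le_mul (hk _) b1.2 b3 hΛ0
      · rw [abs_mul, abs_mul]
        refine mul_le_mul (hQC p) (mul_le_mul (hM₀ _) ?_ (abs_nonneg _) hM00) (by positivity) hC0
        rw [abs_le]; constructor <;> linarith [b1.1, b1.2]
    · rw [indicator_of_notMem hp, stripIntegrand]
      apply le_of_eq
      by_cases ht : p.2 ∈ tsupport χ
      · have hx : p.1 ∉ Ioo (ξ p.2) (ζ p.2) := by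
          intro hx
          refine hp ⟨⟨?_, ?_⟩, ht⟩
          · linarith [hx.1, (abs_le.1 (hξ _ ht)).1]
          · linarith [hx.2, (abs_le.1 (hζ _ ht)).2]
        rw [plateau_eq_zero hδ hx, plateauL_eq_zero hδ hx, plateauR_eq_zero hδ hx]
        simp
      · rw [image_eq_zero_of_notMem_tsupport ht, image_eq_zero_of_notMem_tsupport
          (fun h => ht (tsupport_deriv_subset h))]
        simp

/-- Subsolutions may be tested with plateau functions between Lipschitz curves. -/
lemma IsPlaneSubsolution.integral_stripIntegrand_nonneg {E Q : ℝ × ℝ → ℝ}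
    (h : IsPlaneSubsolution E Q) (hE : Measurable E) (hQ : Measurable Q) {C Λ : ℝ}
    (hEC : ∀ p, |E p| ≤ C) (hQC : ∀ p, |Q p| ≤ C) {g k : ℝ → ℝ} (hg : Measurable g)
    (hk : Measurable k) (hgΛ : ∀ t, |g t| ≤ Λ) (hkΛ : ∀ t, |k t| ≤ Λ) (x₀ y₀ s : ℝ) {δ : ℝ}
    (hδ : 0 < δ) {χ : ℝ → ℝ} (hχ : ContDiff ℝ (⊤ : ℕ∞) χ) (hχc : HasCompactSupport χ)
    (hχ0 : ∀ t, 0 ≤ χ t) :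
    Integrable (stripIntegrand E Q χ δ (curve x₀ s g) (curve y₀ s k) g k) ∧
    0 ≤ ∫ p, stripIntegrand E Q χ δ (curve x₀ s g) (curve y₀ s k) g k p := by
  have hgl := locallyIntegrable_of_bdd hg hgΛ
  have hkl := locallyIntegrable_of_bdd hk hkΛ
  have hΛ0 : 0 ≤ Λ := (abs_nonneg _).trans (hgΛ 0)
  obtain ⟨R, hR⟩ := hχc.isCompact.isBounded.subset_closedBall s
  have hRt : ∀ t ∈ tsupport χ, |t - s| ≤ R := fun t ht => by
    simpa [Real.dist_eq] using hR ht
  obtain ⟨F, hF, hb⟩ := exists_abs_stripIntegrand_le (Λ := Λ) (B := |x₀| + |y₀| + Λ * R) hδ hEC hQC hχ hχc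
  have hB : ∀ z : ℝ, ∀ j : ℝ → ℝ, Measurable j → (∀ t, |j t| ≤ Λ) →
      ∀ t ∈ tsupport χ, |curve z s j t| ≤ |z| + Λ * R := fun z j hj hjΛ t ht =>
    (abs_curve_le hj hjΛ z s t).trans
      (add_le_add le_rfl (mul_le_mul_of_nonneg_left (hRt t ht) hΛ0))
  have hBx : ∀ j : ℝ → ℝ, Measurable j → (∀ t, |j t| ≤ Λ) → ∀ t ∈ tsupport χ,
      |curve x₀ s j t| ≤ |x₀| + |y₀| + Λ * R := fun j hj hjΛ t ht => by
    linarith [hB x₀ j hj hjΛ t ht, abs_nonneg y₀]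
  have hBy : ∀ j : ℝ → ℝ, Measurable j → (∀ t, |j t| ≤ Λ) → ∀ t ∈ tsupport χ,
      |curve y₀ s j t| ≤ |x₀| + |y₀| + Λ * R := fun j hj hjΛ t ht => by
    linarith [hB y₀ j hj hjΛ t ht, abs_nonneg x₀]
  have hgn : ∀ n t, |mollify n g t| ≤ Λ := fun n t => abs_mollify_le n hgΛ t
  have hkn : ∀ n t, |mollify n k t| ≤ Λ := fun n t => abs_mollify_le n hkΛ t
  have hgm := fun n => mollify_measurable n hgl
  have hkm := fun n => mollify_measurable n hkl
  have hbn := fun n => hb _ _ _ _ (hgn n) (hkn n) (hBx _ (hgm n) (hgn n)) (hBy _ (hkm n) (hkn n))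
  have hm : Measurable (stripIntegrand E Q χ δ (curve x₀ s g) (curve y₀ s k) g k) :=
    stripIntegrand_measurable hE hQ hχ.continuous (curve_continuous hg hgΛ _ _)
      (curve_continuous hk hkΛ _ _) hg hk
  refine ⟨hF.mono' hm.aestronglyMeasurable (Eventually.of_forall
    (hb _ _ _ _ hgΛ hkΛ (hBx g hg hgΛ) (hBy k hk hkΛ))), ?_⟩
  -- mollified velocities make the curves smooth, so that the cut-off is a test function
  have hlim := tendsto_integral_of_dominated_convergence (μ := (volume : Measure (ℝ × ℝ))) F
    (F := fun n => stripIntegrand E Q χ δ (curve x₀ s (mollify n g)) (curve y₀ s (mollify n k))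
      (mollify n g) (mollify n k))
    (f := stripIntegrand E Q χ δ (curve x₀ s g) (curve y₀ s k) g k)
    (fun n => (stripIntegrand_measurable hE hQ hχ.continuous
      (curve_continuous (hgm n) (hgn n) _ _) (curve_continuous (hkm n) (hkn n) _ _)
      (hgm n) (hkm n)).aestronglyMeasurable) hF (fun n => Eventually.of_forall (hbn n)) ?_
  · refine ge_of_tendsto' hlim fun n => ?_
    set ξ := curve x₀ s (mollify n g)
    set ζ := curve y₀ s (mollify n k)
    have hχd : ∀ t, HasDerivAt χ (deriv χ t) t := fun t =>
      (hχ.differentiable (by simp) t).hasDerivAt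
    have hξd : ∀ t, HasDerivAt ξ (mollify n g t) t := curve_mollify_hasDerivAt x₀ s n hgl
    have hζd : ∀ t, HasDerivAt ζ (mollify n k t) t := curve_mollify_hasDerivAt y₀ s n hkl
    have hS : ContDiff ℝ (⊤ : ℕ∞) Real.smoothTransition := Real.smoothTransition.contDiff
    have hξs : ContDiff ℝ (⊤ : ℕ∞) ξ := curve_mollify_contDiff x₀ s n hgl
    have hζs : ContDiff ℝ (⊤ : ℕ∞) ζ := curve_mollify_contDiff y₀ s n hkl
    have hφ : IsTestFunction fun p => χ p.2 * plateau δ (ξ p.2) (ζ p.2) p.1 := by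
      refine ⟨(hχ.comp contDiff_snd).mul (ContDiff.mul
        (hS.comp ((contDiff_fst.sub (hξs.comp contDiff_snd)).div_const δ))
        (hS.comp (((hζs.comp contDiff_snd).sub contDiff_fst).div_const δ))), ?_⟩
      refine HasCompactSupport.intro (isCompact_Icc (a := -(|x₀| + |y₀| + Λ * R))
        (b := |x₀| + |y₀| + Λ * R) |>.prod hχc.isCompact) fun p hp => ?_
      by_cases ht : p.2 ∈ tsupport χ
      · rw [plateau_eq_zero hδ, mul_zero]
        intro hx
        refine hp ⟨⟨?_, ?_⟩, ht⟩
        · linarith [hx.1, (abs_le.1 (hBx _ (hgm n) (hgn n) _ ht)).1]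
        · linarith [hx.2, (abs_le.1 (hBy _ (hkm n) (hkn n) _ ht)).2]
      · rw [image_eq_zero_of_notMem_tsupport ht, zero_mul]
    refine (h _ hφ fun p => mul_nonneg (hχ0 _) (plateau_nonneg _ _ _ _)).trans_eq
      (integral_congr_ae (Eventually.of_forall ?_))
    rintro ⟨x, t⟩
    have e1 := dt_eq (hφ.differentiable (x, t)) ((hχd t).mul (hasDerivAt_plateau_t (hξd t) (hζd t)))
    have e2 := dx_eq (hφ.differentiable (x, t))
      ((hasDerivAt_plateau_x δ (ξ t) (ζ t) x).const_mul (χ t))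
    simp only [stripIntegrand]
    rw [e1, e2]
  · have a1 := Measure.quasiMeasurePreserving_snd (μ := (volume : Measure ℝ))
      (ν := (volume : Measure ℝ)) |>.ae (mollify_ae_tendsto hgl)
    have a2 := Measure.quasiMeasurePreserving_snd (μ := (volume : Measure ℝ))
      (ν := (volume : Measure ℝ)) |>.ae (mollify_ae_tendsto hkl)
    rw [← Measure.volume_eq_prod] at a1 a2
    filter_upwards [a1, a2] with p h1 h2
    have c1 := curve_mollify_tendsto x₀ s hg hgΛ p.2
    have c2 := curve_mollify_tendsto y₀ s hk hkΛ p.2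
    have c3 := c1.prodMk_nhds (c2.prodMk_nhds (tendsto_const_nhds (x := p.1)))
    have d0 := (((plateau_continuous δ).tendsto _).comp c3).const_mul (deriv χ p.2)
    have d1 := ((plateauL_continuous δ).tendsto _).comp c3
    have d2 := ((plateauR_continuous δ).tendsto _).comp c3
    exact ((d0.add (((h1.neg.mul d1).add (h2.mul d2)).const_mul (χ p.2))).const_mul (E p)).add
      (((d1.sub d2).const_mul (χ p.2)).const_mul (Q p))

end ConservationLaw

end

/-! ### The limit of sharp strips -/

noncomputable section

namespace ConservationLaw

lemma plateauL_le_ker {δ : ℝ} (hδ : 0 < δ) (α β x : ℝ) : plateauL δ α β x ≤ ker δ α x :=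
  mul_le_of_le_one_right (ker_nonneg hδ α x) (Real.smoothTransition.le_one _)

lemma plateauR_eq (δ α β x : ℝ) : plateauR δ α β x = plateauL δ (-β) (-α) (-x) := by
  simp only [plateauR, plateauL]
  rw [show -x - -β = β - x by ring, show -α - -x = x - α by ring]

lemma plateauL_integrable {δ : ℝ} (hδ : 0 < δ) (α β : ℝ) : Integrable (plateauL δ α β) := by
  refine (ker_integrable hδ α).mono' ?_ (Eventually.of_forall fun x => ?_)
  · exact ((plateauL_continuous δ).comp (by fun_prop : Continuous fun x : ℝ => (α, β, x))).aestronglyMeasurable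
  · rw [Real.norm_of_nonneg (plateauL_nonneg hδ _ _ _)]
    exact plateauL_le_ker hδ _ _ _

lemma plateauR_integrable {δ : ℝ} (hδ : 0 < δ) (α β : ℝ) : Integrable (plateauR δ α β) := by
  simp only [funext (plateauR_eq δ α β)]
  exact (plateauL_integrable hδ (-β) (-α)).comp_neg

lemma plateau_integrable {δ : ℝ} (hδ : 0 < δ) (α β : ℝ) : Integrable (plateau δ α β) := by
  refine Continuous.integrable_of_hasCompactSupport
    ((plateau_continuous δ).comp (by fun_prop : Continuous fun x : ℝ => (α, β, x)))
    (hasCompactSupport_of_Icc (A := α) (B := β) fun x hx => ?_)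
  exact plateau_eq_zero hδ fun h => hx (Ioo_subset_Icc_self h)

lemma abs_integral_plateauL_le {δ : ℝ} (hδ : 0 < δ) (α β : ℝ) {G : ℝ → ℝ} {C : ℝ}
    (hC : ∀ x, |G x| ≤ C) : |∫ x, plateauL δ α β x * G x| ≤ C := by
  calc |∫ x, plateauL δ α β x * G x| ≤ ∫ x, ker δ α x * C := by
        rw [← Real.norm_eq_abs]
        refine norm_integral_le_of_norm_le ((ker_integrable hδ α).mul_const C)
          (Eventually.of_forall fun x => ?_)
        rw [norm_mul, Real.norm_of_nonneg (plateauL_nonneg hδ _ _ x), Real.norm_eq_abs]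
        exact mul_le_mul (plateauL_le_ker hδ _ _ _) (hC x) (abs_nonneg _) (ker_nonneg hδ _ _)
    _ = C := by rw [integral_mul_const, ker_integral hδ, one_mul]

lemma integral_plateauR (δ α β : ℝ) (G : ℝ → ℝ) :
    ∫ x, plateauR δ α β x * G x = ∫ x, plateauL δ (-β) (-α) x * G (-x) := by
  rw [← integral_neg_eq_self]
  simp only [plateauR_eq, neg_neg]

lemma abs_integral_plateauR_le {δ : ℝ} (hδ : 0 < δ) (α β : ℝ) {G : ℝ → ℝ} {C : ℝ}
    (hC : ∀ x, |G x| ≤ C) : |∫ x, plateauR δ α β x * G x| ≤ C := by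
  rw [integral_plateauR]
  exact abs_integral_plateauL_le hδ _ _ fun x => hC _

lemma abs_integral_plateauL_sub_le {δ α β : ℝ} (hδ : 0 < δ) (hαβ : α + 2 * δ ≤ β) {G : ℝ → ℝ}
    {C l ε : ℝ} (hG : Measurable G) (hC : ∀ x, |G x| ≤ C)
    (h : ∀ᵐ x, x ∈ Ioo α (α + δ) → |G x - l| ≤ ε) :
    |(∫ x, plateauL δ α β x * G x) - l| ≤ ε := by
  have e : ∀ x, plateauL δ α β x = ker δ α x := by
    intro x
    by_cases hx : x ∈ Ioo α (α + δ)
    · rw [plateauL, Real.smoothTransition.one_of_one_le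
        ((one_le_div hδ).2 (by linarith [hx.2])), mul_one, ker]
    · rw [ker_eq_zero hδ hx]
      exact le_antisymm ((plateauL_le_ker hδ _ _ _).trans (ker_eq_zero hδ hx).le)
        (plateauL_nonneg hδ _ _ _)
  simp only [e]
  exact abs_integral_ker_sub_le hδ α hG hC h

lemma ae_neg {p : ℝ → Prop} (h : ∀ᵐ x, p x) : ∀ᵐ x, p (-x) :=
  (Measure.measurePreserving_neg (volume : Measure ℝ)).quasiMeasurePreserving.ae h

lemma abs_integral_plateauR_sub_le {δ α β : ℝ} (hδ : 0 < δ) (hαβ : α + 2 * δ ≤ β) {G : ℝ → ℝ}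
    {C l ε : ℝ} (hG : Measurable G) (hC : ∀ x, |G x| ≤ C)
    (h : ∀ᵐ x, x ∈ Ioo (β - δ) β → |G x - l| ≤ ε) :
    |(∫ x, plateauR δ α β x * G x) - l| ≤ ε := by
  rw [integral_plateauR]
  refine abs_integral_plateauL_sub_le hδ (by linarith) (hG.comp measurable_neg) (fun x => hC _) ?_
  filter_upwards [ae_neg h] with x hx hxI
  exact hx ⟨by linarith [hxI.2], by linarith [hxI.1]⟩

/-- The mass of `E(·, t)` between `ξ(t)` and `ζ(t)`, with a smooth cut-off. -/
def stripMass (E : ℝ × ℝ → ℝ) (δ : ℝ) (ξ ζ : ℝ → ℝ) (t : ℝ) : ℝ :=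
  ∫ x, plateau δ (ξ t) (ζ t) x * E (x, t)

/-- The flux into the strip between `ξ` and `ζ`, relative to the motion of the two curves. -/
def stripFlux (E Q : ℝ × ℝ → ℝ) (δ : ℝ) (ξ ζ g k : ℝ → ℝ) (t : ℝ) : ℝ :=
  (∫ x, plateauL δ (ξ t) (ζ t) x * (Q (x, t) - g t * E (x, t))) -
    ∫ x, plateauR δ (ξ t) (ζ t) x * (Q (x, t) - k t * E (x, t))

lemma stripMass_measurable {E : ℝ × ℝ → ℝ} {δ : ℝ} {ξ ζ : ℝ → ℝ} (hE : Measurable E)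
    (hξ : Continuous ξ) (hζ : Continuous ζ) : Measurable (stripMass E δ ξ ζ) := by
  have h : Continuous fun p : ℝ × ℝ => (ξ p.1, ζ p.1, p.2) := by fun_prop
  have h0 := ((plateau_continuous δ).comp h).measurable
  have h1 : StronglyMeasurable (Function.uncurry fun t x => plateau δ (ξ t) (ζ t) x * E (x, t)) :=
    (h0.mul (hE.comp measurable_swap)).stronglyMeasurable
  exact h1.integral_prod_right.measurable

lemma stripFlux_measurable {E Q : ℝ × ℝ → ℝ} {δ : ℝ} {ξ ζ g k : ℝ → ℝ} (hE : Measurable E)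
    (hQ : Measurable Q) (hξ : Continuous ξ) (hζ : Continuous ζ) (hg : Measurable g)
    (hk : Measurable k) : Measurable (stripFlux E Q δ ξ ζ g k) := by
  have h : Continuous fun p : ℝ × ℝ => (ξ p.1, ζ p.1, p.2) := by fun_prop
  have h1 := ((plateauL_continuous δ).comp h).measurable
  have h2 := ((plateauR_continuous δ).comp h).measurable
  have hE' := hE.comp measurable_swap
  have hQ' := hQ.comp measurable_swap
  have g1 : StronglyMeasurable (Function.uncurry fun t x =>
      plateauL δ (ξ t) (ζ t) x * (Q (x, t) - g t * E (x, t))) :=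
    (h1.mul (hQ'.sub ((hg.comp measurable_fst).mul hE'))).stronglyMeasurable
  have g2 : StronglyMeasurable (Function.uncurry fun t x =>
      plateauR δ (ξ t) (ζ t) x * (Q (x, t) - k t * E (x, t))) :=
    (h2.mul (hQ'.sub ((hk.comp measurable_fst).mul hE'))).stronglyMeasurable
  exact g1.integral_prod_right.measurable.sub g2.integral_prod_right.measurable

lemma abs_stripMass_le {E : ℝ × ℝ → ℝ} {δ C : ℝ} (hδ : 0 < δ) (hC : ∀ p, |E p| ≤ C)
    (ξ ζ : ℝ → ℝ) (t : ℝ) : |stripMass E δ ξ ζ t| ≤ C * |ζ t - ξ t| := by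
  have hC0 : 0 ≤ C := (abs_nonneg _).trans (hC 0)
  have hs : ∀ x, x ∉ Ioo (ξ t) (ζ t) → plateau δ (ξ t) (ζ t) x * E (x, t) = 0 := fun x hx => by
    rw [plateau_eq_zero hδ hx, zero_mul]
  rw [stripMass, ← setIntegral_eq_integral_of_forall_compl_eq_zero hs, ← Real.norm_eq_abs]
  refine (norm_setIntegral_le_of_norm_le_const (C := C) (by simp) fun x _ => ?_).trans ?_
  · rw [norm_mul, Real.norm_eq_abs, Real.norm_eq_abs, abs_of_nonneg (plateau_nonneg _ _ _ _)]
    exact (mul_le_of_le_one_left (abs_nonneg _) (plateau_le_one _ _ _ _)).trans (hC _)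
  · refine mul_le_mul_of_nonneg_left ?_ hC0
    rcases le_total (ξ t) (ζ t) with h | h
    · rw [Real.volume_real_Ioo_of_le h]; exact le_abs_self _
    · rw [Ioo_eq_empty (not_lt.2 h)]; simp

lemma abs_flux_sub_mul_le {E Q : ℝ × ℝ → ℝ} {C Λ : ℝ} (hEC : ∀ p, |E p| ≤ C)
    (hQC : ∀ p, |Q p| ≤ C) {g : ℝ → ℝ} (hgΛ : ∀ t, |g t| ≤ Λ) (p : ℝ × ℝ) (t : ℝ) :
    |Q p - g t * E p| ≤ C + Λ * C := by
  have h := abs_sub (Q p) (g t * E p)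
  have hΛ0 : 0 ≤ Λ := (abs_nonneg _).trans (hgΛ 0)
  rw [abs_mul] at h
  exact h.trans (add_le_add (hQC p) (mul_le_mul (hgΛ t) (hEC p) (abs_nonneg _) hΛ0))

lemma abs_stripFlux_le {E Q : ℝ × ℝ → ℝ} {δ C Λ : ℝ} (hδ : 0 < δ) (hEC : ∀ p, |E p| ≤ C)
    (hQC : ∀ p, |Q p| ≤ C) {g k : ℝ → ℝ} (hgΛ : ∀ t, |g t| ≤ Λ) (hkΛ : ∀ t, |k t| ≤ Λ)
    (ξ ζ : ℝ → ℝ) (t : ℝ) : |stripFlux E Q δ ξ ζ g k t| ≤ 2 * (C + Λ * C) := by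
  have h1 := abs_integral_plateauL_le hδ (ξ t) (ζ t) (fun x => abs_flux_sub_mul_le hEC hQC hgΛ (x, t) t)
  have h2 := abs_integral_plateauR_le hδ (ξ t) (ζ t) (fun x => abs_flux_sub_mul_le hEC hQC hkΛ (x, t) t)
  exact (abs_sub _ _).trans (by linarith)

/-- The weak formulation for a strip as a statement in time: the mass has derivative at most the
flux, in the sense of distributions. -/
lemma integral_stripIntegrand {E Q : ℝ × ℝ → ℝ} (hE : Measurable E) (hQ : Measurable Q) {C : ℝ}
    (hEC : ∀ p, |E p| ≤ C) (hQC : ∀ p, |Q p| ≤ C) {δ : ℝ} (hδ : 0 < δ) (χ ξ ζ g k : ℝ → ℝ)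
    (h : Integrable (stripIntegrand E Q χ δ ξ ζ g k)) :
    ∫ p, stripIntegrand E Q χ δ ξ ζ g k p =
      ∫ t, (deriv χ t * stripMass E δ ξ ζ t + χ t * stripFlux E Q δ ξ ζ g k t) := by
  rw [Measure.volume_eq_prod] at h ⊢
  rw [integral_prod_symm _ h]
  refine integral_congr_ae (Eventually.of_forall fun t => ?_)
  have hEt : Measurable fun x => E (x, t) := hE.comp measurable_prodMk_right
  have hQt : Measurable fun x => Q (x, t) := hQ.comp measurable_prodMk_right
  have i0 : Integrable fun x => plateau δ (ξ t) (ζ t) x * E (x, t) :=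
    (plateau_integrable hδ _ _).mul_bdd hEt.aestronglyMeasurable (Eventually.of_forall fun x => hEC _)
  have iL : ∀ v : ℝ, Integrable fun x => plateauL δ (ξ t) (ζ t) x * (Q (x, t) - v * E (x, t)) :=
    fun v => (plateauL_integrable hδ _ _).mul_bdd (hQt.sub (hEt.const_mul v)).aestronglyMeasurable
      (Eventually.of_forall fun x => abs_flux_sub_mul_le (g := fun _ => v) hEC hQC (fun _ => le_rfl) _ 0)
  have iR : ∀ v : ℝ, Integrable fun x => plateauR δ (ξ t) (ζ t) x * (Q (x, t) - v * E (x, t)) :=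
    fun v => (plateauR_integrable hδ _ _).mul_bdd (hQt.sub (hEt.const_mul v)).aestronglyMeasurable
      (Eventually.of_forall fun x => abs_flux_sub_mul_le (g := fun _ => v) hEC hQC (fun _ => le_rfl) _ 0)
  have iLR : Integrable fun x => plateauL δ (ξ t) (ζ t) x * (Q (x, t) - g t * E (x, t)) -
      plateauR δ (ξ t) (ζ t) x * (Q (x, t) - k t * E (x, t)) := (iL (g t)).sub (iR (k t))
  simp only [stripMass, stripFlux]
  rw [← integral_sub (iL (g t)) (iR (k t)), ← integral_const_mul, ← integral_const_mul,
    ← integral_add (i0.const_mul _) (iLR.const_mul _)]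
  refine integral_congr_ae (Eventually.of_forall fun x => ?_)
  simp only [stripIntegrand]
  ring

/-- Passing to the limit of sharp strips in the weak formulation. -/
lemma IsPlaneSubsolution.strip_limit {E Q : ℝ × ℝ → ℝ}
    (h : IsPlaneSubsolution E Q) (hE : Measurable E) (hQ : Measurable Q) {C Λ D : ℝ}
    (hEC : ∀ p, |E p| ≤ C) (hQC : ∀ p, |Q p| ≤ C) {g k : ℝ → ℝ} (hg : Measurable g)
    (hk : Measurable k) (hgΛ : ∀ t, |g t| ≤ Λ) (hkΛ : ∀ t, |k t| ≤ Λ) {x₀ y₀ δ : ℕ → ℝ} {s : ℝ}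
    (hxy : ∀ n, |y₀ n - x₀ n| ≤ D) (hδ : ∀ n, 0 < δ n) {m J : ℝ → ℝ}
    (hm : ∀ᵐ t, s < t → Tendsto
      (fun n => stripMass E (δ n) (curve (x₀ n) s g) (curve (y₀ n) s k) t) atTop (𝓝 (m t)))
    (hJ : ∀ᵐ t, s < t → Tendsto
      (fun n => stripFlux E Q (δ n) (curve (x₀ n) s g) (curve (y₀ n) s k) g k t) atTop (𝓝 (J t)))
    {χ : ℝ → ℝ} (hχ : ContDiff ℝ (⊤ : ℕ∞) χ) (hχc : HasCompactSupport χ)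
    (hχs : tsupport χ ⊆ Ioi s) (hχ0 : ∀ t, 0 ≤ χ t) :
    Integrable (fun t => deriv χ t * m t + χ t * J t) ∧
      0 ≤ ∫ t, (deriv χ t * m t + χ t * J t) := by
  have hC0 : 0 ≤ C := (abs_nonneg _).trans (hEC 0)
  have hD0 : 0 ≤ D := (abs_nonneg _).trans (hxy 0)
  have hΛ0 : 0 ≤ Λ := (abs_nonneg _).trans (hgΛ 0)
  obtain ⟨R, hR⟩ := hχc.isCompact.isBounded.subset_closedBall s
  have hRt : ∀ t ∈ tsupport χ, |t - s| ≤ R := fun t ht => by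
    simpa [Real.dist_eq] using hR ht
  set F : ℕ → ℝ → ℝ := fun n t =>
    deriv χ t * stripMass E (δ n) (curve (x₀ n) s g) (curve (y₀ n) s k) t +
      χ t * stripFlux E Q (δ n) (curve (x₀ n) s g) (curve (y₀ n) s k) g k t with hF
  have hFm : ∀ n, Measurable (F n) := fun n =>
    ((measurable_deriv χ).mul (stripMass_measurable hE (curve_continuous hg hgΛ _ _)
      (curve_continuous hk hkΛ _ _))).add (hχ.continuous.measurable.mul
      (stripFlux_measurable hE hQ (curve_continuous hg hgΛ _ _) (curve_continuous hk hkΛ _ _) hg hk))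
  set b : ℝ → ℝ := fun t => |deriv χ t| * (C * (D + 2 * (Λ * R))) + |χ t| * (2 * (C + Λ * C)) with hb
  have hbi : Integrable b := by
    refine Integrable.add (Integrable.mul_const ?_ _) (Integrable.mul_const ?_ _)
    · exact ((hχ.continuous_deriv (by simp)).integrable_of_hasCompactSupport hχc.deriv).abs
    · exact (hχ.continuous.integrable_of_hasCompactSupport hχc).abs
  have hFb : ∀ n t, |F n t| ≤ b t := by
    intro n t
    refine (abs_add_le _ _).trans (add_le_add ?_ ?_)
    · rw [abs_mul]
      by_cases ht : t ∈ tsupport χ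
      · refine mul_le_mul_of_nonneg_left ((abs_stripMass_le (hδ n) hEC _ _ t).trans
          (mul_le_mul_of_nonneg_left ?_ hC0)) (abs_nonneg _)
        have h1 := abs_curve_sub_le hg hgΛ (x₀ n) s t s
        have h2 := abs_curve_sub_le hk hkΛ (y₀ n) s t s
        rw [curve_self] at h1 h2
        have h3 := mul_le_mul_of_nonneg_left (hRt t ht) hΛ0
        have h4 := hxy n
        rw [abs_le] at *
        constructor <;> linarith [h1.1, h1.2, h2.1, h2.2, h4.1, h4.2]
      · rw [image_eq_zero_of_notMem_tsupport (fun h => ht (tsupport_deriv_subset h))]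
        simp
    · rw [abs_mul]
      exact mul_le_mul_of_nonneg_left (abs_stripFlux_le (hδ n) hEC hQC hgΛ hkΛ _ _ t) (abs_nonneg _)
  have hlim : ∀ᵐ t, Tendsto (fun n => F n t) atTop (𝓝 (deriv χ t * m t + χ t * J t)) := by
    filter_upwards [hm, hJ] with t h1 h2
    by_cases ht : t ∈ tsupport χ
    · exact ((h1 (hχs ht)).const_mul _).add ((h2 (hχs ht)).const_mul _)
    · simp [hF, image_eq_zero_of_notMem_tsupport ht,
        image_eq_zero_of_notMem_tsupport (fun h => ht (tsupport_deriv_subset h))]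
  refine ⟨hbi.mono' (aestronglyMeasurable_of_tendsto_ae _ (fun n => (hFm n).aestronglyMeasurable) hlim)
    ?_, ?_⟩
  · filter_upwards [hlim] with t ht
    exact le_of_tendsto' ht.abs fun n => hFb n t
  · refine ge_of_tendsto' (tendsto_integral_of_dominated_convergence b
      (fun n => (hFm n).aestronglyMeasurable) hbi (fun n => Eventually.of_forall (hFb n)) hlim)
      fun n => ?_
    have := h.integral_stripIntegrand_nonneg hE hQ hEC hQC hg hk hgΛ hkΛ (x₀ n) (y₀ n) s (hδ n)
      hχ hχc hχ0
    rw [integral_stripIntegrand hE hQ hEC hQC (hδ n) _ _ _ _ _ this.1] at this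
    exact this.2

end ConservationLaw

end

/-! ### Jump and mass inequalities along curves -/

noncomputable section

namespace ConservationLaw

instance aeRight_neBot (x : ℝ) : (aeRight x).NeBot := by
  refine inf_neBot_iff.2 fun A hA B hB => ?_
  obtain ⟨z, hz, hzB⟩ := mem_nhdsGT_iff_exists_Ioo_subset.1 hB
  obtain ⟨y, hy, hyA⟩ := exists_mem_Ioo_of_ae (P := (· ∈ A)) hA hz
  exact ⟨y, hyA, hzB hy⟩

instance aeLeft_neBot (x : ℝ) : (aeLeft x).NeBot := by
  refine inf_neBot_iff.2 fun A hA B hB => ?_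
  obtain ⟨z, hz, hzB⟩ := mem_nhdsLT_iff_exists_Ioo_subset.1 hB
  obtain ⟨y, hy, hyA⟩ := exists_mem_Ioo_of_ae (P := (· ∈ A)) hA hz
  exact ⟨y, hyA, hzB hy⟩

/-- The essential limit of `g` at `x` from the left. -/
def leftTrace (g : ℝ → ℝ) (x : ℝ) : ℝ := limUnder (aeLeft x) g

/-- The essential limit of `g` at `x` from the right. -/
def rightTrace (g : ℝ → ℝ) (x : ℝ) : ℝ := limUnder (aeRight x) g

lemma HasTraces.tendsto_left {g : ℝ → ℝ} (h : HasTraces g) (x : ℝ) :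
    Tendsto g (aeLeft x) (𝓝 (leftTrace g x)) := tendsto_nhds_limUnder (h x).1

lemma HasTraces.tendsto_right {g : ℝ → ℝ} (h : HasTraces g) (x : ℝ) :
    Tendsto g (aeRight x) (𝓝 (rightTrace g x)) := tendsto_nhds_limUnder (h x).2

lemma HasTraces.leftTrace_mem {g : ℝ → ℝ} (h : HasTraces g) {a b : ℝ} (hg : ∀ x, g x ∈ Icc a b)
    (x : ℝ) : leftTrace g x ∈ Icc a b :=
  isClosed_Icc.mem_of_tendsto (h.tendsto_left x) (Eventually.of_forall hg)

lemma HasTraces.rightTrace_mem {g : ℝ → ℝ} (h : HasTraces g) {a b : ℝ} (hg : ∀ x, g x ∈ Icc a b)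
    (x : ℝ) : rightTrace g x ∈ Icc a b :=
  isClosed_Icc.mem_of_tendsto (h.tendsto_right x) (Eventually.of_forall hg)

/-- Averages over small intervals with left end `x` tend to the right trace at `x`. -/
lemma tendsto_plateauL_right {G : ℝ → ℝ} {C l x y : ℝ} (hG : Measurable G) (hC : ∀ z, |G z| ≤ C)
    (h : Tendsto G (aeRight x) (𝓝 l)) (hxy : x < y) {δ : ℕ → ℝ} (hδ : ∀ n, 0 < δ n)
    (hδ0 : Tendsto δ atTop (𝓝 0)) :
    Tendsto (fun n => ∫ z, plateauL (δ n) x y z * G z) atTop (𝓝 l) := by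
  refine Metric.tendsto_nhds.2 fun ε hε => ?_
  obtain ⟨r, hr, hrG⟩ := exists_of_tendsto_aeRight h (half_pos hε)
  filter_upwards [hδ0.eventually_lt_const hr,
    hδ0.eventually_lt_const (show 0 < (y - x) / 2 by linarith)] with n h1 h2
  rw [Real.dist_eq]
  refine (abs_integral_plateauL_sub_le (hδ n) (by linarith) hG hC ?_).trans_lt (half_lt_self hε)
  filter_upwards [hrG] with z hz hzI
  exact hz ⟨hzI.1, by linarith [hzI.2]⟩

lemma tendsto_plateauR_left {G : ℝ → ℝ} {C l x y : ℝ} (hG : Measurable G) (hC : ∀ z, |G z| ≤ C)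
    (h : Tendsto G (aeLeft y) (𝓝 l)) (hxy : x < y) {δ : ℕ → ℝ} (hδ : ∀ n, 0 < δ n)
    (hδ0 : Tendsto δ atTop (𝓝 0)) :
    Tendsto (fun n => ∫ z, plateauR (δ n) x y z * G z) atTop (𝓝 l) := by
  refine Metric.tendsto_nhds.2 fun ε hε => ?_
  obtain ⟨r, hr, hrG⟩ := exists_of_tendsto_aeLeft h (half_pos hε)
  filter_upwards [hδ0.eventually_lt_const hr,
    hδ0.eventually_lt_const (show 0 < (y - x) / 2 by linarith)] with n h1 h2
  rw [Real.dist_eq]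
  refine (abs_integral_plateauR_sub_le (hδ n) (by linarith) hG hC ?_).trans_lt (half_lt_self hε)
  filter_upwards [hrG] with z hz hzI
  exact hz ⟨by linarith [hzI.1], hzI.2⟩

lemma tendsto_plateauL_left {G : ℝ → ℝ} {C l x : ℝ} (hG : Measurable G) (hC : ∀ z, |G z| ≤ C)
    (h : Tendsto G (aeLeft x) (𝓝 l)) {δ : ℕ → ℝ} (hδ : ∀ n, 0 < δ n)
    (hδ0 : Tendsto δ atTop (𝓝 0)) :
    Tendsto (fun n => ∫ z, plateauL (δ n) (x - δ n) (x + δ n) z * G z) atTop (𝓝 l) := by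
  refine Metric.tendsto_nhds.2 fun ε hε => ?_
  obtain ⟨r, hr, hrG⟩ := exists_of_tendsto_aeLeft h (half_pos hε)
  filter_upwards [hδ0.eventually_lt_const hr] with n h1
  rw [Real.dist_eq]
  refine (abs_integral_plateauL_sub_le (hδ n) (by linarith) hG hC ?_).trans_lt (half_lt_self hε)
  filter_upwards [hrG] with z hz hzI
  exact hz ⟨by linarith [hzI.1], by linarith [hzI.2]⟩

lemma tendsto_plateauR_right {G : ℝ → ℝ} {C l x : ℝ} (hG : Measurable G) (hC : ∀ z, |G z| ≤ C)
    (h : Tendsto G (aeRight x) (𝓝 l)) {δ : ℕ → ℝ} (hδ : ∀ n, 0 < δ n)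
    (hδ0 : Tendsto δ atTop (𝓝 0)) :
    Tendsto (fun n => ∫ z, plateauR (δ n) (x - δ n) (x + δ n) z * G z) atTop (𝓝 l) := by
  refine Metric.tendsto_nhds.2 fun ε hε => ?_
  obtain ⟨r, hr, hrG⟩ := exists_of_tendsto_aeRight h (half_pos hε)
  filter_upwards [hδ0.eventually_lt_const hr] with n h1
  rw [Real.dist_eq]
  refine (abs_integral_plateauR_sub_le (hδ n) (by linarith) hG hC ?_).trans_lt (half_lt_self hε)
  filter_upwards [hrG] with z hz hzI
  exact hz ⟨by linarith [hzI.1], by linarith [hzI.2]⟩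

lemma exists_bound_comp {U : ℝ × ℝ → ℝ} {a b : ℝ} (hUab : ∀ p, U p ∈ Icc a b) {η q : ℝ → ℝ}
    (hη : Continuous η) (hq : Continuous q) :
    ∃ C, (∀ p, |η (U p)| ≤ C) ∧ ∀ p, |cutFlux (fun p => q (U p)) p| ≤ C := by
  obtain ⟨C₁, h₁⟩ := isCompact_Icc.exists_bound_of_continuousOn (s := Icc a b) hη.continuousOn
  obtain ⟨C₂, h₂⟩ := isCompact_Icc.exists_bound_of_continuousOn (s := Icc a b) hq.continuousOn
  exact ⟨max C₁ C₂, fun p => (h₁ _ (hUab p)).trans (le_max_left _ _),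
    fun p => (abs_cutFlux_le _ p).trans ((h₂ _ (hUab p)).trans (le_max_right _ _))⟩

/-- The sequence of strip widths used in the limits below. -/
def width (n : ℕ) : ℝ := 1 / ((n : ℝ) + 1)

lemma width_pos (n : ℕ) : 0 < width n := by rw [width]; positivity

lemma width_le_one (n : ℕ) : width n ≤ 1 := by
  rw [width, div_le_one (by positivity)]
  linarith [show (0 : ℝ) ≤ n by positivity]

lemma tendsto_width : Tendsto width atTop (𝓝 0) := tendsto_one_div_add_atTop_nhds_zero_nat

lemma curve_add (x₀ y s : ℝ) (g : ℝ → ℝ) (t : ℝ) : curve (x₀ + y) s g t = curve x₀ s g t + y := by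
  simp only [curve]; ring

lemma curve_sub (x₀ y s : ℝ) (g : ℝ → ℝ) (t : ℝ) : curve (x₀ - y) s g t = curve x₀ s g t - y := by
  simp only [curve]; ring

/-- The entropy inequality along a Lipschitz curve: the flux of the entropy relative to the curve
does not increase from the left to the right trace. It is the limit of the weak formulation in strips
around the curve, whose mass vanishes in the limit. -/
lemma IsPlaneSubsolution.jump {U : ℝ × ℝ → ℝ} (hU : Measurable U) {a b : ℝ}
    (hUab : ∀ p, U p ∈ Icc a b) (hT : ∀ᵐ t : ℝ, 0 < t → HasTraces fun x => U (x, t))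
    {η q : ℝ → ℝ} (hη : Continuous η) (hq : Continuous q)
    (h : IsPlaneSubsolution (fun p => η (U p)) (cutFlux fun p => q (U p)))
    {g : ℝ → ℝ} {Λ : ℝ} (hg : Measurable g) (hgΛ : ∀ t, |g t| ≤ Λ) (x₀ : ℝ) {s : ℝ} (hs : 0 ≤ s) :
    ∀ᵐ t, s < t →
      q (rightTrace (fun x => U (x, t)) (curve x₀ s g t)) -
          g t * η (rightTrace (fun x => U (x, t)) (curve x₀ s g t)) ≤
        q (leftTrace (fun x => U (x, t)) (curve x₀ s g t)) -
          g t * η (leftTrace (fun x => U (x, t)) (curve x₀ s g t)) := by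
  obtain ⟨C, hEC, hQC⟩ := exists_bound_comp hUab hη hq
  have hC0 : 0 ≤ C := (abs_nonneg _).trans (hEC 0)
  have hE : Measurable fun p => η (U p) := hη.measurable.comp hU
  have hQ : Measurable (cutFlux fun p => q (U p)) := cutFlux_measurable (hq.measurable.comp hU)
  set ξ := curve x₀ s g with hξ
  set J : ℝ → ℝ := fun t =>
    (q (leftTrace (fun x => U (x, t)) (ξ t)) - g t * η (leftTrace (fun x => U (x, t)) (ξ t))) -
    (q (rightTrace (fun x => U (x, t)) (ξ t)) - g t * η (rightTrace (fun x => U (x, t)) (ξ t)))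
    with hJ
  suffices hae : ∀ᵐ t, s < t → 0 ≤ (Ioi s).indicator J t by
    filter_upwards [hae] with t ht hst
    have := ht hst
    rw [indicator_of_mem (show t ∈ Ioi s from hst)] at this
    exact sub_nonneg.1 this
  have hlim : ∀ᵐ t, s < t → Tendsto (fun n => stripFlux (fun p => η (U p)) (cutFlux fun p => q (U p))
      (width n) (curve (x₀ - width n) s g) (curve (x₀ + width n) s g) g g t) atTop (𝓝 (J t)) := by
    filter_upwards [hT] with t ht hst
    have ht0 : 0 < t := hs.trans_lt hst
    have hUt : Measurable fun x => U (x, t) := hU.comp measurable_prodMk_right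
    have hGc : Continuous fun v => q v - g t * η v := hq.sub (hη.const_mul (g t))
    have e : ∀ x, cutFlux (fun p => q (U p)) (x, t) - g t * η (U (x, t)) =
        q (U (x, t)) - g t * η (U (x, t)) := fun x => by rw [cutFlux, if_pos ht0]
    have hb : ∀ x, |q (U (x, t)) - g t * η (U (x, t))| ≤ C + Λ * C := fun x => by
      rw [← e]; exact abs_flux_sub_mul_le hEC hQC hgΛ (x, t) t
    simp only [stripFlux, curve_sub, curve_add, e]
    exact (tendsto_plateauL_left (hGc.measurable.comp hUt) hb ((hGc.tendsto _).comp ((ht ht0).tendsto_left _))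
      width_pos tendsto_width).sub (tendsto_plateauR_right (hGc.measurable.comp hUt) hb
      ((hGc.tendsto _).comp ((ht ht0).tendsto_right _)) width_pos tendsto_width)
  have hFb : ∀ n t, |stripFlux (fun p => η (U p)) (cutFlux fun p => q (U p))
      (width n) (curve (x₀ - width n) s g) (curve (x₀ + width n) s g) g g t| ≤ 2 * (C + Λ * C) :=
    fun n t => abs_stripFlux_le (width_pos n) hEC hQC hgΛ hgΛ _ _ t
  have hJm : AEStronglyMeasurable ((Ioi s).indicator J) := by
    refine aestronglyMeasurable_of_tendsto_ae (u := atTop) (f := fun n => (Ioi s).indicator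
      (stripFlux (fun p => η (U p)) (cutFlux fun p => q (U p)) (width n) (curve (x₀ - width n) s g)
        (curve (x₀ + width n) s g) g g)) (fun n => ?_) ?_
    · exact ((stripFlux_measurable hE hQ (curve_continuous hg hgΛ _ _)
        (curve_continuous hg hgΛ _ _) hg hg).indicator measurableSet_Ioi).aestronglyMeasurable
    · filter_upwards [hlim] with t ht
      by_cases hst : t ∈ Ioi s
      · simp only [indicator_of_mem hst]; exact ht hst
      · simp only [indicator_of_notMem hst]; exact tendsto_const_nhds
  have hJl : LocallyIntegrable ((Ioi s).indicator J) := by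
    refine (locallyIntegrable_const (2 * (C + Λ * C))).mono hJm ?_
    filter_upwards [hlim] with t ht
    refine le_trans ?_ (le_abs_self _)
    by_cases hst : t ∈ Ioi s
    · rw [indicator_of_mem hst]
      exact le_of_tendsto' (ht hst).abs fun n => hFb n t
    · rw [indicator_of_notMem hst, norm_zero]
      exact (abs_nonneg _).trans (hFb 0 t)
  refine ae_nonneg_of_forall_test hJl fun χ hχ hχc hχs hχ0 => ?_
  have key := (h.strip_limit hE hQ hEC hQC hg hg hgΛ hgΛ (x₀ := fun n => x₀ - width n)
    (y₀ := fun n => x₀ + width n) (D := 2) (δ := width) (m := fun _ => 0) (s := s) (fun n => ?_)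
    width_pos ?_ hlim hχ hχc hχs hχ0).2
  · refine key.trans_eq (integral_congr_ae (Eventually.of_forall fun t => ?_))
    by_cases hst : t ∈ Ioi s
    · simp [indicator_of_mem hst]
    · have : χ t = 0 := image_eq_zero_of_notMem_tsupport fun h' => hst (hχs h')
      simp [this]
  · rw [add_sub_sub_cancel, abs_of_pos (by linarith [width_pos n])]
    linarith [width_le_one n]
  · refine Eventually.of_forall fun t _ => ?_
    refine squeeze_zero_norm (a := fun n => C * (2 * width n)) (fun n => ?_) ?_
    · refine (abs_stripMass_le (width_pos n) hEC _ _ t).trans (mul_le_mul_of_nonneg_left ?_ hC0)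
      rw [curve_add, curve_sub, add_sub_sub_cancel, abs_of_pos (by linarith [width_pos n])]
      linarith
    · simpa using (tendsto_width.const_mul 2).const_mul C

/-- If the relative fluxes through the two ends of the strip between `ξ` and `ζ` differ by at most
`κ`, the mass in the strip grows at most with speed `κ`. -/
lemma IsPlaneSubsolution.exists_ae_mass_le {U : ℝ × ℝ → ℝ} (hU : Measurable U) {a b : ℝ}
    (hUab : ∀ p, U p ∈ Icc a b) (hT : ∀ᵐ t : ℝ, 0 < t → HasTraces fun x => U (x, t))
    {η q : ℝ → ℝ} (hη : Continuous η) (hq : Continuous q)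
    (h : IsPlaneSubsolution (fun p => η (U p)) (cutFlux fun p => q (U p)))
    {g k : ℝ → ℝ} {Λ : ℝ} (hg : Measurable g) (hk : Measurable k) (hgΛ : ∀ t, |g t| ≤ Λ)
    (hkΛ : ∀ t, |k t| ≤ Λ) (x₀ y₀ : ℝ) {s : ℝ} (hs : 0 ≤ s) {κ : ℝ} (hκ : 0 ≤ κ)
    (hflux : ∀ᵐ t, s < t → curve x₀ s g t < curve y₀ s k t →
      (q (rightTrace (fun x => U (x, t)) (curve x₀ s g t)) -
          g t * η (rightTrace (fun x => U (x, t)) (curve x₀ s g t))) -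
        (q (leftTrace (fun x => U (x, t)) (curve y₀ s k t)) -
          k t * η (leftTrace (fun x => U (x, t)) (curve y₀ s k t))) ≤ κ) :
    ∃ G : Set ℝ, (∀ᵐ t, t ∈ G) ∧ ∀ τ ∈ G, ∀ T ∈ G, s < τ → τ < T →
      ∫ x in Ioo (curve x₀ s g T) (curve y₀ s k T), η (U (x, T)) ≤
        (∫ x in Ioo (curve x₀ s g τ) (curve y₀ s k τ), η (U (x, τ))) + κ * (T - τ) := by
  obtain ⟨C, hEC, hQC⟩ := exists_bound_comp hUab hη hq
  have hC0 : 0 ≤ C := (abs_nonneg _).trans (hEC 0)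
  have hΛ0 : 0 ≤ Λ := (abs_nonneg _).trans (hgΛ 0)
  have hE : Measurable fun p => η (U p) := hη.measurable.comp hU
  have hQ : Measurable (cutFlux fun p => q (U p)) := cutFlux_measurable (hq.measurable.comp hU)
  set ξ := curve x₀ s g with hξ
  set ζ := curve y₀ s k with hζ
  set m : ℝ → ℝ := fun t => ∫ x in Ioo (ξ t) (ζ t), η (U (x, t)) with hmdef
  -- when the curves have met, the strip is empty and there is no flux
  set J : ℝ → ℝ := fun t => if ξ t < ζ t then
    (q (rightTrace (fun x => U (x, t)) (ξ t)) - g t * η (rightTrace (fun x => U (x, t)) (ξ t))) -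
    (q (leftTrace (fun x => U (x, t)) (ζ t)) - k t * η (leftTrace (fun x => U (x, t)) (ζ t)))
    else 0 with hJ
  have hm : ∀ t, Tendsto (fun n => stripMass (fun p => η (U p)) (width n) ξ ζ t) atTop (𝓝 (m t)) := by
    intro t
    have hEt : Measurable fun x => η (U (x, t)) := hE.comp measurable_prodMk_right
    have hs : ∀ n x, x ∉ Ioo (ξ t) (ζ t) → plateau (width n) (ξ t) (ζ t) x * η (U (x, t)) = 0 :=
      fun n x hx => by rw [plateau_eq_zero (width_pos n) hx, zero_mul]
    simp only [stripMass, hmdef]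
    simp_rw [fun n => (setIntegral_eq_integral_of_forall_compl_eq_zero (μ := volume) (hs n)).symm]
    refine tendsto_integral_of_dominated_convergence (fun _ => C) (fun n => ?_)
      (integrableOn_const (by simp)) (fun n => Eventually.of_forall fun x => ?_) ?_
    · exact ((((plateau_continuous _).comp (by fun_prop : Continuous fun x : ℝ => (ξ t, ζ t, x))).measurable).mul
        hEt).aestronglyMeasurable
    · rw [norm_mul, Real.norm_eq_abs, Real.norm_eq_abs, abs_of_nonneg (plateau_nonneg _ _ _ _)]
      exact (mul_le_of_le_one_left (abs_nonneg _) (plateau_le_one _ _ _ _)).trans (hEC _)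
    · filter_upwards [ae_restrict_mem measurableSet_Ioo] with x hx
      refine tendsto_const_nhds.congr' ?_
      filter_upwards [tendsto_width.eventually_lt_const (sub_pos.2 hx.1),
        tendsto_width.eventually_lt_const (sub_pos.2 hx.2)] with n h1 h2
      rw [plateau, Real.smoothTransition.one_of_one_le ((one_le_div (width_pos n)).2 h1.le),
        Real.smoothTransition.one_of_one_le ((one_le_div (width_pos n)).2 h2.le), one_mul, one_mul]
  have hξc : Continuous ξ := curve_continuous hg hgΛ _ _
  have hζc : Continuous ζ := curve_continuous hk hkΛ _ _
  have hmm : Measurable m := measurable_of_tendsto_metrizable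
    (fun n => stripMass_measurable (δ := width n) hE hξc hζc) (tendsto_pi_nhds.2 hm)
  have hml : LocallyIntegrable m := by
    have hc : Continuous fun t => C * |ζ t - ξ t| := by fun_prop
    refine hc.locallyIntegrable.mono hmm.aestronglyMeasurable (Eventually.of_forall fun t => ?_)
    exact (le_of_tendsto' (hm t).abs fun n => abs_stripMass_le (width_pos n) hEC ξ ζ t).trans
      (le_abs_self _)
  have hlim : ∀ᵐ t, s < t → Tendsto (fun n => stripFlux (fun p => η (U p)) (cutFlux fun p => q (U p))
      (width n) ξ ζ g k t) atTop (𝓝 (J t)) := by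
    filter_upwards [hT] with t ht hst
    have ht0 : 0 < t := hs.trans_lt hst
    have hUt : Measurable fun x => U (x, t) := hU.comp measurable_prodMk_right
    have hGc : ∀ v : ℝ, Continuous fun w => q w - v * η w := fun v => hq.sub (hη.const_mul v)
    have e : ∀ x, cutFlux (fun p => q (U p)) (x, t) = q (U (x, t)) := fun x => by
      rw [cutFlux, if_pos ht0]
    have hb : ∀ v x, |q (U (x, t)) - v * η (U (x, t))| ≤ C + |v| * C := fun v x => by
      rw [← e]; exact abs_flux_sub_mul_le hEC hQC (g := fun _ => v) (fun _ => le_rfl) (x, t) t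
    by_cases hlt : ξ t < ζ t
    · simp only [stripFlux, e, hJ, if_pos hlt]
      exact (tendsto_plateauL_right ((hGc (g t)).measurable.comp hUt) (hb (g t))
        (((hGc (g t)).tendsto _).comp ((ht ht0).tendsto_right _)) hlt width_pos tendsto_width).sub
        (tendsto_plateauR_left ((hGc (k t)).measurable.comp hUt) (hb (k t))
        (((hGc (k t)).tendsto _).comp ((ht ht0).tendsto_left _)) hlt width_pos tendsto_width)
    · have hx : ∀ x, x ∉ Ioo (ξ t) (ζ t) := fun x hx => hlt (hx.1.trans hx.2)
      simp only [stripFlux, hJ, if_neg hlt, plateauL_eq_zero (width_pos _) (hx _),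
        plateauR_eq_zero (width_pos _) (hx _), zero_mul, integral_zero, sub_zero]
      exact tendsto_const_nhds
  have hJκ : ∀ᵐ t, s < t → J t ≤ κ := by
    filter_upwards [hflux] with t ht hst
    simp only [hJ]
    split_ifs with hlt
    · exact ht hst hlt
    · exact hκ
  have hlin : Continuous fun t : ℝ => κ * t := by fun_prop
  obtain ⟨G, hG, hG'⟩ := exists_ae_antitone (s := s) (D := fun t => m t - κ * t)
    (hml.sub hlin.locallyIntegrable) fun χ hχ hχc hχs hχ0 => by
    obtain ⟨i1, key⟩ := h.strip_limit hE hQ hEC hQC hg hk hgΛ hkΛ (x₀ := fun _ => x₀)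
      (y₀ := fun _ => y₀) (D := |y₀ - x₀|) (δ := width) (s := s) (fun n => le_rfl)
      width_pos (Eventually.of_forall fun t _ => hm t) hlim hχ hχc hχs hχ0
    have hχd : ∀ t, HasDerivAt χ (deriv χ t) t := fun t =>
      (hχ.differentiable (by simp) t).hasDerivAt
    have hχ' : Continuous (deriv χ) := hχ.continuous_deriv (by simp)
    have i2 : Integrable fun t => deriv χ t * m t :=
      hml.integrable_smul_left_of_hasCompactSupport hχ' hχc.deriv
    have i3 : Integrable fun t => deriv χ t * (κ * t) :=
      hlin.locallyIntegrable.integrable_smul_left_of_hasCompactSupport hχ' hχc.deriv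
    have i4 : Integrable fun t => χ t * κ :=
      (hχ.continuous.integrable_of_hasCompactSupport hχc).mul_const κ
    have e1 : ∫ t, (deriv χ t * (κ * t) + χ t * κ) = 0 := by
      refine integral_deriv_eq_zero_of_compact (g := fun t => χ t * (κ * t)) (fun t => ?_) ?_
        (hχc.mul_right)
      · refine ((hχd t).mul ((hasDerivAt_id' t).const_mul κ)).congr_deriv (by ring)
      · have := hχ.continuous; fun_prop
    rw [integral_add i3 i4] at e1
    have e2 : ∫ t, (deriv χ t * m t + χ t * J t) ≤ ∫ t, (deriv χ t * m t + χ t * κ) := by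
      refine integral_mono_ae i1 (i2.add i4) ?_
      filter_upwards [hJκ] with t ht
      by_cases hst : t ∈ Ioi s
      · exact add_le_add le_rfl (mul_le_mul_of_nonneg_left (ht hst) (hχ0 t))
      · have : χ t = 0 := image_eq_zero_of_notMem_tsupport fun h' => hst (hχs h')
        simp [this]
    rw [integral_add i2 i4] at e2
    simp only [mul_sub]
    rw [integral_sub i2 i3]
    linarith
  refine ⟨G, hG, fun τ hτ T hT h1 h2 => ?_⟩
  have := hG' τ hτ T hT h1 h2
  linarith

end ConservationLaw

end

/-! ### The algebra of generalised characteristics -/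

noncomputable section

namespace ConservationLaw

/-- The slope `A(v, c)` of the chord of `f` between `c` and `v`. -/
def chord (f : ℝ → ℝ) (c v : ℝ) : ℝ := if v = c then deriv f c else (f v - f c) / (v - c)

lemma velocity_eq (f : ℝ → ℝ) (u : ℝ × ℝ → ℝ) (c : ℝ) (p : ℝ × ℝ) :
    velocity f u c p = chord f c (u p) := rfl

lemma chord_mul (f : ℝ → ℝ) (c v : ℝ) : chord f c v * (v - c) = f v - f c := by
  rw [chord]
  split_ifs with h
  · simp [h]
  · exact div_mul_cancel₀ _ (sub_ne_zero.2 h)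

lemma abs_mul_chord (f : ℝ → ℝ) (c v : ℝ) : |v - c| * chord f c v = kflux f v c := by
  rcases le_total c v with h | h
  · rw [abs_of_nonneg (sub_nonneg.2 h), kflux_of_le h, mul_comm, chord_mul]
  · rw [abs_of_nonpos (sub_nonpos.2 h), kflux_of_ge h, ← neg_sub (f v), ← chord_mul]; ring

/-- The second order Taylor estimate for a function with Lipschitz derivative. -/
lemma abs_taylor_le {f : ℝ → ℝ} (hf : ContDiff ℝ 1 f) {a b : ℝ} {L : ℝ≥0}
    (hL : LipschitzOnWith L (deriv f) (Icc a b)) {c v : ℝ} (hc : c ∈ Icc a b) (hv : v ∈ Icc a b) :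
    |f v - f c - deriv f c * (v - c)| ≤ L * (v - c) ^ 2 / 2 := by
  have hfd : ∀ x, HasDerivAt f (deriv f x) x := fun x =>
    (hf.differentiable (by simp) x).hasDerivAt
  have hg : ∀ s : ℝ, HasDerivAt (fun s => f (c + s * (v - c)) - f c - deriv f c * (s * (v - c)))
      (deriv f (c + s * (v - c)) * (v - c) - deriv f c * (v - c)) s := fun s => by
    have h1 : HasDerivAt (fun s : ℝ => s * (v - c)) (v - c) s := by
      simpa using (hasDerivAt_id s).mul_const (v - c)
    exact (((hfd _).comp s (h1.const_add c)).sub_const _).sub (h1.const_mul _)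
  have hB : ∀ s : ℝ, HasDerivAt (fun s : ℝ => L * (v - c) ^ 2 * (s ^ 2 / 2)) (L * (v - c) ^ 2 * s) s :=
    fun s => by
      have := ((hasDerivAt_pow 2 s).div_const 2).const_mul (L * (v - c) ^ 2)
      refine this.congr_deriv ?_
      simp
  have key := image_norm_le_of_norm_deriv_right_le_deriv_boundary (a := 0) (b := 1)
    (f := fun s => f (c + s * (v - c)) - f c - deriv f c * (s * (v - c)))
    (fun s _ => (hg s).continuousAt.continuousWithinAt) (fun s _ => (hg s).hasDerivWithinAt)
    (B := fun s => L * (v - c) ^ 2 * (s ^ 2 / 2)) (by simp) hB (fun s hs => ?_)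
    (show (1 : ℝ) ∈ Icc 0 1 by simp)
  · simpa [div_eq_mul_inv] using key
  · have hmem : c + s * (v - c) ∈ Icc a b :=
      (convex_Icc a b).add_smul_sub_mem hc hv ⟨hs.1, hs.2.le⟩
    have := hL.dist_le_mul _ hmem _ hc
    rw [Real.dist_eq, Real.dist_eq, add_sub_cancel_left, abs_mul, abs_of_nonneg hs.1] at this
    rw [← sub_mul, Real.norm_eq_abs, abs_mul]
    calc _ ≤ L * (s * |v - c|) * |v - c| := mul_le_mul_of_nonneg_right this (abs_nonneg _)
      _ = L * (v - c) ^ 2 * s := by rw [← sq_abs (v - c)]; ring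

lemma abs_chord_sub_le {f : ℝ → ℝ} (hf : ContDiff ℝ 1 f) {a b : ℝ} {L : ℝ≥0}
    (hL : LipschitzOnWith L (deriv f) (Icc a b)) {c v : ℝ} (hc : c ∈ Icc a b) (hv : v ∈ Icc a b) :
    |chord f c v - deriv f c| ≤ L * |v - c| / 2 := by
  by_cases h : v = c
  · simp [chord, h]
  have h1 := abs_taylor_le hf hL hc hv
  have h0 : 0 < |v - c| := abs_pos.2 (sub_ne_zero.2 h)
  rw [← chord_mul, ← sub_mul, abs_mul, ← sq_abs (v - c)] at h1
  refine le_of_mul_le_mul_right ?_ h0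
  linarith

lemma chord_continuous {f : ℝ → ℝ} (hf : ContDiff ℝ 1 f) (c : ℝ) : Continuous (chord f c) := by
  have hfd : HasDerivAt f (deriv f c) c := (hf.differentiable (by simp) c).hasDerivAt
  have e : chord f c = Function.update (slope f c) c (deriv f c) := by
    ext v
    by_cases h : v = c
    · simp [chord, h]
    · rw [Function.update_of_ne h, chord, if_neg h, slope_def_field]
  rw [e, continuous_iff_continuousAt]
  intro v
  by_cases h : v = c
  · subst h
    exact continuousAt_update_same.2 (hasDerivAt_iff_tendsto_slope.1 hfd)
  · refine (continuousAt_update_of_ne h).2 ?_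
    have : ContinuousAt (fun v => (f v - f c) / (v - c)) v :=
      (hf.continuous.continuousAt.sub continuousAt_const).div
        (continuousAt_id.sub continuousAt_const) (sub_ne_zero.2 h)
    simpa only [slope_fun_def_field] using this

lemma abs_chord_le {f : ℝ → ℝ} {c v Λ : ℝ} (hΛ : |deriv f c| ≤ Λ)
    (hf : |f v - f c| ≤ Λ * |v - c|) : |chord f c v| ≤ Λ := by
  rw [chord]
  split_ifs with h
  · exact hΛ
  · rw [abs_div]
    exact div_le_of_le_mul₀ (abs_nonneg _) ((abs_nonneg _).trans hΛ) hf

/-- The relative flux of the entropy `ε + dist(·, [α, β])`, where `[α, β]` is the part of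
`[c - ε, c + ε]` in `[a, b]`, through a curve of speed `σ`, compared with the chord slope. The
constant `ε f'(c)` normalises the flux of the entropy. -/
lemma gapFlux_sub_mul_gap {f : ℝ → ℝ} (hf : ContDiff ℝ 1 f) {a b : ℝ} {L : ℝ≥0}
    (hL : LipschitzOnWith L (deriv f) (Icc a b)) {c v : ℝ} (hc : c ∈ Icc a b) (hv : v ∈ Icc a b)
    {ε : ℝ} (hε : 0 < ε) (σ : ℝ) :
    let w := gapFlux f (max (c - ε) a) (min (c + ε) b) v + ε * deriv f c -
      σ * (ε + gap (max (c - ε) a) (min (c + ε) b) v)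
    (|v - c| ≤ ε ∧ w = ε * (deriv f c - σ)) ∨
      v ≠ c ∧ |w - |v - c| * (chord f c v - σ)| ≤ L * ε ^ 2 / 2 := by
  intro w
  have hαβ : max (c - ε) a ≤ min (c + ε) b :=
    max_le (le_min (by linarith) (by linarith [hc.2])) (le_min (by linarith [hc.1]) (hc.1.trans hc.2))
  by_cases h1 : v ≤ c + ε
  · by_cases h2 : c - ε ≤ v
    · have hm : v ∈ Icc (max (c - ε) a) (min (c + ε) b) := ⟨max_le h2 hv.1, le_min h1 hv.2⟩
      refine Or.inl ⟨abs_le.2 ⟨by linarith, by linarith⟩, ?_⟩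
      simp only [w]
      rw [gapFlux_of_mem hm, gap_of_mem hm]; ring
    · have h2 : v < c - ε := not_le.1 h2
      have hα : max (c - ε) a = c - ε := max_eq_left (hv.1.trans h2.le)
      refine Or.inr ⟨by linarith, ?_⟩
      have t := abs_taylor_le hf hL hc (v := c - ε) ⟨hv.1.trans h2.le, by linarith [hc.2]⟩
      have k := chord_mul f c v
      simp only [w]
      rw [gapFlux_of_le hαβ (by rw [hα]; exact h2.le), gap_of_le hαβ (by rw [hα]; exact h2.le), hα,
        abs_of_neg (show v - c < 0 by linarith)]
      convert t using 2
      · linear_combination k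
      · ring
  · have h1 : c + ε < v := not_le.1 h1
    have hβ : min (c + ε) b = c + ε := min_eq_left (h1.le.trans hv.2)
    refine Or.inr ⟨by linarith, ?_⟩
    have t := abs_taylor_le hf hL hc (v := c + ε) ⟨by linarith [hc.1], h1.le.trans hv.2⟩
    have k := chord_mul f c v
    rw [← abs_neg] at t
    simp only [w]
    rw [gapFlux_of_ge hαβ (by rw [hβ]; exact h1.le), gap_of_ge hαβ (by rw [hβ]; exact h1.le), hβ,
      abs_of_pos (show 0 < v - c by linarith)]
    convert t using 2
    · linear_combination -k
    · ring

/-- At a point with one-sided limits `vl` and `vr`, a generalised characteristic of speed `σ`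
satisfies `A(vr, c) ≤ σ ≤ A(vl, c)`, except that an inequality may fail at a side where the
limit is `c`, and in that case the other one is an equality. -/
lemma chord_le_of_jump {f : ℝ → ℝ} {a b c vl vr σ : ℝ} (hvl : vl ∈ Icc a b) (hvr : vr ∈ Icc a b)
    (hσ₁ : min (chord f c vl) (chord f c vr) ≤ σ) (hσ₂ : σ ≤ max (chord f c vl) (chord f c vr))
    (ha : kflux f vr a - σ * |vr - a| ≤ kflux f vl a - σ * |vl - a|)
    (hb : kflux f vr b - σ * |vr - b| ≤ kflux f vl b - σ * |vl - b|)
    (hc : kflux f vr c - σ * |vr - c| ≤ kflux f vl c - σ * |vl - c|) :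
    (vr ≠ c → chord f c vr ≤ σ) ∧ (vl ≠ c → σ ≤ chord f c vl) ∧
      (vr = c → vl ≠ c → chord f c vl = σ) ∧ (vl = c → vr ≠ c → chord f c vr = σ) := by
  rw [kflux_of_le hvl.1, kflux_of_le hvr.1, abs_of_nonneg (sub_nonneg.2 hvl.1),
    abs_of_nonneg (sub_nonneg.2 hvr.1)] at ha
  rw [kflux_of_ge hvl.2, kflux_of_ge hvr.2, abs_of_nonpos (sub_nonpos.2 hvl.2),
    abs_of_nonpos (sub_nonpos.2 hvr.2)] at hb
  have el := chord_mul f c vl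
  have er := chord_mul f c vr
  rw [← abs_mul_chord, ← abs_mul_chord] at hc
  -- since `vl` and `vr` lie in `[a, b]`, the entropies `|· - a|` and `|· - b|` reduce to the equation and
  -- its negative, so that the Rankine-Hugoniot condition holds
  have hRH : (chord f c vr - σ) * (vr - c) = (chord f c vl - σ) * (vl - c) := by
    apply le_antisymm <;> linarith
  have habs : |chord f c vr - σ| * |vr - c| = |chord f c vl - σ| * |vl - c| := by
    rw [← abs_mul, ← abs_mul, hRH]
  have pl : vl ≠ c → 0 < |vl - c| := fun h => abs_pos.2 (sub_ne_zero.2 h)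
  have pr : vr ≠ c → 0 < |vr - c| := fun h => abs_pos.2 (sub_ne_zero.2 h)
  have el' : vr = c → vl ≠ c → chord f c vl = σ := fun h1 h2 => by
    rw [h1, sub_self, mul_zero] at hRH
    exact sub_eq_zero.1 ((mul_eq_zero.1 hRH.symm).resolve_right (sub_ne_zero.2 h2))
  have er' : vl = c → vr ≠ c → chord f c vr = σ := fun h1 h2 => by
    rw [h1, sub_self, mul_zero] at hRH
    exact sub_eq_zero.1 ((mul_eq_zero.1 hRH).resolve_right (sub_ne_zero.2 h2))
  refine ⟨fun h => ?_, fun h => ?_, el', er'⟩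
  · by_contra! hlt
    by_cases h' : vl = c
    · exact hlt.ne' (er' h' h)
    -- if `A(vr, c) > σ`, then `A(vl, c) > σ` as well, against the choice of `σ`
    have h1 := mul_pos (sub_pos.2 hlt) (pr h)
    have h2 : σ < chord f c vl := by nlinarith [pl h']
    exact absurd hσ₁ (not_le.2 (lt_min h2 hlt))
  · by_contra! hlt
    by_cases h' : vr = c
    · exact hlt.ne (el' h' h)
    have h1 := mul_pos (sub_pos.2 hlt) (pl h)
    have h2 : chord f c vr < σ := by nlinarith [pr h']
    exact absurd hσ₂ (not_le.2 (max_lt hlt h2))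

/-- The relative flux of the entropy `ε + dist(·, [α, β])` through a generalised characteristic is
of second order in `ε`, from below on the left and from above on the right. -/
lemma flux_le_of_jump {f : ℝ → ℝ} (hf : ContDiff ℝ 1 f) {a b : ℝ} {L : ℝ≥0}
    (hL : LipschitzOnWith L (deriv f) (Icc a b)) {c vl vr σ ε : ℝ} (hc : c ∈ Icc a b)
    (hvl : vl ∈ Icc a b) (hvr : vr ∈ Icc a b) (hε : 0 < ε)
    (hσ₁ : min (chord f c vl) (chord f c vr) ≤ σ) (hσ₂ : σ ≤ max (chord f c vl) (chord f c vr))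
    (ha : kflux f vr a - σ * |vr - a| ≤ kflux f vl a - σ * |vl - a|)
    (hb : kflux f vr b - σ * |vr - b| ≤ kflux f vl b - σ * |vl - b|)
    (hc' : kflux f vr c - σ * |vr - c| ≤ kflux f vl c - σ * |vl - c|)
    {wl wr : ℝ} (hwl : wl = gapFlux f (max (c - ε) a) (min (c + ε) b) vl + ε * deriv f c -
      σ * (ε + gap (max (c - ε) a) (min (c + ε) b) vl))
    (hwr : wr = gapFlux f (max (c - ε) a) (min (c + ε) b) vr + ε * deriv f c -
      σ * (ε + gap (max (c - ε) a) (min (c + ε) b) vr)) (hw : wr ≤ wl) :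
    wr ≤ L * ε ^ 2 / 2 ∧ -(L * ε ^ 2 / 2) ≤ wl := by
  obtain ⟨h1, h2, h3, h4⟩ := chord_le_of_jump hvl hvr hσ₁ hσ₂ ha hb hc'
  have gl := gapFlux_sub_mul_gap hf hL hc hvl hε σ
  have gr := gapFlux_sub_mul_gap hf hL hc hvr hε σ
  simp only at gl gr
  rw [← hwl] at gl
  rw [← hwr] at gr
  have bl := abs_le.1 (abs_chord_sub_le hf hL hc hvl)
  have br := abs_le.1 (abs_chord_sub_le hf hL hc hvr)
  have hL0 : (0 : ℝ) ≤ L := L.2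
  have hnear : ∀ v : ℝ, |v - c| ≤ ε → L * |v - c| / 2 ≤ L * ε / 2 := fun v hv => by
    have := mul_le_mul_of_nonneg_left hv hL0
    linarith
  constructor
  · rcases gr with ⟨gr1, gr2⟩ | ⟨gr1, gr2⟩
    · by_cases hr : vr = c
      · by_cases hl : vl = c
        · rw [hl, hr, min_self] at hσ₁
          have : chord f c c = deriv f c := by simp [chord]
          have : ε * (deriv f c - σ) ≤ 0 := mul_nonpos_of_nonneg_of_nonpos hε.le (by linarith)
          have : 0 ≤ L * ε ^ 2 / 2 := by positivity
          linarith
        · have e := h3 hr hl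
          rcases gl with ⟨gl1, gl2⟩ | ⟨gl1, gl2⟩
          · have := hnear vl gl1
            rw [gr2]; nlinarith [bl.1]
          · rw [e, sub_self, mul_zero, sub_zero] at gl2
            linarith [(abs_le.1 gl2).2]
      · have := hnear vr gr1
        have := h1 hr
        rw [gr2]; nlinarith [br.1]
    · have := mul_nonneg (abs_nonneg (vr - c)) (sub_nonneg.2 (h1 gr1))
      linarith [(abs_le.1 gr2).2]
  · rcases gl with ⟨gl1, gl2⟩ | ⟨gl1, gl2⟩
    · by_cases hl : vl = c
      · by_cases hr : vr = c
        · rw [hl, hr, max_self] at hσ₂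
          have : chord f c c = deriv f c := by simp [chord]
          have : 0 ≤ ε * (deriv f c - σ) := mul_nonneg hε.le (by linarith)
          have : 0 ≤ L * ε ^ 2 / 2 := by positivity
          linarith
        · have e := h4 hl hr
          rcases gr with ⟨gr1, gr2⟩ | ⟨gr1, gr2⟩
          · have := hnear vr gr1
            rw [gl2]; nlinarith [br.2]
          · rw [e, sub_self, mul_zero, sub_zero] at gr2
            linarith [(abs_le.1 gr2).1]
      · have := hnear vl gl1
        have := h2 hl
        rw [gl2]; nlinarith [bl.2]
    · have := mul_nonneg (abs_nonneg (vl - c)) (sub_nonneg.2 (h2 gl1))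
      linarith [(abs_le.1 gl2).1]

end ConservationLaw

end

/-! ### Envelopes of the velocity field -/

noncomputable section

namespace ConservationLaw

lemma le_lowerEnvelope {A : ℝ × ℝ → ℝ} {x t δ r : ℝ} (hδ : 0 < δ)
    (h : ∀ᵐ y, y ∈ Metric.ball x δ → r ≤ A (y, t)) : (r : EReal) ≤ lowerEnvelope A x t := by
  refine le_iSup₂_of_le δ hδ (le_essInf_of_ae_le _ ?_)
  filter_upwards [(ae_restrict_iff' Metric.isOpen_ball.measurableSet).2 h] with y hy
  exact EReal.coe_le_coe_iff.2 hy

lemma upperEnvelope_le {A : ℝ × ℝ → ℝ} {x t δ r : ℝ} (hδ : 0 < δ)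
    (h : ∀ᵐ y, y ∈ Metric.ball x δ → A (y, t) ≤ r) : upperEnvelope A x t ≤ (r : EReal) := by
  refine iInf₂_le_of_le δ hδ (essSup_le_of_ae_le _ ?_)
  filter_upwards [(ae_restrict_iff' Metric.isOpen_ball.measurableSet).2 h] with y hy
  exact EReal.coe_le_coe_iff.2 hy

lemma exists_of_lt_lowerEnvelope {A : ℝ × ℝ → ℝ} {x t r : ℝ}
    (h : (r : EReal) < lowerEnvelope A x t) :
    ∃ δ > 0, ∀ᵐ y, y ∈ Metric.ball x δ → r ≤ A (y, t) := by
  obtain ⟨δ, hδ⟩ := lt_iSup_iff.1 h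
  obtain ⟨hδ0, hr⟩ := lt_iSup_iff.1 hδ
  refine ⟨δ, hδ0, (ae_restrict_iff' Metric.isOpen_ball.measurableSet).1 ?_⟩
  filter_upwards [ae_lt_of_lt_essInf hr] with y hy
  exact (EReal.coe_lt_coe_iff.1 hy).le

lemma exists_of_upperEnvelope_lt {A : ℝ × ℝ → ℝ} {x t r : ℝ}
    (h : upperEnvelope A x t < (r : EReal)) :
    ∃ δ > 0, ∀ᵐ y, y ∈ Metric.ball x δ → A (y, t) ≤ r := by
  obtain ⟨δ, hδ⟩ := iInf_lt_iff.1 h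
  obtain ⟨hδ0, hr⟩ := iInf_lt_iff.1 hδ
  refine ⟨δ, hδ0, (ae_restrict_iff' Metric.isOpen_ball.measurableSet).1 ?_⟩
  filter_upwards [ae_lt_of_essSup_lt hr] with y hy
  exact (EReal.coe_lt_coe_iff.1 hy).le

lemma lowerEnvelope_congr {A B : ℝ × ℝ → ℝ} {t : ℝ} (h : ∀ᵐ y, A (y, t) = B (y, t)) (x : ℝ) :
    lowerEnvelope A x t = lowerEnvelope B x t := by
  refine iSup_congr fun δ => iSup_congr fun _ => essInf_congr_ae (ae_restrict_of_ae ?_)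
  filter_upwards [h] with y hy
  rw [hy]

lemma upperEnvelope_congr {A B : ℝ × ℝ → ℝ} {t : ℝ} (h : ∀ᵐ y, A (y, t) = B (y, t)) (x : ℝ) :
    upperEnvelope A x t = upperEnvelope B x t := by
  refine iInf_congr fun δ => iInf_congr fun _ => essSup_congr_ae (ae_restrict_of_ae ?_)
  filter_upwards [h] with y hy
  rw [hy]

/-- Filippov solutions only depend on the velocity up to null sets of the half plane. -/
lemma IsFilippovSolution.congr {A B : ℝ × ℝ → ℝ} {s : ℝ} {ξ : ℝ → ℝ} (hs : 0 ≤ s)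
    (hAB : ∀ᵐ t : ℝ, 0 < t → ∀ᵐ y, A (y, t) = B (y, t)) (h : IsFilippovSolution A s ξ) :
    IsFilippovSolution B s ξ := by
  refine ⟨h.absCont, ?_⟩
  filter_upwards [h.inclusion, ae_restrict_of_ae hAB, ae_restrict_mem measurableSet_Ioi] with t ht h1 h2
  have h3 := h1 (hs.trans_lt h2)
  rwa [← lowerEnvelope_congr h3, ← upperEnvelope_congr h3]

/-- Near a point, a function is essentially close to its traces. -/
lemma exists_ball_of_tendsto {G : ℝ → ℝ} {x : ℝ} {I : Set ℝ} {l r : ℝ}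
    (hl : Tendsto G (aeLeft x) (𝓝 l)) (hr : Tendsto G (aeRight x) (𝓝 r)) (hI₁ : I ∈ 𝓝 l)
    (hI₂ : I ∈ 𝓝 r) : ∃ δ > 0, ∀ᵐ y, y ∈ Metric.ball x δ → G y ∈ I := by
  obtain ⟨ε₁, hε₁, h₁⟩ := Metric.mem_nhds_iff.1 hI₁
  obtain ⟨ε₂, hε₂, h₂⟩ := Metric.mem_nhds_iff.1 hI₂
  obtain ⟨δ₁, hδ₁, k₁⟩ := exists_of_tendsto_aeLeft hl (half_pos hε₁)
  obtain ⟨δ₂, hδ₂, k₂⟩ := exists_of_tendsto_aeRight hr (half_pos hε₂)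
  refine ⟨min δ₁ δ₂, lt_min hδ₁ hδ₂, ?_⟩
  filter_upwards [k₁, k₂, Measure.ae_ne volume x] with y hy₁ hy₂ hne hy
  rw [Metric.mem_ball, Real.dist_eq, abs_lt] at hy
  rcases lt_or_gt_of_ne hne with h | h
  · refine h₁ ((hy₁ ⟨?_, h⟩).trans_lt (half_lt_self hε₁))
    linarith [hy.1, min_le_left δ₁ δ₂]
  · refine h₂ ((hy₂ ⟨h, ?_⟩).trans_lt (half_lt_self hε₂))
    linarith [hy.2, min_le_right δ₁ δ₂]

lemma min_le_of_lowerEnvelope_le {A : ℝ × ℝ → ℝ} {x t l r σ : ℝ}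
    (hl : Tendsto (fun y => A (y, t)) (aeLeft x) (𝓝 l))
    (hr : Tendsto (fun y => A (y, t)) (aeRight x) (𝓝 r))
    (h : lowerEnvelope A x t ≤ (σ : EReal)) : min l r ≤ σ := by
  refine le_of_forall_lt fun z hz => ?_
  obtain ⟨w, hzw, hw⟩ := exists_between hz
  obtain ⟨δ, hδ, hb⟩ := exists_ball_of_tendsto hl hr (Ioi_mem_nhds (hw.trans_le (min_le_left _ _)))
    (Ioi_mem_nhds (hw.trans_le (min_le_right _ _)))
  refine hzw.trans_le (EReal.coe_le_coe_iff.1 ((le_lowerEnvelope hδ ?_).trans h))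
  filter_upwards [hb] with y hy hyb using (hy hyb).le

lemma le_max_of_le_upperEnvelope {A : ℝ × ℝ → ℝ} {x t l r σ : ℝ}
    (hl : Tendsto (fun y => A (y, t)) (aeLeft x) (𝓝 l))
    (hr : Tendsto (fun y => A (y, t)) (aeRight x) (𝓝 r))
    (h : (σ : EReal) ≤ upperEnvelope A x t) : σ ≤ max l r := by
  refine le_of_forall_gt fun z hz => ?_
  obtain ⟨w, hw, hwz⟩ := exists_between hz
  obtain ⟨δ, hδ, hb⟩ := exists_ball_of_tendsto hl hr (Iio_mem_nhds ((le_max_left _ _).trans_lt hw))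
    (Iio_mem_nhds ((le_max_right _ _).trans_lt hw))
  refine (EReal.coe_le_coe_iff.1 (h.trans (upperEnvelope_le hδ ?_))).trans_lt hwz
  filter_upwards [hb] with y hy hyb using (hy hyb).le

end ConservationLaw

end

/-! ### Stability of Filippov solutions -/

noncomputable section

namespace ConservationLaw

/-- A Borel representative of an entropy solution with values in `[a, b]` that satisfies the
Kruzhkov inequalities on the plane and has one-sided traces at almost every positive time. -/
structure IsTracedSolution (f : ℝ → ℝ) (a b : ℝ) (U : ℝ × ℝ → ℝ) : Prop where
  measurable : Measurable U
  mem : ∀ p, U p ∈ Icc a b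
  kruzkov : IsKruzkov f a b U
  traces : ∀ᵐ t : ℝ, 0 < t → HasTraces fun x => U (x, t)

/-- A measurable bounded velocity for a Filippov solution. -/
lemma IsFilippovSolution.exists_curve {A : ℝ × ℝ → ℝ} {s Λ : ℝ} {ξ : ℝ → ℝ}
    (h : IsFilippovSolution A s ξ) (hΛ : ∀ p, |A p| ≤ Λ) :
    ∃ g : ℝ → ℝ, Measurable g ∧ (∀ t, |g t| ≤ Λ) ∧ (∀ t, s ≤ t → ξ t = curve (ξ s) s g t) ∧
      ∀ᵐ t, s < t → lowerEnvelope A (ξ t) t ≤ ((g t : ℝ) : EReal) ∧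
        ((g t : ℝ) : EReal) ≤ upperEnvelope A (ξ t) t := by
  have hΛ0 : 0 ≤ Λ := (abs_nonneg _).trans (hΛ 0)
  have hinc := (ae_restrict_iff' measurableSet_Ioi).1 h.inclusion
  have hbd : ∀ᵐ t, s < t → |deriv ξ t| ≤ Λ := by
    filter_upwards [hinc] with t ht hst
    obtain ⟨-, h1, h2⟩ := ht hst
    refine abs_le.2 ⟨?_, ?_⟩
    · exact EReal.coe_le_coe_iff.1 ((le_lowerEnvelope one_pos
        (Eventually.of_forall fun y _ => (abs_le.1 (hΛ (y, t))).1)).trans h1)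
    · exact EReal.coe_le_coe_iff.1 (h2.trans (upperEnvelope_le one_pos
        (Eventually.of_forall fun y _ => (abs_le.1 (hΛ (y, t))).2)))
  refine ⟨{t | |deriv ξ t| ≤ Λ}.indicator (deriv ξ), ?_, fun t => ?_, fun t hst => ?_, ?_⟩
  · exact (measurable_deriv ξ).indicator (measurableSet_le (measurable_deriv ξ).abs measurable_const)
  · by_cases ht : t ∈ {t | |deriv ξ t| ≤ Λ}
    · rw [indicator_of_mem ht]; exact ht
    · rw [indicator_of_notMem ht, abs_zero]; exact hΛ0
  · have e : ∫ r in s..t, {t | |deriv ξ t| ≤ Λ}.indicator (deriv ξ) r = ∫ r in s..t, deriv ξ r := by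
      refine intervalIntegral.integral_congr_ae ?_
      filter_upwards [hbd] with r hr hrI
      rw [uIoc_of_le hst] at hrI
      exact indicator_of_mem (show r ∈ {t | |deriv ξ t| ≤ Λ} from hr hrI.1) _
    rw [curve, e, (h.absCont t hst).integral_deriv_eq_sub]
    ring
  · filter_upwards [hinc, hbd] with t ht hb hst
    rw [indicator_of_mem (show t ∈ {t | |deriv ξ t| ≤ Λ} from hb hst)]
    exact (ht hst).2

/-- If `x ≤ p / ε + ε q` for all `ε > 0`, then `x ≤ 2 √(p q)`. The sign of `q` is not needed, because the
hypothesis forces `0 ≤ q` if `0 < x`. -/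
lemma le_two_sqrt_of_forall {x p q : ℝ} (hp : 0 ≤ p) (h : ∀ ε > 0, ε * x ≤ p + ε ^ 2 * q) :
    x ≤ 2 * √(p * q) := by
  rcases le_or_gt x 0 with hx | hx
  · exact hx.trans (by positivity)
  have hq : 0 ≤ q := by
    by_contra! hq
    -- for large `ε` the right-hand side is negative
    have := h ((p + 1) / x - (p + 1) / q) (by
      have := div_pos (show 0 < p + 1 by linarith) hx
      have := div_neg_of_pos_of_neg (show 0 < p + 1 by linarith) hq
      linarith)
    have h1 : (p + 1) / x * x = p + 1 := div_mul_cancel₀ _ hx.ne'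
    have h2 : 0 < -((p + 1) / q) * x :=
      mul_pos (neg_pos.2 (div_neg_of_pos_of_neg (by linarith) hq)) hx
    have h3 : ((p + 1) / x - (p + 1) / q) ^ 2 * q ≤ 0 :=
      mul_nonpos_of_nonneg_of_nonpos (sq_nonneg _) hq.le
    nlinarith
  have hd := discrim_le_zero (a := q) (b := -x) (c := p) fun ε => by
    rcases le_or_gt ε 0 with hε | hε
    · have : 0 ≤ -x * ε := by nlinarith
      have : 0 ≤ q * (ε * ε) := mul_nonneg hq (mul_self_nonneg ε)
      linarith
    · have := h ε hε
      nlinarith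
  rw [discrim] at hd
  have h4 : x ^ 2 ≤ 4 * (p * q) := by nlinarith
  have h5 : x ≤ √(4 * (p * q)) := Real.le_sqrt_of_sq_le h4
  rwa [Real.sqrt_mul (by norm_num), show (4 : ℝ) = 2 ^ 2 by norm_num,
    Real.sqrt_sq (by norm_num)] at h5

lemma gap_nonneg {α β : ℝ} (v : ℝ) : 0 ≤ gap α β v := by
  have := abs_sub_le β v α
  have := le_abs_self (β - α)
  rw [gap, abs_sub_comm v β]
  linarith

lemma gap_le_abs_sub {α β c : ℝ} (hc : c ∈ Icc α β) (v : ℝ) : gap α β v ≤ |v - c| := by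
  have h1 := abs_sub_le v c α
  have h2 := abs_sub_le v c β
  rw [abs_of_nonneg (sub_nonneg.2 hc.1)] at h1
  rw [abs_of_nonpos (sub_nonpos.2 hc.2)] at h2
  rw [gap]
  linarith

/-- The mass estimate behind the Hölder regularity: the mass of `ε + dist(u, [c - ε, c + ε])` between
two Filippov solutions grows at most with speed `L ε²`. -/
lemma IsTracedSolution.eps_mul_le {f : ℝ → ℝ} (hf : ContDiff ℝ 1 f) {a b : ℝ} {U : ℝ × ℝ → ℝ}
    (hU : IsTracedSolution f a b U) {c : ℝ} (hc : c ∈ Icc a b) {L : ℝ≥0}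
    (hL : LipschitzOnWith L (deriv f) (Icc a b)) {M : ℝ} (hM : ∀ p, |U p - c| ≤ M) {s : ℝ}
    (hs : 0 ≤ s) {g k : ℝ → ℝ} {Λ : ℝ} (hg : Measurable g) (hk : Measurable k)
    (hgΛ : ∀ t, |g t| ≤ Λ) (hkΛ : ∀ t, |k t| ≤ Λ) {x₀ y₀ : ℝ}
    (hξ : ∀ᵐ t, s < t → lowerEnvelope (fun p => chord f c (U p)) (curve x₀ s g t) t ≤ (g t : EReal) ∧
      (g t : EReal) ≤ upperEnvelope (fun p => chord f c (U p)) (curve x₀ s g t) t)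
    (hζ : ∀ᵐ t, s < t → lowerEnvelope (fun p => chord f c (U p)) (curve y₀ s k t) t ≤ (k t : EReal) ∧
      (k t : EReal) ≤ upperEnvelope (fun p => chord f c (U p)) (curve y₀ s k t) t)
    {ε : ℝ} (hε : 0 < ε) {T : ℝ} (hT : s < T) :
    ε * max (curve y₀ s k T - curve x₀ s g T) 0 ≤
      (M + ε) * max (y₀ - x₀) 0 + L * ε ^ 2 * (T - s) := by
  have hL0 : (0 : ℝ) ≤ L := L.2
  have hM0 : 0 ≤ M := (abs_nonneg _).trans (hM 0)
  have hab : a ≤ b := hc.1.trans hc.2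
  set α := max (c - ε) a with hα
  set β := min (c + ε) b with hβ
  have hcα : c ∈ Icc α β := ⟨max_le (by linarith) hc.1, le_min (by linarith) hc.2⟩
  have hαm : α ∈ Icc a b := ⟨le_max_right _ _, hcα.1.trans hc.2⟩
  have hβm : β ∈ Icc a b := ⟨hc.1.trans hcα.2, min_le_right _ _⟩
  have hR : ∀ p, |U p| ≤ max |a| |b| := fun p => abs_le_max_abs_abs (hU.mem p).1 (hU.mem p).2
  have hηc : Continuous fun v => ε + gap α β v := continuous_const.add (gap_continuous α β)
  have hqc : Continuous fun v => gapFlux f α β v + ε * deriv f c :=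
    (gapFlux_continuous hf.continuous α β).add continuous_const
  have hent := hU.kruzkov.gap hf.continuous hU.measurable hR hαm hβm ε (ε * deriv f c)
  have hkc : ∀ k, Continuous fun v => kflux f v k := fun k =>
    (kflux_continuous hf.continuous).comp (continuous_id.prodMk continuous_const)
  have hac : ∀ k : ℝ, Continuous fun v : ℝ => |v - k| := fun k => by fun_prop
  -- the one-sided flux bounds along a generalised characteristic
  have hside : ∀ (z₀ : ℝ) (j : ℝ → ℝ), Measurable j → (∀ t, |j t| ≤ Λ) →
      (∀ᵐ t, s < t → lowerEnvelope (fun p => chord f c (U p)) (curve z₀ s j t) t ≤ (j t : EReal) ∧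
        (j t : EReal) ≤ upperEnvelope (fun p => chord f c (U p)) (curve z₀ s j t) t) →
      ∀ᵐ t, s < t →
        gapFlux f α β (rightTrace (fun x => U (x, t)) (curve z₀ s j t)) + ε * deriv f c -
            j t * (ε + gap α β (rightTrace (fun x => U (x, t)) (curve z₀ s j t))) ≤ L * ε ^ 2 / 2 ∧
        -(L * ε ^ 2 / 2) ≤
          gapFlux f α β (leftTrace (fun x => U (x, t)) (curve z₀ s j t)) + ε * deriv f c -
            j t * (ε + gap α β (leftTrace (fun x => U (x, t)) (curve z₀ s j t))) := by
    intro z₀ j hj hjΛ henv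
    have j1 := (hU.kruzkov a ⟨le_rfl, hab⟩).jump hU.measurable hU.mem hU.traces (hac a) (hkc a)
      hj hjΛ z₀ hs
    have j2 := (hU.kruzkov b ⟨hab, le_rfl⟩).jump hU.measurable hU.mem hU.traces (hac b) (hkc b)
      hj hjΛ z₀ hs
    have j3 := (hU.kruzkov c hc).jump hU.measurable hU.mem hU.traces (hac c) (hkc c) hj hjΛ z₀ hs
    have j4 := hent.jump hU.measurable hU.mem hU.traces hηc hqc hj hjΛ z₀ hs
    filter_upwards [j1, j2, j3, j4, henv, hU.traces] with t k1 k2 k3 k4 he htr hst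
    have ht := htr (hs.trans_lt hst)
    have hA := (chord_continuous hf c)
    have tl := (hA.tendsto _).comp (ht.tendsto_left (curve z₀ s j t))
    have tr := (hA.tendsto _).comp (ht.tendsto_right (curve z₀ s j t))
    exact flux_le_of_jump hf hL hc (ht.leftTrace_mem (fun x => hU.mem _) _)
      (ht.rightTrace_mem (fun x => hU.mem _) _) hε
      (min_le_of_lowerEnvelope_le tl tr (he hst).1) (le_max_of_le_upperEnvelope tl tr (he hst).2)
      (k1 hst) (k2 hst) (k3 hst) rfl rfl (k4 hst)
  -- the mass grows by at most `L ε² / 2` from each of the two boundary curves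
  have hflux := (hside x₀ g hg hgΛ hξ).and (hside y₀ k hk hkΛ hζ)
  obtain ⟨G, hG, hmass⟩ := hent.exists_ae_mass_le hU.measurable hU.mem hU.traces hηc hqc hg hk hgΛ
    hkΛ x₀ y₀ hs (κ := L * ε ^ 2) (by positivity) (by
      filter_upwards [hflux] with t ht hst _
      have h1 := (ht.1 hst).1
      have h2 := (ht.2 hst).2
      linarith)
  set D : ℝ → ℝ := fun t => max (curve y₀ s k t - curve x₀ s g t) 0 with hD
  have hDc : Continuous D := by
    have := curve_continuous hk hkΛ y₀ s
    have := curve_continuous hg hgΛ x₀ s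
    fun_prop
  have hvol : ∀ t, volume.real (Ioo (curve x₀ s g t) (curve y₀ s k t)) = D t := fun t => by
    rw [Measure.real, Real.volume_Ioo, hD]
    exact ENNReal.toReal_ofReal'
  have hmeas : ∀ t, IntegrableOn (fun x => ε + gap α β (U (x, t)))
      (Ioo (curve x₀ s g t) (curve y₀ s k t)) := fun t => by
    refine Measure.integrableOn_of_bounded (M := ε + M) (by simp)
      (hηc.measurable.comp (hU.measurable.comp measurable_prodMk_right)).aestronglyMeasurable
      (Eventually.of_forall fun x => ?_)
    rw [Real.norm_of_nonneg (by linarith [gap_nonneg (α := α) (β := β) (U (x, t))])]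
    linarith [gap_le_abs_sub hcα (U (x, t)), hM (x, t)]
  have hup : ∀ t, ∫ x in Ioo (curve x₀ s g t) (curve y₀ s k t), (ε + gap α β (U (x, t))) ≤
      (M + ε) * D t := fun t => by
    have := setIntegral_mono (hmeas t) (integrableOn_const (C := M + ε) (by simp)) fun x => by
      linarith [gap_le_abs_sub hcα (U (x, t)), hM (x, t)]
    rwa [setIntegral_const, hvol, smul_eq_mul, mul_comm] at this
  have hlo : ∀ t, ε * D t ≤
      ∫ x in Ioo (curve x₀ s g t) (curve y₀ s k t), (ε + gap α β (U (x, t))) := fun t => by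
    have := setIntegral_mono (integrableOn_const (C := ε) (by simp)) (hmeas t) fun x => by
      linarith [gap_nonneg (α := α) (β := β) (U (x, t))]
    rwa [setIntegral_const, hvol, smul_eq_mul, mul_comm] at this
  have hDs : D s = max (y₀ - x₀) 0 := by simp only [hD, curve_self]
  rw [← hDs]
  change ε * D T ≤ _
  -- pass from almost all pairs of times to the pair `(s, T)`
  by_contra! hlt
  have hH : Continuous fun p : ℝ × ℝ =>
      ε * D p.2 - ((M + ε) * D p.1 + L * ε ^ 2 * (p.2 - p.1)) := by fun_prop
  have hev := hH.continuousAt (x := (s, T)) |>.eventually (lt_mem_nhds (sub_pos.2 hlt))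
  obtain ⟨r, hr, hball⟩ := Metric.eventually_nhds_iff.1 hev
  obtain ⟨τ, hτ, hτG⟩ := exists_mem_Ioo_of_ae hG
    (show s < s + min r (T - s) by have := lt_min hr (sub_pos.2 hT); linarith)
  obtain ⟨T', hT', hTG⟩ := exists_mem_Ioo_of_ae hG (show T < T + r by linarith)
  have h1 : τ < s + r := hτ.2.trans_le (by linarith [min_le_left r (T - s)])
  have h2 : τ < T := hτ.2.trans_le (by linarith [min_le_right r (T - s)])
  have h3 := hball (y := (τ, T')) (by
    rw [Prod.dist_eq, max_lt_iff, Real.dist_eq, Real.dist_eq, abs_of_pos (sub_pos.2 hτ.1),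
      abs_of_pos (sub_pos.2 hT'.1)]
    exact ⟨by linarith, by linarith [hT'.2]⟩)
  have h4 := hmass τ hτG T' hTG hτ.1 (h2.trans hT'.1)
  have h5 := hup τ
  have h6 := hlo T'
  simp only at h3
  linarith

/-- Two Filippov solutions separate at most like the square root of their initial distance. -/
theorem IsTracedSolution.sub_le {f : ℝ → ℝ} (hf : ContDiff ℝ 1 f) {a b : ℝ} {U : ℝ × ℝ → ℝ}
    (hU : IsTracedSolution f a b U) {c : ℝ} (hc : c ∈ Icc a b) {L : ℝ≥0}
    (hL : LipschitzOnWith L (deriv f) (Icc a b)) {M Λ : ℝ} (hM : ∀ p, |U p - c| ≤ M)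
    (hΛ : ∀ p, |chord f c (U p)| ≤ Λ) {s : ℝ}
    (hs : 0 ≤ s) {ξ ζ : ℝ → ℝ} (hξ : IsFilippovSolution (fun p => chord f c (U p)) s ξ)
    (hζ : IsFilippovSolution (fun p => chord f c (U p)) s ζ) {T : ℝ} (hT : s ≤ T) :
    ζ T - ξ T ≤ max (ζ s - ξ s) 0 + 2 * √(L * (T - s) * M * max (ζ s - ξ s) 0) := by
  have hM0 : 0 ≤ M := (abs_nonneg _).trans (hM 0)
  rcases hT.eq_or_lt with rfl | hT
  · simp
  obtain ⟨g, hg, hgΛ, hξg, hgenv⟩ := hξ.exists_curve hΛ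
  obtain ⟨k, hk, hkΛ, hζk, hkenv⟩ := hζ.exists_curve hΛ
  have e1 : ∀ᵐ t, s < t →
      lowerEnvelope (fun p => chord f c (U p)) (curve (ξ s) s g t) t ≤ (g t : EReal) ∧
      (g t : EReal) ≤ upperEnvelope (fun p => chord f c (U p)) (curve (ξ s) s g t) t := by
    filter_upwards [hgenv] with t ht hst
    rw [← hξg t hst.le]; exact ht hst
  have e2 : ∀ᵐ t, s < t →
      lowerEnvelope (fun p => chord f c (U p)) (curve (ζ s) s k t) t ≤ (k t : EReal) ∧
      (k t : EReal) ≤ upperEnvelope (fun p => chord f c (U p)) (curve (ζ s) s k t) t := by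
    filter_upwards [hkenv] with t ht hst
    rw [← hζk t hst.le]; exact ht hst
  have key := fun ε (hε : 0 < ε) =>
    hU.eps_mul_le hf hc hL hM hs hg hk hgΛ hkΛ e1 e2 hε hT
  rw [← hξg T hT.le, ← hζk T hT.le] at key
  set d₀ := max (ζ s - ξ s) 0 with hd₀
  have hd0 : 0 ≤ d₀ := le_max_right _ _
  -- `ε (d - d₀) ≤ M d₀ + ε² L (T - s)` for every `ε`
  have := le_two_sqrt_of_forall (x := max (ζ T - ξ T) 0 - d₀) (p := M * d₀) (q := L * (T - s))
    (mul_nonneg hM0 hd0) fun ε hε => by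
      have := key ε hε
      nlinarith
  rw [show M * d₀ * (L * (T - s)) = L * (T - s) * M * d₀ by ring] at this
  linarith [le_max_left (ζ T - ξ T) 0]

/-- The two-sided form of `IsTracedSolution.sub_le`. In particular, Filippov solutions that start at the
same point coincide. -/
theorem IsTracedSolution.abs_sub_le {f : ℝ → ℝ} (hf : ContDiff ℝ 1 f) {a b : ℝ} {U : ℝ × ℝ → ℝ}
    (hU : IsTracedSolution f a b U) {c : ℝ} (hc : c ∈ Icc a b) {L : ℝ≥0}
    (hL : LipschitzOnWith L (deriv f) (Icc a b)) {M Λ : ℝ} (hM : ∀ p, |U p - c| ≤ M)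
    (hΛ : ∀ p, |chord f c (U p)| ≤ Λ) {s : ℝ}
    (hs : 0 ≤ s) {ξ ζ : ℝ → ℝ} (hξ : IsFilippovSolution (fun p => chord f c (U p)) s ξ)
    (hζ : IsFilippovSolution (fun p => chord f c (U p)) s ζ) {T : ℝ} (hT : s ≤ T) :
    |ζ T - ξ T| ≤ |ζ s - ξ s| + 2 * √(L * (T - s) * M * |ζ s - ξ s|) := by
  have h1 := hU.sub_le hf hc hL hM hΛ hs hξ hζ hT
  have h2 := hU.sub_le hf hc hL hM hΛ hs hζ hξ hT
  have hM0 : 0 ≤ M := (abs_nonneg _).trans (hM 0)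
  have hmono : ∀ d : ℝ, d ≤ |ζ s - ξ s| → max d 0 + 2 * √(L * (T - s) * M * max d 0) ≤
      |ζ s - ξ s| + 2 * √(L * (T - s) * M * |ζ s - ξ s|) := fun d hd => by
    have h3 : max d 0 ≤ |ζ s - ξ s| := max_le hd (abs_nonneg _)
    have h4 : 0 ≤ (L : ℝ) * (T - s) * M :=
      mul_nonneg (mul_nonneg L.2 (sub_nonneg.2 hT)) hM0
    gcongr
  rw [abs_le]
  constructor
  · linarith [hmono (ξ s - ζ s) (by rw [abs_sub_comm]; exact le_abs_self _)]
  · linarith [hmono (ζ s - ξ s) (le_abs_self _)]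

end ConservationLaw

end

/-! ### Existence by Euler polygons -/

noncomputable section

namespace ConservationLaw

/-- The average of the velocity field `A(·, t)` over an interval of length `h` to the right
of `x`. -/
def averagedVelocity (A : ℝ × ℝ → ℝ) (h x t : ℝ) : ℝ := ∫ y, ker h x y * A (y, t)

lemma averagedVelocity_measurable {A : ℝ × ℝ → ℝ} (hA : Measurable A) (h x : ℝ) :
    Measurable (averagedVelocity A h x) := by
  have h1 : StronglyMeasurable (Function.uncurry fun t y => ker h x y * A (y, t)) :=
    (((ker_continuous h x).measurable.comp measurable_snd).mul
      (hA.comp measurable_swap)).stronglyMeasurable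
  exact h1.integral_prod_right.measurable

lemma averagedVelocity_mem {A : ℝ × ℝ → ℝ} (hA : Measurable A) {Λ : ℝ} (hΛ : ∀ p, |A p| ≤ Λ)
    {h x t l r : ℝ} (hh : 0 < h) (hlr : ∀ᵐ y, y ∈ Ioo x (x + h) → A (y, t) ∈ Icc l r) :
    averagedVelocity A h x t ∈ Icc l r := by
  have := abs_le.1 (abs_integral_ker_sub_le hh x (G := fun y => A (y, t)) (l := (l + r) / 2)
    (ε := (r - l) / 2) (hA.comp measurable_prodMk_right) (fun y => hΛ _) (by
      filter_upwards [hlr] with y hy hyI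
      have := hy hyI
      rw [abs_le]
      constructor <;> linarith [this.1, this.2]))
  rw [averagedVelocity]
  constructor <;> linarith [this.1, this.2]

/-- The nodes of the Euler polygon with step `h` that starts at `(x₀, s)`. -/
def eulerNode (A : ℝ × ℝ → ℝ) (x₀ s h : ℝ) : ℕ → ℝ
  | 0 => x₀
  | n + 1 => eulerNode A x₀ s h n +
      ∫ r in (s + n * h)..(s + (n + 1) * h), averagedVelocity A h (eulerNode A x₀ s h n) r

/-- The velocity of the Euler polygon with step `h` that starts at `(x₀, s)`. -/
def eulerVelocity (A : ℝ × ℝ → ℝ) (x₀ s h t : ℝ) : ℝ :=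
  averagedVelocity A h (eulerNode A x₀ s h ⌊(t - s) / h⌋₊) t

lemma eulerVelocity_measurable {A : ℝ × ℝ → ℝ} (hA : Measurable A) (x₀ s h : ℝ) :
    Measurable (eulerVelocity A x₀ s h) := by
  unfold eulerVelocity
  generalize eulerNode A x₀ s h = N
  have h1 : Measurable (Function.uncurry fun (t : ℝ) (n : ℕ) => averagedVelocity A h (N n) t) :=
    measurable_from_prod_countable_left fun n => averagedVelocity_measurable hA h (N n)
  have h2 : Measurable fun t : ℝ => ⌊(t - s) / h⌋₊ :=
    Nat.measurable_floor.comp ((measurable_id.sub_const s).div_const h)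
  exact h1.comp (measurable_id.prodMk h2)

lemma abs_eulerVelocity_le {A : ℝ × ℝ → ℝ} {Λ : ℝ} (hΛ : ∀ p, |A p| ≤ Λ)
    (x₀ s : ℝ) {h : ℝ} (hh : 0 < h) (t : ℝ) : |eulerVelocity A x₀ s h t| ≤ Λ :=
  abs_integral_ker_le hh _ fun _ => hΛ _

lemma curve_add_integral {g : ℝ → ℝ} {Λ : ℝ} (hg : Measurable g) (hΛ : ∀ t, |g t| ≤ Λ)
    (x₀ s t t' : ℝ) : curve x₀ s g t' = curve x₀ s g t + ∫ r in t..t', g r := by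
  rw [curve, curve, add_assoc, intervalIntegral.integral_add_adjacent_intervals
    (intervalIntegrable_of_bdd hg hΛ _ _) (intervalIntegrable_of_bdd hg hΛ _ _)]

lemma curve_eulerVelocity {A : ℝ × ℝ → ℝ} (hA : Measurable A) {Λ : ℝ} (hΛ : ∀ p, |A p| ≤ Λ)
    (x₀ s : ℝ) {h : ℝ} (hh : 0 < h) (n : ℕ) :
    curve x₀ s (eulerVelocity A x₀ s h) (s + n * h) = eulerNode A x₀ s h n := by
  induction n with
  | zero => simp [eulerNode]
  | succ n ih =>
    rw [curve_add_integral (eulerVelocity_measurable hA x₀ s h) (abs_eulerVelocity_le hΛ x₀ s hh)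
      x₀ s (s + n * h), ih, eulerNode]
    push_cast
    congr 1
    refine intervalIntegral.integral_congr_ae ?_
    filter_upwards [Measure.ae_ne volume (s + (n + 1) * h)] with r hr hrI
    rw [uIoc_of_le (by nlinarith)] at hrI
    have hfl : ⌊(r - s) / h⌋₊ = n := by
      refine (Nat.floor_eq_iff (div_nonneg (by nlinarith [hrI.1, show (0:ℝ) ≤ n * h by positivity])
        hh.le)).2 ⟨?_, ?_⟩
      · rw [le_div_iff₀ hh]; linarith [hrI.1]
      · rw [div_lt_iff₀ hh]; linarith [lt_of_le_of_ne hrI.2 hr]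
    rw [eulerVelocity, hfl]

lemma abs_curve_sub_eulerNode_le {A : ℝ × ℝ → ℝ} (hA : Measurable A) {Λ : ℝ} (hΛ : ∀ p, |A p| ≤ Λ)
    (x₀ : ℝ) {s h t : ℝ} (hh : 0 < h) (ht : s ≤ t) :
    |curve x₀ s (eulerVelocity A x₀ s h) t - eulerNode A x₀ s h ⌊(t - s) / h⌋₊| ≤ Λ * h := by
  have hΛ0 : 0 ≤ Λ := (abs_nonneg _).trans (hΛ 0)
  rw [← curve_eulerVelocity hA hΛ x₀ s hh]
  refine (abs_curve_sub_le (eulerVelocity_measurable hA x₀ s h) (abs_eulerVelocity_le hΛ x₀ s hh)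
    x₀ s _ _).trans (mul_le_mul_of_nonneg_left ?_ hΛ0)
  have h1 := Nat.floor_le (div_nonneg (sub_nonneg.2 ht) hh.le)
  have h2 := Nat.lt_floor_add_one ((t - s) / h)
  rw [le_div_iff₀ hh] at h1
  rw [div_lt_iff₀ hh] at h2
  rw [abs_le]
  constructor <;> linarith

/-- Equi-Lipschitz functions that agree at one point have a pointwise convergent subsequence. -/
lemma exists_subseq_tendsto {F : ℕ → ℝ → ℝ} {Λ x₀ s : ℝ} (hs : ∀ n, F n s = x₀)
    (hF : ∀ n t t', |F n t - F n t'| ≤ Λ * |t - t'|) :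
    ∃ φ : ℕ → ℕ, StrictMono φ ∧ ∃ ξ : ℝ → ℝ, ∀ t, Tendsto (fun n => F (φ n) t) atTop (𝓝 (ξ t)) := by
  have hΛ0 : 0 ≤ Λ := by
    have := (abs_nonneg _).trans (hF 0 1 0)
    simpa using this
  obtain ⟨G, -, φ, hφ, hG⟩ := (isCompact_univ_pi fun q : ℚ =>
    isCompact_Icc (a := x₀ - Λ * |q - s|) (b := x₀ + Λ * |q - s|)).tendsto_subseq
    (x := fun n (q : ℚ) => F n q) fun n q _ => by
      have := abs_le.1 (hF n q s)
      rw [hs n] at this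
      constructor <;> linarith [this.1, this.2]
  rw [tendsto_pi_nhds] at hG
  refine ⟨φ, hφ, ?_⟩
  suffices h : ∀ t, ∃ l, Tendsto (fun n => F (φ n) t) atTop (𝓝 l) from
    ⟨fun t => (h t).choose, fun t => (h t).choose_spec⟩
  intro t
  refine cauchySeq_tendsto_of_complete (Metric.cauchySeq_iff.2 fun ε hε => ?_)
  obtain ⟨q, hq1, hq2⟩ := exists_rat_btwn (show t < t + ε / (4 * (Λ + 1)) by
    have : 0 < ε / (4 * (Λ + 1)) := by positivity
    linarith)
  obtain ⟨N, hN⟩ := Metric.cauchySeq_iff.1 (hG q).cauchySeq (ε / 2) (half_pos hε)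
  refine ⟨N, fun m hm n hn => ?_⟩
  have h1 := hN m hm n hn
  have h2 := hF (φ m) t q
  have h3 := hF (φ n) t q
  have h4 : Λ * |t - q| ≤ ε / 4 := by
    rw [abs_of_neg (by linarith)]
    have h5 : (-(t - q)) * (4 * (Λ + 1)) ≤ ε := by
      rw [← le_div_iff₀ (by positivity)]; linarith
    nlinarith
  simp only [Function.comp, Real.dist_eq] at h1 ⊢
  rw [abs_lt] at h1 ⊢
  have h2 := abs_le.1 (h2.trans h4)
  have h3 := abs_le.1 (h3.trans h4)
  constructor <;> linarith [h1.1, h1.2, h2.1, h2.2, h3.1, h3.2]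

/-- An upper bound for the velocities of converging curves bounds the velocity of the limit. -/
lemma ae_deriv_le_of_tendsto {v : ℕ → ℝ → ℝ} {Λ x₀ s : ℝ} (hv : ∀ n, Measurable (v n))
    (hΛ : ∀ n t, |v n t| ≤ Λ) {ξ : ℝ → ℝ}
    (hξ : ∀ t, Tendsto (fun n => curve x₀ s (v n) t) atTop (𝓝 (ξ t))) :
    ∀ᵐ t, DifferentiableAt ℝ ξ t → ∀ R, (∀ᶠ n in atTop, v n t ≤ R) → deriv ξ t ≤ R := by
  -- the primitive of the supremum `W N` of the tail of the velocities grows at least as fast as `ξ`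
  set W : ℕ → ℝ → ℝ := fun N t => ⨆ n, v (N + n) t with hW
  have hbdd : ∀ N t, BddAbove (range fun n => v (N + n) t) := fun N t =>
    ⟨Λ, by rintro _ ⟨n, rfl⟩; exact (abs_le.1 (hΛ _ t)).2⟩
  have hWm : ∀ N, Measurable (W N) := fun N => Measurable.iSup fun n => hv (N + n)
  have hWΛ : ∀ N t, |W N t| ≤ Λ := fun N t => abs_le.2
    ⟨(abs_le.1 (hΛ (N + 0) t)).1.trans (le_ciSup (hbdd N t) 0),
      ciSup_le fun n => (abs_le.1 (hΛ _ t)).2⟩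
  have hle : ∀ N n, N ≤ n → ∀ t, v n t ≤ W N t := fun N n hn t => by
    obtain ⟨m, rfl⟩ := Nat.exists_eq_add_of_le hn
    exact le_ciSup (hbdd N t) m
  have hmono : ∀ N, Monotone fun t => (∫ r in s..t, W N r) - ξ t := by
    intro N t t' htt'
    have h1 : ξ t' - ξ t ≤ ∫ r in t..t', W N r := by
      refine le_of_tendsto ((hξ t').sub (hξ t)) ?_
      filter_upwards [eventually_ge_atTop N] with n hn
      rw [curve_add_integral (hv n) (hΛ n) x₀ s t t', add_sub_cancel_left]
      exact intervalIntegral.integral_mono_on htt' (intervalIntegrable_of_bdd (hv n) (hΛ n) _ _)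
        (intervalIntegrable_of_bdd (hWm N) (hWΛ N) _ _) fun r _ => hle N n hn r
    have h2 := intervalIntegral.integral_add_adjacent_intervals
      (intervalIntegrable_of_bdd (hWm N) (hWΛ N) s t) (intervalIntegrable_of_bdd (hWm N) (hWΛ N) t t')
    simp only
    linarith
  have hd := ae_all_iff.2 fun N =>
    LocallyIntegrable.ae_hasDerivAt_integral (locallyIntegrable_of_bdd (hWm N) (hWΛ N))
  filter_upwards [hd] with t ht hdiff R hR
  obtain ⟨N, hN⟩ := eventually_atTop.1 hR
  have h1 := ((ht N s).sub hdiff.hasDerivAt).deriv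
  have h2 : 0 ≤ deriv (fun t => (∫ r in s..t, W N r) - ξ t) t := (hmono N).deriv_nonneg
  have h3 : W N t ≤ R := ciSup_le fun n => hN _ (Nat.le_add_right N n)
  have h4 : deriv (fun t => (∫ r in s..t, W N r) - ξ t) t = W N t - deriv ξ t := h1
  linarith

lemma ae_le_deriv_of_tendsto {v : ℕ → ℝ → ℝ} {Λ x₀ s : ℝ} (hv : ∀ n, Measurable (v n))
    (hΛ : ∀ n t, |v n t| ≤ Λ) {ξ : ℝ → ℝ}
    (hξ : ∀ t, Tendsto (fun n => curve x₀ s (v n) t) atTop (𝓝 (ξ t))) :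
    ∀ᵐ t, DifferentiableAt ℝ ξ t → ∀ R, (∀ᶠ n in atTop, R ≤ v n t) → R ≤ deriv ξ t := by
  have := ae_deriv_le_of_tendsto (v := fun n t => -v n t) (Λ := Λ) (x₀ := -x₀) (s := s)
    (ξ := fun t => -ξ t) (fun n => (hv n).neg) (fun n t => by rw [abs_neg]; exact hΛ n t) fun t => by
      refine (hξ t).neg.congr fun n => ?_
      simp only [curve, intervalIntegral.integral_neg]; ring
  filter_upwards [this] with t ht hdiff R hR
  have h1 := ht hdiff.neg (-R) (hR.mono fun n hn => neg_le_neg hn)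
  have h2 : deriv (fun t => -ξ t) t = -deriv ξ t := hdiff.hasDerivAt.neg.deriv
  linarith

/-- Bounded velocity fields have Filippov solutions, obtained as limits of Euler polygons for the
averaged velocity. -/
theorem exists_filippovSolution {A : ℝ × ℝ → ℝ} (hA : Measurable A) {Λ : ℝ} (hΛ : ∀ p, |A p| ≤ Λ)
    (x₀ s : ℝ) : ∃ ξ : ℝ → ℝ, IsFilippovSolution A s ξ ∧ ξ s = x₀ := by
  have hΛ0 : 0 ≤ Λ := (abs_nonneg _).trans (hΛ 0)
  set v : ℕ → ℝ → ℝ := fun n => eulerVelocity A x₀ s (width n) with hvdef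
  have hv : ∀ n, Measurable (v n) := fun n => eulerVelocity_measurable hA _ _ _
  have hvΛ : ∀ n t, |v n t| ≤ Λ := fun n => abs_eulerVelocity_le hΛ x₀ s (width_pos n)
  obtain ⟨φ, hφ, ξ, hξ⟩ := exists_subseq_tendsto (F := fun n => curve x₀ s (v n)) (s := s) (x₀ := x₀)
    (fun n => curve_self _ _ _) (fun n => abs_curve_sub_le (hv n) (hvΛ n) x₀ s)
  have hξL : LipschitzWith ⟨Λ, hΛ0⟩ ξ := LipschitzWith.of_dist_le_mul fun t t' =>
    le_of_tendsto' ((hξ t).sub (hξ t')).abs fun n => abs_curve_sub_le (hv _) (hvΛ _) x₀ s t t'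
  have hw : Tendsto (fun n => width (φ n)) atTop (𝓝 0) := tendsto_width.comp hφ.tendsto_atTop
  -- the intervals over which the velocity is averaged shrink to the limit curve
  have hsmall : ∀ t, s < t → ∀ δ > 0, ∀ᶠ n in atTop,
      Ioo (eulerNode A x₀ s (width (φ n)) ⌊(t - s) / width (φ n)⌋₊)
        (eulerNode A x₀ s (width (φ n)) ⌊(t - s) / width (φ n)⌋₊ + width (φ n)) ⊆
      Metric.ball (ξ t) δ := by
    intro t hst δ hδ
    have h1 := Metric.tendsto_nhds.1 (hξ t) (δ / 2) (half_pos hδ)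
    have h2 : Tendsto (fun n => (Λ + 1) * width (φ n)) atTop (𝓝 0) := by simpa using hw.const_mul (Λ + 1)
    filter_upwards [h1, h2.eventually_lt_const (half_pos hδ)] with n h1 h2 y hy
    have h3 := abs_le.1 (abs_curve_sub_eulerNode_le hA hΛ x₀ (width_pos (φ n)) hst.le)
    rw [Real.dist_eq, abs_lt] at h1
    have h4 := width_pos (φ n)
    rw [Metric.mem_ball, Real.dist_eq, abs_lt]
    constructor
    · linarith [hy.1, h1.1, h3.2]
    · linarith [hy.2, h1.2, h3.1]
  refine ⟨ξ, ⟨fun T hT => hξL.lipschitzOnWith.absolutelyContinuousOnInterval, ?_⟩, ?_⟩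
  · rw [ae_restrict_iff' measurableSet_Ioi]
    filter_upwards [hξL.ae_differentiableAt_real,
      ae_deriv_le_of_tendsto (fun n => hv (φ n)) (fun n => hvΛ (φ n)) hξ,
      ae_le_deriv_of_tendsto (fun n => hv (φ n)) (fun n => hvΛ (φ n)) hξ] with t hd hup hlo hst
    refine ⟨hd, ?_, ?_⟩
    · by_contra! hlt
      obtain ⟨R, hR1, hR2⟩ := EReal.lt_iff_exists_real_btwn.1 hlt
      obtain ⟨δ, hδ, hb⟩ := exists_of_lt_lowerEnvelope hR2
      refine absurd (hlo hd R ?_) (not_le.2 (EReal.coe_lt_coe_iff.1 hR1))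
      filter_upwards [hsmall t hst δ hδ] with n hn
      refine (averagedVelocity_mem hA hΛ (width_pos (φ n)) (r := Λ) ?_).1
      filter_upwards [hb] with y hy hyI using ⟨hy (hn hyI), (abs_le.1 (hΛ _)).2⟩
    · by_contra! hlt
      obtain ⟨R, hR1, hR2⟩ := EReal.lt_iff_exists_real_btwn.1 hlt
      obtain ⟨δ, hδ, hb⟩ := exists_of_upperEnvelope_lt hR1
      refine absurd (hup hd R ?_) (not_le.2 (EReal.coe_lt_coe_iff.1 hR2))
      filter_upwards [hsmall t hst δ hδ] with n hn
      refine (averagedVelocity_mem hA hΛ (width_pos (φ n)) (l := -Λ) ?_).2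
      filter_upwards [hb] with y hy hyI using ⟨(abs_le.1 (hΛ _)).1, hy (hn hyI)⟩
  · exact tendsto_nhds_unique (hξ s) (by simp)

end ConservationLaw

end

/-! ### The Filippov flow -/

noncomputable section

namespace ConservationLaw

lemma IsFilippovSolution.mono {A : ℝ × ℝ → ℝ} {s τ : ℝ} {ξ : ℝ → ℝ} (h : IsFilippovSolution A s ξ)
    (hτ : s ≤ τ) : IsFilippovSolution A τ ξ := by
  refine ⟨fun T hT => (h.absCont T (hτ.trans hT)).mono ?_, ?_⟩
  · rw [uIcc_of_le hT, uIcc_of_le (hτ.trans hT)]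
    exact Icc_subset_Icc_left hτ
  · exact ae_restrict_of_ae_restrict_of_subset (Ioi_subset_Ioi hτ) h.inclusion

lemma IsFilippovSolution.abs_sub_le {A : ℝ × ℝ → ℝ} {s Λ : ℝ} {ξ : ℝ → ℝ}
    (h : IsFilippovSolution A s ξ) (hΛ : ∀ p, |A p| ≤ Λ) {t t' : ℝ} (ht : s ≤ t) (ht' : s ≤ t') :
    |ξ t - ξ t'| ≤ Λ * |t - t'| := by
  obtain ⟨g, hg, hgΛ, he, -⟩ := h.exists_curve hΛ
  rw [he t ht, he t' ht']
  exact abs_curve_sub_le hg hgΛ _ _ _ _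

/-- A family of Filippov solutions `t ↦ X t x s` starting at `(x, s)` whose distances are controlled
by `d + 2 √(K t d)`, where `d` is the initial distance. -/
structure IsStableFamily (A : ℝ × ℝ → ℝ) (K Λ : ℝ) (X : ℝ → ℝ → ℝ → ℝ) : Prop where
  nonneg : 0 ≤ K
  bound : ∀ p, |A p| ≤ Λ
  initial : ∀ x s, 0 ≤ s → X s x s = x
  solution : ∀ x s, 0 ≤ s → IsFilippovSolution A s (fun t => X t x s)
  stable : ∀ s ξ ζ T, 0 ≤ s → s ≤ T → IsFilippovSolution A s ξ → IsFilippovSolution A s ζ →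
    |ζ T - ξ T| ≤ |ζ s - ξ s| + 2 * √(K * (T - s) * |ζ s - ξ s|)

namespace IsStableFamily

variable {A : ℝ × ℝ → ℝ} {K Λ : ℝ} {X : ℝ → ℝ → ℝ → ℝ}

lemma nonneg_bound (h : IsStableFamily A K Λ X) : 0 ≤ Λ := (abs_nonneg _).trans (h.bound 0)

lemma eq_of_eq (h : IsStableFamily A K Λ X) {s T : ℝ} {ξ ζ : ℝ → ℝ} (hs : 0 ≤ s) (hT : s ≤ T)
    (hξ : IsFilippovSolution A s ξ) (hζ : IsFilippovSolution A s ζ) (he : ζ s = ξ s) :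
    ζ T = ξ T := by
  have := h.stable s ξ ζ T hs hT hξ hζ
  rw [he, sub_self, abs_zero, mul_zero, Real.sqrt_zero, mul_zero, add_zero] at this
  exact sub_eq_zero.1 (abs_nonpos_iff.1 this)

lemma semigroup (h : IsStableFamily A K Λ X) {x s τ t : ℝ} (hs : 0 ≤ s) (hτ : s ≤ τ) (ht : τ ≤ t) :
    X t (X τ x s) τ = X t x s :=
  h.eq_of_eq (ξ := fun t => X t x s) (ζ := fun t => X t (X τ x s) τ) (hs.trans hτ) ht
    ((h.solution x s hs).mono hτ) (h.solution _ τ (hs.trans hτ)) (h.initial _ _ (hs.trans hτ))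

lemma abs_sub_time_le (h : IsStableFamily A K Λ X) {x s t t' : ℝ} (hs : 0 ≤ s) (ht : s ≤ t)
    (ht' : s ≤ t') : |X t x s - X t' x s| ≤ Λ * |t - t'| :=
  (h.solution x s hs).abs_sub_le h.bound ht ht'

lemma abs_sub_space_le (h : IsStableFamily A K Λ X) {x y s t : ℝ} (hs : 0 ≤ s) (ht : s ≤ t) :
    |X t y s - X t x s| ≤ |y - x| + 2 * √(K * (t - s) * |y - x|) := by
  have := h.stable s _ _ t hs ht (h.solution x s hs) (h.solution y s hs)
  rwa [h.initial x s hs, h.initial y s hs] at this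

/-- The curve from `(x, s₁)` is at a distance at most `Λ |s₂ - s₁|` from `x` at the time `s₂`, from where
it is compared with the curve from `(x, s₂)`. -/
lemma abs_sub_start_le (h : IsStableFamily A K Λ X) {x s₁ s₂ t : ℝ} (h₁ : 0 ≤ s₁) (h₂ : 0 ≤ s₂)
    (ht₁ : s₁ ≤ t) (ht₂ : s₂ ≤ t) :
    |X t x s₂ - X t x s₁| ≤ Λ * |s₂ - s₁| + 2 * √(K * t * (Λ * |s₂ - s₁|)) := by
  wlog h12 : s₁ ≤ s₂ generalizing s₁ s₂
  · rw [abs_sub_comm, abs_sub_comm s₂]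
    exact this h₂ h₁ ht₂ ht₁ (le_of_not_ge h12)
  have hK := h.nonneg
  have hΛ := h.nonneg_bound
  have h3 := h.abs_sub_space_le (x := X s₂ x s₁) (y := x) h₂ ht₂
  rw [h.semigroup h₁ h12 ht₂] at h3
  have h4 : |x - X s₂ x s₁| ≤ Λ * |s₂ - s₁| := by
    have := h.abs_sub_time_le (x := x) h₁ le_rfl h12
    rwa [h.initial x s₁ h₁, abs_sub_comm s₁] at this
  refine h3.trans (add_le_add h4 (mul_le_mul_of_nonneg_left (Real.sqrt_le_sqrt ?_) (by norm_num)))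
  exact mul_le_mul (mul_le_mul_of_nonneg_left (by linarith) hK) h4 (abs_nonneg _)
    (mul_nonneg hK (h₂.trans ht₂))

lemma continuous (h : IsStableFamily A K Λ X) :
    Continuous fun p : flowDomain => X p.1.1 p.1.2.1 p.1.2.2 := by
  have hK := h.nonneg
  rw [continuous_iff_continuousAt]
  rintro ⟨⟨t, x, s⟩, hs, hst⟩
  simp only at hs hst
  -- both curves are followed up to the common time `max t' t`, where the starting points are exchanged
  set B : flowDomain → ℝ := fun p => Λ * |p.1.1 - max p.1.1 t| +
    (|p.1.2.1 - x| + 2 * √(K * max p.1.1 t * |p.1.2.1 - x|)) +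
    (Λ * |p.1.2.2 - s| + 2 * √(K * max p.1.1 t * (Λ * |p.1.2.2 - s|))) +
    Λ * |max p.1.1 t - t| with hB
  have hBc : Continuous B := by fun_prop
  have hB0 : B ⟨(t, x, s), hs, hst⟩ = 0 := by simp [hB]
  rw [ContinuousAt, tendsto_iff_dist_tendsto_zero]
  have hBt := hBc.tendsto ⟨(t, x, s), hs, hst⟩
  rw [hB0] at hBt
  refine squeeze_zero (fun _ => dist_nonneg) (g := B) ?_ hBt
  rintro ⟨⟨t', x', s'⟩, hs', hst'⟩
  simp only at hs' hst'
  simp only [Real.dist_eq, hB]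
  have k1 := h.abs_sub_time_le (x := x') hs' hst' (hst'.trans (le_max_left t' t))
  have k2 := h.abs_sub_space_le (x := x) (y := x') hs' (hst'.trans (le_max_left t' t))
  have k3 := h.abs_sub_start_le (x := x) hs hs' (hst.trans (le_max_right t' t))
    (hst'.trans (le_max_left t' t))
  have k4 := h.abs_sub_time_le (x := x) hs (hst.trans (le_max_right t' t)) hst
  have k5 : √(K * (max t' t - s') * |x' - x|) ≤ √(K * max t' t * |x' - x|) := by
    refine Real.sqrt_le_sqrt (mul_le_mul_of_nonneg_right ?_ (abs_nonneg _))
    exact mul_le_mul_of_nonneg_left (by linarith) hK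
  have e : X t' x' s' - X t x s = (X t' x' s' - X (max t' t) x' s') +
      (X (max t' t) x' s' - X (max t' t) x s') + (X (max t' t) x s' - X (max t' t) x s) +
      (X (max t' t) x s - X t x s) := by ring
  rw [e]
  refine (abs_add_le _ _).trans (add_le_add ((abs_add_le _ _).trans
    (add_le_add ((abs_add_le _ _).trans (add_le_add k1 ?_)) k3)) k4)
  linarith

lemma isFilippovFlow (h : IsStableFamily A K Λ X) : IsFilippovFlow A X :=
  ⟨h.continuous.measurable, h.initial, h.solution, fun _ _ _ _ hs hτ ht => h.semigroup hs hτ ht⟩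

lemma holder_space (h : IsStableFamily A K Λ X) (T R : ℝ) : ∃ C : ℝ, ∀ x y s t, 0 ≤ s → s ≤ t →
    t ≤ T → |y - x| ≤ R → |X t y s - X t x s| ≤ C * |y - x| ^ (1 / 2 : ℝ) := by
  refine ⟨√R + 2 * √(K * T), fun x y s t hs hst hT hR => ?_⟩
  rw [← Real.sqrt_eq_rpow]
  have hK := h.nonneg
  have h1 : |y - x| ≤ √R * √|y - x| := by
    conv_lhs => rw [← Real.mul_self_sqrt (abs_nonneg (y - x))]
    exact mul_le_mul_of_nonneg_right (Real.sqrt_le_sqrt hR) (Real.sqrt_nonneg _)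
  have h2 : √(K * (t - s) * |y - x|) ≤ √(K * T) * √|y - x| := by
    rw [← Real.sqrt_mul' _ (abs_nonneg _)]
    refine Real.sqrt_le_sqrt (mul_le_mul_of_nonneg_right ?_ (abs_nonneg _))
    exact mul_le_mul_of_nonneg_left (by linarith) hK
  have h3 := h.abs_sub_space_le (x := x) (y := y) hs hst
  linarith

lemma holder_start (h : IsStableFamily A K Λ X) (T : ℝ) : ∃ C : ℝ, ∀ x s₁ s₂ t, 0 ≤ s₁ → 0 ≤ s₂ →
    s₁ ≤ t → s₂ ≤ t → t ≤ T → |X t x s₂ - X t x s₁| ≤ C * |s₂ - s₁| ^ (1 / 2 : ℝ) := by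
  refine ⟨Λ * √T + 2 * √(K * T * Λ), fun x s₁ s₂ t h₁ h₂ ht₁ ht₂ hT => ?_⟩
  rw [← Real.sqrt_eq_rpow]
  have hK := h.nonneg
  have hΛ := h.nonneg_bound
  have hd : |s₂ - s₁| ≤ T := by rw [abs_le]; constructor <;> linarith
  have h1 : Λ * |s₂ - s₁| ≤ Λ * (√T * √|s₂ - s₁|) := by
    refine mul_le_mul_of_nonneg_left ?_ hΛ
    conv_lhs => rw [← Real.mul_self_sqrt (abs_nonneg (s₂ - s₁))]
    exact mul_le_mul_of_nonneg_right (Real.sqrt_le_sqrt hd) (Real.sqrt_nonneg _)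
  have h2 : √(K * t * (Λ * |s₂ - s₁|)) ≤ √(K * T * Λ) * √|s₂ - s₁| := by
    rw [← Real.sqrt_mul' _ (abs_nonneg _), ← mul_assoc]
    refine Real.sqrt_le_sqrt (mul_le_mul_of_nonneg_right ?_ (abs_nonneg _))
    exact mul_le_mul_of_nonneg_right (mul_le_mul_of_nonneg_left hT hK) hΛ
  have h3 := h.abs_sub_start_le (x := x) h₁ h₂ ht₁ ht₂
  linarith

end IsStableFamily

/-- Filippov flows only depend on the velocity up to null sets of the half plane. -/
lemma IsFilippovFlow.congr {A B : ℝ × ℝ → ℝ} {X : ℝ → ℝ → ℝ → ℝ}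
    (hAB : ∀ᵐ t : ℝ, 0 < t → ∀ᵐ y, A (y, t) = B (y, t)) (h : IsFilippovFlow A X) :
    IsFilippovFlow B X :=
  ⟨h.measurable, h.initial, fun x s hs => (h.solution x s hs).congr hs hAB, h.semigroup⟩

/-- An entropy solution agrees on the upper half plane with a traced solution whose values lie in
the part of `[a, b]` within distance `‖u₀ - c‖` of `c`. -/
lemma IsEntropySolution.exists_traced {f u₀ : ℝ → ℝ} {u : ℝ × ℝ → ℝ} (hf : ContDiff ℝ 1 f)
    (hu₀ : MemLp u₀ ⊤ volume) (hBV : IsBVLoc u₀) (hu : IsEntropySolution f u₀ u) {a b c : ℝ}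
    (hc : c ∈ Icc a b) (hab : ∀ᵐ x : ℝ, u₀ x ∈ Icc a b) :
    ∃ a' b' U, c ∈ Icc a' b' ∧ Icc a' b' ⊆ Icc a b ∧ IsTracedSolution f a' b' U ∧
      (∀ p, |U p - c| ≤ (eLpNorm (fun z => u₀ z - c) ⊤ volume).toReal) ∧
      ∀ᵐ p : ℝ × ℝ, 0 < p.2 → U p = u p := by
  set M := (eLpNorm (fun z => u₀ z - c) ⊤ volume).toReal with hM
  have hM0 : 0 ≤ M := ENNReal.toReal_nonneg
  have hmem : MemLp (fun z => u₀ z - c) ⊤ volume := hu₀.sub (memLp_top_const c)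
  have hMae := ae_abs_le_of_memLp_top hmem
  -- the interval is shrunk so that the maximum principle yields the bound by `‖u₀ - c‖` as well
  have hc' : c ∈ Icc (max a (c - M)) (min b (c + M)) :=
    ⟨max_le hc.1 (by linarith), le_min hc.2 (by linarith)⟩
  have hab' : ∀ᵐ x : ℝ, u₀ x ∈ Icc (max a (c - M)) (min b (c + M)) := by
    filter_upwards [hab, hMae] with x h1 h2
    have h3 := abs_le.1 h2
    exact ⟨max_le h1.1 (by linarith [h3.1]), le_min h1.2 (by linarith [h3.2])⟩
  obtain ⟨U, hU, hUab, hUk, hUu, v₀, hv₀, hv₀u, hU0⟩ :=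
    hu.exists_kruzkov hf hu₀ (hc'.1.trans hc'.2) hab'
  refine ⟨_, _, U, hc', Icc_subset_Icc (le_max_left _ _) (min_le_left _ _),
    ⟨hU, hUab, hUk, hUk.ae_hasTraces hf hBV hv₀ hv₀u hU hUab hU0⟩, fun p => ?_, hUu⟩
  have h1 := (le_max_right a (c - M)).trans (hUab p).1
  have h2 := (hUab p).2.trans (min_le_right b (c + M))
  rw [abs_le]
  constructor <;> linarith

end ConservationLaw

end

theorem theorem1p4
    (f : ℝ → ℝ) (hf : ContDiff ℝ 1 f)
    (u₀ : ℝ → ℝ) (hu₀ : MemLp u₀ ⊤ volume) (hBV : ConservationLaw.IsBVLoc u₀)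
    (u : ℝ × ℝ → ℝ) (hu : ConservationLaw.IsEntropySolution f u₀ u)
    (c : ℝ) (a b : ℝ) (hc : c ∈ Icc a b) (hab : ∀ᵐ x : ℝ, u₀ x ∈ Icc a b)
    (L : ℝ≥0) (hL : LipschitzOnWith L (deriv f) (Icc a b)) :
    ∃ X : ℝ → ℝ → ℝ → ℝ,
      -- `X` is the unique Filippov flow of the velocity field
      ConservationLaw.IsFilippovFlow (ConservationLaw.velocity f u c) X ∧
      (∀ Y : ℝ → ℝ → ℝ → ℝ,
        ConservationLaw.IsFilippovFlow (ConservationLaw.velocity f u c) Y →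
          ∀ x s t, 0 ≤ s → s ≤ t → Y t x s = X t x s) ∧
      -- Lipschitz continuity in `t`
      (∃ M : ℝ≥0, ∀ x s, 0 ≤ s → LipschitzOnWith M (fun t => X t x s) (Ici s)) ∧
      -- the quantitative estimate in `x`
      (∀ x y s t, 0 ≤ s → s ≤ t →
        |X t y s - X t x s| ≤ |y - x| +
          2 * √(L * (t - s) * (eLpNorm (fun z => u₀ z - c) ⊤ volume).toReal * |y - x|)) ∧
      -- Hölder continuity in `x` with exponent one half
      (∀ T R : ℝ, ∃ C : ℝ, ∀ x y s t, 0 ≤ s → s ≤ t → t ≤ T → |y - x| ≤ R →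
        |X t y s - X t x s| ≤ C * |y - x| ^ (1 / 2 : ℝ)) ∧
      -- Hölder continuity in `s` with exponent one half
      (∀ T : ℝ, ∃ C : ℝ, ∀ x s₁ s₂ t, 0 ≤ s₁ → 0 ≤ s₂ → s₁ ≤ t → s₂ ≤ t → t ≤ T →
        |X t x s₂ - X t x s₁| ≤ C * |s₂ - s₁| ^ (1 / 2 : ℝ)) := by
  obtain ⟨a', b', U, hc', hsub, hU, hM, hUu⟩ := hu.exists_traced hf hu₀ hBV hc hab
  set M := (eLpNorm (fun z => u₀ z - c) ⊤ volume).toReal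
  have hM0 : 0 ≤ M := ENNReal.toReal_nonneg
  have hL' := hL.mono hsub
  obtain ⟨Λ, hΛ0, hΛ1, hΛ2⟩ := ConservationLaw.exists_lipschitz_bound hf (max |a'| |b'|)
  have hR : ∀ v ∈ Icc a' b', v ∈ Icc (-max |a'| |b'|) (max |a'| |b'|) := fun v hv =>
    abs_le.1 (abs_le_max_abs_abs hv.1 hv.2)
  have hΛ : ∀ p, |ConservationLaw.chord f c (U p)| ≤ Λ := fun p =>
    ConservationLaw.abs_chord_le (hΛ1 c (hR c hc')) (hΛ2 _ (hR _ (hU.mem p)) _ (hR _ hc'))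
  have hA : Measurable fun p => ConservationLaw.chord f c (U p) :=
    (ConservationLaw.chord_continuous hf c).measurable.comp hU.measurable
  -- on almost every time slice the velocity of `u` is that of its traced representative `U`
  have hAB : ∀ᵐ t : ℝ, 0 < t → ∀ᵐ y,
      ConservationLaw.chord f c (U (y, t)) = ConservationLaw.velocity f u c (y, t) := by
    filter_upwards [ConservationLaw.ae_fiber hUu] with t ht ht0
    filter_upwards [ht] with y hy
    rw [ConservationLaw.velocity_eq, hy ht0]
  have hBA : ∀ᵐ t : ℝ, 0 < t → ∀ᵐ y,
      ConservationLaw.velocity f u c (y, t) = ConservationLaw.chord f c (U (y, t)) := by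
    filter_upwards [hAB] with t ht ht0
    filter_upwards [ht ht0] with y hy using hy.symm
  -- any choice of Filippov solutions will do, since the stability estimate makes them unique
  choose ξ hξ hξ0 using ConservationLaw.exists_filippovSolution hA hΛ
  obtain ⟨X, hX0, hXs⟩ : ∃ X : ℝ → ℝ → ℝ → ℝ, (∀ x s, X s x s = x) ∧ ∀ x s,
      ConservationLaw.IsFilippovSolution (fun p => ConservationLaw.chord f c (U p)) s
        (fun t => X t x s) := ⟨fun t x s => ξ x s t, hξ0, hξ⟩
  have hX : ConservationLaw.IsStableFamily (fun p => ConservationLaw.chord f c (U p)) (L * M) Λ X := by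
    refine ⟨mul_nonneg L.2 hM0, hΛ, fun x s _ => hX0 x s, fun x s _ => hXs x s,
      fun s ξ ζ T hs hT h1 h2 => ?_⟩
    rw [mul_right_comm (L : ℝ) M]
    exact hU.abs_sub_le hf hc' hL' hM hΛ hs h1 h2 hT
  have hflow : ConservationLaw.IsFilippovFlow (ConservationLaw.velocity f u c) X :=
    hX.isFilippovFlow.congr (B := ConservationLaw.velocity f u c) hAB
  refine ⟨X, hflow, fun Y hY x s t hs hst => ?_,
    ⟨⟨Λ, hΛ0⟩, fun x s hs => ?_⟩, fun x y s t hs hst => ?_, hX.holder_space, hX.holder_start⟩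
  · have hY' := hY.congr (B := fun p => ConservationLaw.chord f c (U p)) hBA
    exact hX.eq_of_eq (ξ := fun t => X t x s) (ζ := fun t => Y t x s) hs hst (hXs x s)
      (hY'.solution x s hs) ((hY'.initial x s hs).trans (hX0 x s).symm)
  · exact LipschitzOnWith.of_dist_le_mul fun t ht t' ht' => hX.abs_sub_time_le hs ht ht'
  · have := hX.abs_sub_space_le (x := x) (y := y) hs hst
    rwa [mul_right_comm (L : ℝ) M] at this
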